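/- Let $q\in(0,1)$. **The algebras.** Let $\mathcal O(SU_q(3))$ be the universal unital complex $*$-algebra generated by elements $u_{ij}$, $1\le i,j\le 3$, subject to the relations that the matrix $\mathbf u=(u_{ij})$ is unitary, i.e. $\sum_k u_{ki}^*u_{kj}=\delta_{ij}=\sum_k u_{ik}u_{jk}^*$, and that for all $j_1,j_2,j_3\in\{1,2,3\}$ $$\sum_{i_1,i_2,i_3=1}^{3}E_{i_1i_2i_3}\,u_{j_1i_1}u_{j_2i_2}u_{j_3i_3}=E_{j_1j_2j_3},$$ where $E_{i_1i_2i_3}=(-q)^{I(i_1,i_2,i_3)}$ if $i_1,i_2,i_3$ are pairwise distinct, $I$ denoting the number of inversions, and $E_{i_1i_2i_3}=0$ otherwise. It is a Hopf $*$-algebra with $\Delta(u_{ij})=\sum_k u_{ik}\otimes u_{kj}$, $\varepsilon(u_{ij})=\delta_{ij}$, $S(u_{ij})=u_{ji}^*$. Let $\mathcal O(U_q(2))$ be the universal unital complex $*$-algebra generated by a central unitary $u$ and elements $\alpha,\gamma$ with $$\alpha\gamma=q\gamma\alpha,\quad \alpha\gamma^*=q\gamma^*\alpha,\quad \gamma\gamma^*=\gamma^*\gamma,\quad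 \alpha^*\alpha+\gamma\gamma^*=1,\quad \alpha\alpha^*+q^2\gamma\gamma^*=1.$$ It is a Hopf $*$-algebra whose structure is determined by the matrix $$\mathbf v=\begin{pmatrix}u&0&0\\0&\alpha&-q\gamma^*u^*\\0&\gamma&\alpha^*u^*\end{pmatrix},\qquad \Delta(v_{ij})=\sum_k v_{ik}\otimes v_{kj},\quad \varepsilon(v_{ij})=\delta_{ij},\quad S(v_{ij})=v_{ji}^*.$$ Let $\pi:\mathcal O(SU_q(3))\to\mathcal O(U_q(2))$ be the unital $*$-algebra homomorphism with $\pi(u_{ij})=v_{ij}$, and put $$\varrho=(\mathrm{id}\otimes\pi)\circ\Delta:\ \mathcal O(SU_q(3))\to\mathcal O(SU_q(3))\otimes\mathcal O(U_q(2)).$$ **The quantum projective plane.** For $z=(z_1,z_2)\in\mathbb T^2$ (with $|z_1|=|z_2|=1$) let $\mu_z$ be the $*$-automorphism of $\mathcal O(SU_q(3))$ with $\mu_z(u_{i1})=z_1u_{i1}$, $\mu_z(u_{i2})=z_2u_{i2}$, $\mu_z(u_{i3})=\overline{z_1z_2}\,u_{i3}$. Let $\mathcal O(S^5_q)$ be the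 unital $*$-subalgebra of $\mathcal O(SU_q(3))$ generated by the first column $u_{11},u_{21},u_{31}$, and let $$\mathcal O(\mathbb CP^2_q)=\{b\in\mathcal O(S^5_q)\ :\ \mu_z(b)=b\ \text{ for all } z\in\mathbb T^2\}.$$ **Principal comodule algebras.** Let $H$ be a Hopf algebra and let $\rho:A\to A\otimes H$ be a linear map on a unital algebra $A$. Then $(A,\rho)$ is a *principal $H$-comodule algebra* if 1. $\rho$ is a coassociative, counital right coaction and a unital algebra map; 2. the antipode of $H$ is bijective; 3. $A$ is faithfully flat as a left module over the coinvariant subalgebra $A^{\mathrm{co}H}=\{b\in A:\rho(b)=b\otimes1\}$; 4. the canonical map $A\otimes_{A^{\mathrm{co}H}}A\to A\otimes H$, $a\otimes a'\mapsto (a\otimes 1)\rho(a')$, is bijective. **Claim.** $(\mathcal O(SU_q(3)),\varrho)$ is a principal $\mathcal O(U_q(2))$-comodule algebra, and its coinvariant subalgebra is $$\mathcal O(SU_q(3))^{\mathrm{co}\,\mathcal O(U_q(2))}=\mathcal O(\mathbb CP^2_q).$$ -/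

import Mathlib

noncomputable section
set_option linter.unusedSimpArgs false
open scoped TensorProduct

namespace QBundle

/-! ## Universal unital star-algebras given by generators and relations -/

/-- The free unital complex star-algebra on a set `X` of generators, realised as the free algebra on
the letters `inl x` (standing for `x`) and `inr x` (standing for the adjoint of `x`). -/
def FreeStar (X : Type) : Type := FreeAlgebra ℂ (X ⊕ X)

namespace FreeStar

variable {X : Type}

instance : Ring (FreeStar X) := inferInstanceAs (Ring (FreeAlgebra ℂ (X ⊕ X)))

instance : Algebra ℂ (FreeStar X) := inferInstanceAs (Algebra ℂ (FreeAlgebra ℂ (X ⊕ X)))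

/-- The letters of the free star-algebra. -/
def letter (x : X ⊕ X) : FreeStar X := FreeAlgebra.ι ℂ x

/-- The generators of the free star-algebra. -/
def of (x : X) : FreeStar X := letter (Sum.inl x)

/-- Extension of a map on letters to an algebra homomorphism. -/
def lift {B : Type*} [Semiring B] [Algebra ℂ B] (f : X ⊕ X → B) : FreeStar X →ₐ[ℂ] B :=
  FreeAlgebra.lift ℂ f

@[simp]
theorem lift_letter {B : Type*} [Semiring B] [Algebra ℂ B] (f : X ⊕ X → B) (x : X ⊕ X) :
    lift f (letter x) = f x :=
  FreeAlgebra.lift_ι_apply f x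

theorem induction {C : FreeStar X → Prop} (hs : ∀ c : ℂ, C (algebraMap ℂ (FreeStar X) c))
    (hl : ∀ x, C (letter x)) (hm : ∀ a b, C a → C b → C (a * b))
    (ha : ∀ a b, C a → C b → C (a + b)) (a : FreeStar X) : C a :=
  FreeAlgebra.induction ℂ (X ⊕ X) (motive := C) hs hl hm ha a

/-- The opposite of the free star-algebra, with scalars acting through complex conjugation. -/
abbrev conjOpAlgebra (X : Type) : Algebra ℂ (FreeStar X)ᵐᵒᵖ :=
  ((algebraMap ℂ (FreeStar X)ᵐᵒᵖ).comp (starRingEnd ℂ)).toAlgebra' fun c x =>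
    Algebra.commutes (starRingEnd ℂ c) x

/-- The adjoint operation, as a ring homomorphism to the opposite ring: it is conjugate-linear,
reverses products, and exchanges `inl x` and `inr x`. -/
def starHom (X : Type) : FreeStar X →+* (FreeStar X)ᵐᵒᵖ :=
  letI := conjOpAlgebra X
  (lift fun x => MulOpposite.op (letter x.swap) : FreeStar X →ₐ[ℂ] (FreeStar X)ᵐᵒᵖ).toRingHom

theorem starHom_letter (x : X ⊕ X) : starHom X (letter x) = MulOpposite.op (letter x.swap) :=
  letI := conjOpAlgebra X
  lift_letter _ x

theorem starHom_algebraMap (c : ℂ) : starHom X (algebraMap ℂ (FreeStar X) c) =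
    MulOpposite.op (algebraMap ℂ (FreeStar X) (starRingEnd ℂ c)) :=
  letI := conjOpAlgebra X
  (lift fun x => MulOpposite.op (letter x.swap) :
    FreeStar X →ₐ[ℂ] (FreeStar X)ᵐᵒᵖ).commutes c

instance : StarRing (FreeStar X) where
  star a := (starHom X a).unop
  star_involutive a := by
    induction a using induction with
    | hs c => simp [starHom_algebraMap]
    | hl x => simp [starHom_letter]
    | hm a b ha hb => simp [ha, hb]
    | ha a b ha hb => simp [ha, hb]
  star_mul a b := by simp
  star_add a b := by simp

theorem star_letter (x : X ⊕ X) : star (letter x) = letter x.swap :=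
  congrArg MulOpposite.unop (starHom_letter x)

theorem star_algebraMap (c : ℂ) : star (algebraMap ℂ (FreeStar X) c) =
    algebraMap ℂ (FreeStar X) (star c) :=
  congrArg MulOpposite.unop (starHom_algebraMap c)

instance : StarModule ℂ (FreeStar X) where
  star_smul c a := by
    rw [Algebra.smul_def, star_mul, star_algebraMap, ← Algebra.commutes, ← Algebra.smul_def]

theorem star_of (x : X) : star (of x) = letter (Sum.inr x) := star_letter _

@[simp]
theorem lift_of {B : Type*} [Semiring B] [Algebra ℂ B] (f : X ⊕ X → B) (x : X) :
    lift f (of x) = f (Sum.inl x) :=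
  lift_letter f _

@[simp]
theorem lift_star_of {B : Type*} [Semiring B] [Algebra ℂ B] (f : X ⊕ X → B) (x : X) :
    lift f (star (of x)) = f (Sum.inr x) := by
  rw [star_of, lift_letter]

end FreeStar

/-- The closure of a set of relations under the adjoint operation. -/
def StarRel {X : Type} (r : FreeStar X → FreeStar X → Prop) (a b : FreeStar X) : Prop :=
  r a b ∨ r (star a) (star b)

/-- The universal unital star-algebra generated by `X` subject to the relations `r`. -/
def StarPres {X : Type} (r : FreeStar X → FreeStar X → Prop) : Type := RingQuot (StarRel r)

namespace StarPres

variable {X : Type} {r : FreeStar X → FreeStar X → Prop}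

instance : Ring (StarPres r) := inferInstanceAs (Ring (RingQuot (StarRel r)))

instance : Algebra ℂ (StarPres r) := inferInstanceAs (Algebra ℂ (RingQuot (StarRel r)))

instance : StarRing (StarPres r) :=
  RingQuot.starRing (StarRel r) fun a b h =>
    h.elim (fun h => Or.inr (by rwa [star_star, star_star])) Or.inl

/-- The quotient map. -/
def mk (r : FreeStar X → FreeStar X → Prop) : FreeStar X →ₐ[ℂ] StarPres r :=
  RingQuot.mkAlgHom ℂ (StarRel r)

theorem mk_surjective : Function.Surjective (mk r) := RingQuot.mkAlgHom_surjective ℂ (StarRel r)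

theorem star_mk (a : FreeStar X) : star (mk r a) = mk r (star a) := by
  have h : ∀ a, mk r a = RingQuot.mkRingHom (StarRel r) a := fun a =>
    congrArg (fun f : FreeStar X →+* RingQuot (StarRel r) => f a)
      (RingQuot.mkAlgHom_coe ℂ (StarRel r))
  rw [h, h, RingQuot.mkRingHom_def]
  rfl

instance : StarModule ℂ (StarPres r) where
  star_smul c a := by
    obtain ⟨a, rfl⟩ := mk_surjective a
    rw [← map_smul, star_mk, star_mk, star_smul, map_smul]

theorem mk_rel {a b : FreeStar X} (h : r a b) : mk r a = mk r b :=
  RingQuot.mkAlgHom_rel ℂ (Or.inl h)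

/-- The generators of the presented star-algebra. -/
def gen (r : FreeStar X → FreeStar X → Prop) (x : X) : StarPres r := mk r (FreeStar.of x)

theorem star_gen (x : X) : star (gen r x) = mk r (FreeStar.letter (Sum.inr x)) := by
  rw [gen, star_mk, FreeStar.star_of]

theorem mk_eq_lift : mk r = FreeStar.lift (Sum.elim (gen r) fun x => star (gen r x)) := by
  refine AlgHom.ext fun a => ?_
  induction a using FreeStar.induction with
  | hs c => simp
  | hl x =>
    cases x with
    | inl x => rw [FreeStar.lift_letter]; rfl
    | inr x => rw [FreeStar.lift_letter, Sum.elim_inr, star_gen]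
  | hm a b ha hb => simp [ha, hb]
  | ha a b ha hb => simp [ha, hb]

/-- An algebra homomorphism out of a presented star-algebra, given by the images of the generators
and of their adjoints; the relations and their adjoints have to be respected. -/
def liftAlg {B : Type*} [Semiring B] [Algebra ℂ B] (f : X ⊕ X → B)
    (h : ∀ a b, r a b → FreeStar.lift f a = FreeStar.lift f b)
    (h' : ∀ a b, r a b → FreeStar.lift f (star a) = FreeStar.lift f (star b)) :
    StarPres r →ₐ[ℂ] B :=
  RingQuot.liftAlgHom ℂ ⟨FreeStar.lift f, fun a b hab => hab.elim (h a b) fun hab => by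
    simpa using h' _ _ hab⟩

theorem liftAlg_mk {B : Type*} [Semiring B] [Algebra ℂ B] (f : X ⊕ X → B)
    (h : ∀ a b, r a b → FreeStar.lift f a = FreeStar.lift f b)
    (h' : ∀ a b, r a b → FreeStar.lift f (star a) = FreeStar.lift f (star b)) (a : FreeStar X) :
    liftAlg f h h' (mk r a) = FreeStar.lift f a :=
  RingQuot.liftAlgHom_mkAlgHom_apply ℂ _ _ a

@[simp]
theorem liftAlg_gen {B : Type*} [Semiring B] [Algebra ℂ B] (f : X ⊕ X → B)
    (h : ∀ a b, r a b → FreeStar.lift f a = FreeStar.lift f b)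
    (h' : ∀ a b, r a b → FreeStar.lift f (star a) = FreeStar.lift f (star b)) (x : X) :
    liftAlg f h h' (gen r x) = f (Sum.inl x) := by
  rw [gen, liftAlg_mk, FreeStar.of, FreeStar.lift_letter]

@[simp]
theorem liftAlg_star_gen {B : Type*} [Semiring B] [Algebra ℂ B] (f : X ⊕ X → B)
    (h : ∀ a b, r a b → FreeStar.lift f a = FreeStar.lift f b)
    (h' : ∀ a b, r a b → FreeStar.lift f (star a) = FreeStar.lift f (star b)) (x : X) :
    liftAlg f h h' (star (gen r x)) = f (Sum.inr x) := by
  rw [star_gen, liftAlg_mk, FreeStar.lift_letter]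

/-- A subalgebra containing the generators and their adjoints is everything. -/
theorem subalgebra_eq_top (s : Subalgebra ℂ (StarPres r)) (h : ∀ x, gen r x ∈ s)
    (h' : ∀ x, star (gen r x) ∈ s) : s = ⊤ := by
  refine eq_top_iff.2 fun a ha => ?_
  clear ha
  obtain ⟨a, rfl⟩ := mk_surjective a
  induction a using FreeStar.induction with
  | hs c => rw [AlgHom.commutes]; exact s.algebraMap_mem c
  | hl x =>
    cases x with
    | inl x => exact h x
    | inr x => rw [← star_gen]; exact h' x
  | hm a b ha hb => rw [map_mul]; exact s.mul_mem ha hb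
  | ha a b ha hb => rw [map_add]; exact s.add_mem ha hb

theorem algHom_ext {B : Type*} [Semiring B] [Algebra ℂ B] {f g : StarPres r →ₐ[ℂ] B}
    (h : ∀ x, f (gen r x) = g (gen r x)) (h' : ∀ x, f (star (gen r x)) = g (star (gen r x))) :
    f = g := by
  have := subalgebra_eq_top (AlgHom.equalizer f g) h h'
  refine AlgHom.ext fun a => ?_
  have ha : a ∈ AlgHom.equalizer f g := this ▸ Algebra.mem_top
  exact ha

/-- The evaluation of star-polynomials at elements of a star-algebra. -/
abbrev eval {B : Type*} [Ring B] [StarRing B] [Algebra ℂ B] (f : X → B) : FreeStar X →ₐ[ℂ] B :=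
  FreeStar.lift (Sum.elim f fun x => star (f x))

theorem eval_star {B : Type*} [Ring B] [StarRing B] [Algebra ℂ B] [StarModule ℂ B] (f : X → B)
    (a : FreeStar X) : eval f (star a) = star (eval f a) := by
  induction a using FreeStar.induction with
  | hs c => rw [FreeStar.star_algebraMap, AlgHom.commutes, AlgHom.commutes, algebraMap_star_comm]
  | hl x => cases x <;> simp [FreeStar.star_letter]
  | hm a b ha hb => simp [ha, hb]
  | ha a b ha hb => simp [ha, hb]

theorem eval_of {B : Type*} [Ring B] [StarRing B] [Algebra ℂ B] (f : X → B) (x : X) :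
    eval f (FreeStar.of x) = f x := by
  rw [eval, FreeStar.of, FreeStar.lift_letter, Sum.elim_inl]

theorem eval_star_of {B : Type*} [Ring B] [StarRing B] [Algebra ℂ B] (f : X → B) (x : X) :
    eval f (star (FreeStar.of x)) = star (f x) := by
  rw [eval, FreeStar.star_of, FreeStar.lift_letter, Sum.elim_inr]

theorem mk_eq_eval (a : FreeStar X) : mk r a = eval (gen r) a := by rw [mk_eq_lift]

/-- The universal property: elements of a star-algebra satisfying the relations determine a
star-homomorphism. -/
def lift {B : Type*} [Ring B] [StarRing B] [Algebra ℂ B] [StarModule ℂ B] (f : X → B)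
    (h : ∀ a b, r a b → eval f a = eval f b) : StarPres r →⋆ₐ[ℂ] B :=
  { liftAlg (Sum.elim f fun x => star (f x)) h
      (fun a b hab => by rw [eval_star, eval_star, h a b hab]) with
    map_star' := fun a => by
      obtain ⟨a, rfl⟩ := mk_surjective a
      simp only [star_mk]
      exact (liftAlg_mk _ _ _ _).trans ((eval_star f a).trans
        (congrArg star (liftAlg_mk _ _ _ _).symm)) }

@[simp]
theorem lift_gen {B : Type*} [Ring B] [StarRing B] [Algebra ℂ B] [StarModule ℂ B] (f : X → B)
    (h : ∀ a b, r a b → eval f a = eval f b) (x : X) : lift f h (gen r x) = f x :=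
  liftAlg_gen (Sum.elim f fun x => star (f x)) h
    (fun a b hab => by rw [eval_star, eval_star, h a b hab]) x

end StarPres

/-! ## Tensor products over a noncommutative ring and faithful flatness -/

/-- The tensor product of a right module `N` (a module over the opposite ring) and a left module `M`
over a not necessarily commutative ring `B`. -/
def BalancedTensor (B N M : Type*) [Ring B] [AddCommGroup N] [Module Bᵐᵒᵖ N] [AddCommGroup M]
    [Module B M] : Type _ :=
  (N ⊗[ℤ] M) ⧸ AddSubgroup.closure
    {x : N ⊗[ℤ] M | ∃ (n : N) (b : B) (m : M), x = (MulOpposite.op b • n) ⊗ₜ m - n ⊗ₜ (b • m)}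

namespace BalancedTensor

variable {B N N' M : Type*} [Ring B] [AddCommGroup N] [Module Bᵐᵒᵖ N] [AddCommGroup N']
  [Module Bᵐᵒᵖ N'] [AddCommGroup M] [Module B M]

instance : AddCommGroup (BalancedTensor B N M) :=
  inferInstanceAs (AddCommGroup ((N ⊗[ℤ] M) ⧸ AddSubgroup.closure
    {x : N ⊗[ℤ] M | ∃ (n : N) (b : B) (m : M), x = (MulOpposite.op b • n) ⊗ₜ m - n ⊗ₜ (b • m)}))

/-- The class of the elementary tensor of `n` and `m`. -/
def tmul (B : Type*) [Ring B] [Module Bᵐᵒᵖ N] [Module B M] (n : N) (m : M) :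
    BalancedTensor B N M :=
  QuotientAddGroup.mk (n ⊗ₜ[ℤ] m)

/-- The additive map determined by a biadditive balanced map. -/
def lift {P : Type*} [AddCommGroup P] (f : N →+ M →+ P)
    (h : ∀ (n : N) (b : B) (m : M), f (MulOpposite.op b • n) m = f n (b • m)) :
    BalancedTensor B N M →+ P :=
  QuotientAddGroup.lift _
    (TensorProduct.liftAddHom f fun z n m => by rw [map_zsmul, map_zsmul]; rfl) <| by
    rw [AddSubgroup.closure_le]
    rintro _ ⟨n, b, m, rfl⟩
    have : TensorProduct.liftAddHom f (fun z n m => by rw [map_zsmul, map_zsmul]; rfl)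
        ((MulOpposite.op b • n) ⊗ₜ[ℤ] m - n ⊗ₜ[ℤ] (b • m)) = 0 := by
      rw [map_sub, TensorProduct.liftAddHom_tmul, TensorProduct.liftAddHom_tmul, h, sub_self]
    exact this

@[simp]
theorem lift_tmul {P : Type*} [AddCommGroup P] (f : N →+ M →+ P)
    (h : ∀ (n : N) (b : B) (m : M), f (MulOpposite.op b • n) m = f n (b • m)) (n : N) (m : M) :
    lift f h (tmul B n m) = f n m :=
  rfl

theorem smul_tmul (n : N) (b : B) (m : M) :
    tmul B (MulOpposite.op b • n) m = tmul B n (b • m) :=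
  (QuotientAddGroup.eq_iff_sub_mem).2 (AddSubgroup.subset_closure ⟨n, b, m, rfl⟩)

theorem add_tmul (n n' : N) (m : M) : tmul B (n + n') m = tmul B n m + tmul B n' m :=
  congrArg QuotientAddGroup.mk (TensorProduct.add_tmul n n' m)

theorem tmul_add (n : N) (m m' : M) : tmul B n (m + m') = tmul B n m + tmul B n m' :=
  congrArg QuotientAddGroup.mk (TensorProduct.tmul_add n m m')

/-- The map obtained from a homomorphism `f` of right modules by tensoring with `M`. -/
def map (M : Type*) [AddCommGroup M] [Module B M] (f : N →ₗ[Bᵐᵒᵖ] N') :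
    BalancedTensor B N M →+ BalancedTensor B N' M :=
  lift
    { toFun := fun n =>
        { toFun := fun m => tmul B (f n) m
          map_zero' := congrArg QuotientAddGroup.mk (TensorProduct.tmul_zero M (f n))
          map_add' := tmul_add (f n) }
      map_zero' := AddMonoidHom.ext fun m => by
        rw [map_zero]; exact congrArg QuotientAddGroup.mk (TensorProduct.zero_tmul N' m)
      map_add' := fun n n' => AddMonoidHom.ext fun m => by
        rw [map_add]; exact add_tmul (f n) (f n') m }
    fun n b m => by
      change tmul B (f (MulOpposite.op b • n)) m = tmul B (f n) (b • m)
      rw [map_smul, smul_tmul]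

@[simp]
theorem map_tmul (f : N →ₗ[Bᵐᵒᵖ] N') (n : N) (m : M) :
    map M f (tmul B n m) = tmul B (f n) m :=
  rfl

end BalancedTensor

/-- A left module `M` over a ring `B` is faithfully flat if a sequence of right modules is exact
precisely when it is exact after tensoring with `M` over `B`. -/
def IsFaithfullyFlat.{u, v} (B : Type u) (M : Type v) [Ring B] [AddCommGroup M] [Module B M] :
    Prop :=
  ∀ (N₁ N₂ N₃ : Type u) [AddCommGroup N₁] [AddCommGroup N₂] [AddCommGroup N₃]
    [Module Bᵐᵒᵖ N₁] [Module Bᵐᵒᵖ N₂] [Module Bᵐᵒᵖ N₃]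
    (f : N₁ →ₗ[Bᵐᵒᵖ] N₂) (g : N₂ →ₗ[Bᵐᵒᵖ] N₃),
    Function.Exact f g ↔ Function.Exact (BalancedTensor.map M f) (BalancedTensor.map M g)

/-! ## Principal comodule algebras -/

section Comodule

variable {A H : Type*} [Ring A] [Algebra ℂ A] [Ring H] [HopfAlgebra ℂ H]

/-- An algebra map `ρ : A → A ⊗ H` makes `A` into a right `H`-comodule algebra if it is
coassociative and counital. -/
structure IsComoduleAlgebra (ρ : A →ₐ[ℂ] A ⊗[ℂ] H) : Prop where
  coassoc : (TensorProduct.assoc ℂ A H H).toLinearMap ∘ₗ ρ.toLinearMap.rTensor H ∘ₗ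
    ρ.toLinearMap = (Coalgebra.comul (R := ℂ) (A := H)).lTensor A ∘ₗ ρ.toLinearMap
  counit : (TensorProduct.rid ℂ A).toLinearMap ∘ₗ
    (Coalgebra.counit (R := ℂ) (A := H)).lTensor A ∘ₗ ρ.toLinearMap = LinearMap.id

/-- The subalgebra of coinvariants, i.e. of those `b` with `ρ b = b ⊗ 1`. -/
def coinvariants (ρ : A →ₐ[ℂ] A ⊗[ℂ] H) : Subalgebra ℂ A :=
  AlgHom.equalizer ρ Algebra.TensorProduct.includeLeft

theorem mem_coinvariants {ρ : A →ₐ[ℂ] A ⊗[ℂ] H} {b : A} :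
    b ∈ coinvariants ρ ↔ ρ b = b ⊗ₜ 1 :=
  Iff.rfl

/-- An algebra is a right module over each of its subalgebras, by multiplication. -/
instance rightModule (B : Subalgebra ℂ A) : Module (B : Type _)ᵐᵒᵖ A where
  smul b a := a * (b.unop : A)
  one_smul a := mul_one a
  mul_smul b c a := (mul_assoc a (c.unop : A) (b.unop : A)).symm
  smul_zero b := zero_mul (b.unop : A)
  smul_add b a a' := add_mul a a' (b.unop : A)
  add_smul b c a := mul_add a (b.unop : A) (c.unop : A)
  zero_smul a := mul_zero a

/-- The canonical Galois map `A ⊗_B A → A ⊗ H`, `a ⊗ a' ↦ (a ⊗ 1) ρ(a')`, where `B` is the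
subalgebra of coinvariants. -/
def can (ρ : A →ₐ[ℂ] A ⊗[ℂ] H) : BalancedTensor (coinvariants ρ) A A →+ A ⊗[ℂ] H :=
  BalancedTensor.lift
    { toFun := fun a => (AddMonoidHom.mulLeft (a ⊗ₜ[ℂ] (1 : H))).comp
        (ρ : A →+* A ⊗[ℂ] H).toAddMonoidHom
      map_zero' := AddMonoidHom.ext fun a' => by simp
      map_add' := fun a b => AddMonoidHom.ext fun a' => by
        simp [TensorProduct.add_tmul, add_mul] }
    fun a b a' => by
      change ((a * (b : A)) ⊗ₜ[ℂ] (1 : H)) * ρ a' = (a ⊗ₜ[ℂ] (1 : H)) * ρ ((b : A) * a')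
      rw [map_mul, mem_coinvariants.1 b.2, ← mul_assoc, Algebra.TensorProduct.tmul_mul_tmul,
        mul_one]

theorem can_tmul (ρ : A →ₐ[ℂ] A ⊗[ℂ] H) (a a' : A) :
    can ρ (BalancedTensor.tmul (coinvariants ρ) a a') = (a ⊗ₜ 1) * ρ a' :=
  rfl

/-- Principal comodule algebras: comodule algebras over a Hopf algebra with bijective antipode,
faithfully flat as left modules over the coinvariants, and with bijective canonical map. -/
structure IsPrincipalComoduleAlgebra (ρ : A →ₐ[ℂ] A ⊗[ℂ] H) : Prop
    extends IsComoduleAlgebra ρ where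
  antipode_bijective : Function.Bijective (HopfAlgebra.antipode ℂ (A := H))
  faithfullyFlat : IsFaithfullyFlat (coinvariants ρ) A
  can_bijective : Function.Bijective (can ρ)

end Comodule

/-! ## Antipodes given by antihomomorphisms -/

section Antipode

variable {H : Type*} [Ring H] [Bialgebra ℂ H]

/-- The linear map underlying an algebra homomorphism to the opposite algebra. -/
def opLin (S : H →ₐ[ℂ] Hᵐᵒᵖ) : H →ₗ[ℂ] H :=
  (MulOpposite.opLinearEquiv ℂ).symm.toLinearMap ∘ₗ S.toLinearMap

@[simp]
theorem opLin_apply (S : H →ₐ[ℂ] Hᵐᵒᵖ) (a : H) : opLin S a = (S a).unop := rfl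

/-- The set where the left antipode identity holds for an antihomomorphism is a subalgebra. -/
def leftAntipode (S : H →ₐ[ℂ] Hᵐᵒᵖ) : Subalgebra ℂ H where
  carrier := {a | LinearMap.mul' ℂ H ((opLin S).rTensor H (Coalgebra.comul a)) =
    algebraMap ℂ H (Coalgebra.counit a)}
  algebraMap_mem' c := by
    simp [Bialgebra.comul_algebraMap, Algebra.TensorProduct.algebraMap_apply]
  add_mem' := fun {a b} ha hb => by simp_all
  mul_mem' := fun {a b} ha hb => by
    have key : ∀ x y : H ⊗[ℂ] H, LinearMap.mul' ℂ H ((opLin S).rTensor H x) =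
        algebraMap ℂ H (Coalgebra.counit a) → LinearMap.mul' ℂ H ((opLin S).rTensor H (x * y)) =
        algebraMap ℂ H (Coalgebra.counit a) * LinearMap.mul' ℂ H ((opLin S).rTensor H y) := by
      intro x y hx
      induction y with
      | zero => simp
      | add y z hy hz => rw [mul_add, map_add, map_add, hy, hz, map_add, map_add, mul_add]
      | tmul c d =>
        have : LinearMap.mul' ℂ H ((opLin S).rTensor H (x * c ⊗ₜ d)) =
            opLin S c * LinearMap.mul' ℂ H ((opLin S).rTensor H x) * d := by
          clear hx
          induction x with
          | zero => simp
          | add y z hy hz => rw [add_mul, map_add, map_add, hy, hz, map_add, map_add, mul_add,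
              add_mul]
          | tmul e f => simp [mul_assoc]
        rw [this, hx, ← Algebra.commutes]
        simp [mul_assoc]
    change _ = _
    rw [Bialgebra.comul_mul, key _ _ ha, hb, Bialgebra.counit_mul, map_mul]

/-- The set where the right antipode identity holds for an antihomomorphism is a subalgebra. -/
def rightAntipode (S : H →ₐ[ℂ] Hᵐᵒᵖ) : Subalgebra ℂ H where
  carrier := {a | LinearMap.mul' ℂ H ((opLin S).lTensor H (Coalgebra.comul a)) =
    algebraMap ℂ H (Coalgebra.counit a)}
  algebraMap_mem' c := by
    simp [Bialgebra.comul_algebraMap, Algebra.TensorProduct.algebraMap_apply]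
  add_mem' := fun {a b} ha hb => by simp_all
  mul_mem' := fun {a b} ha hb => by
    have key : ∀ x y : H ⊗[ℂ] H, LinearMap.mul' ℂ H ((opLin S).lTensor H y) =
        algebraMap ℂ H (Coalgebra.counit b) → LinearMap.mul' ℂ H ((opLin S).lTensor H (x * y)) =
        LinearMap.mul' ℂ H ((opLin S).lTensor H x) * algebraMap ℂ H (Coalgebra.counit b) := by
      intro x y hy
      induction x with
      | zero => simp
      | add x z hx hz => rw [add_mul, map_add, map_add, hx, hz, map_add, map_add, add_mul]
      | tmul c d =>
        have : LinearMap.mul' ℂ H ((opLin S).lTensor H (c ⊗ₜ d * y)) =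
            c * LinearMap.mul' ℂ H ((opLin S).lTensor H y) * opLin S d := by
          clear hy
          induction y with
          | zero => simp
          | add y z hy hz => rw [mul_add, map_add, map_add, hy, hz, map_add, map_add, mul_add,
              add_mul]
          | tmul e f => simp [mul_assoc]
        rw [this, hy, mul_assoc, Algebra.commutes]
        simp [mul_assoc]
    change _ = _
    rw [Bialgebra.comul_mul, key _ _ hb, ha, Bialgebra.counit_mul, map_mul]

/-- A bialgebra with an antihomomorphism satisfying the antipode identities on an algebra
generating set is a Hopf algebra. -/
abbrev hopfOfAntihom (S : H →ₐ[ℂ] Hᵐᵒᵖ) (hl : leftAntipode S = ⊤) (hr : rightAntipode S = ⊤) :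
    HopfAlgebra ℂ H where
  antipode := opLin S
  mul_antipode_rTensor_comul := LinearMap.ext fun a => by
    have : a ∈ leftAntipode S := hl ▸ Algebra.mem_top
    exact this
  mul_antipode_lTensor_comul := LinearMap.ext fun a => by
    have : a ∈ rightAntipode S := hr ▸ Algebra.mem_top
    exact this

end Antipode

/-! ## The coordinate algebra of the quantum group `SU_q(3)` -/

/-- The number of inverted pairs in a sequence of three indices. -/
def inversions (i j k : Fin 3) : ℕ :=
  (if j < i then 1 else 0) + (if k < i then 1 else 0) + (if k < j then 1 else 0)

/-- The deformed antisymmetric tensor. -/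
def E (q : Set.Ioo (0 : ℝ) 1) (i j k : Fin 3) : ℂ :=
  if i ≠ j ∧ i ≠ k ∧ j ≠ k then (-((q : ℝ) : ℂ)) ^ inversions i j k else 0

/-- Unitarity of the matrix `(u i j)` and the twisted determinant relations. -/
inductive SU3Rel (q : Set.Ioo (0 : ℝ) 1) :
    FreeStar (Fin 3 × Fin 3) → FreeStar (Fin 3 × Fin 3) → Prop
  | coisometry (i j : Fin 3) : SU3Rel q
      (∑ k, FreeStar.of (i, k) * star (FreeStar.of (j, k))) (if i = j then 1 else 0)
  | isometry (i j : Fin 3) : SU3Rel q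
      (∑ k, star (FreeStar.of (k, i)) * FreeStar.of (k, j)) (if i = j then 1 else 0)
  | det (j₁ j₂ j₃ : Fin 3) : SU3Rel q
      (∑ i₁, ∑ i₂, ∑ i₃, E q i₁ i₂ i₃ •
        (FreeStar.of (j₁, i₁) * FreeStar.of (j₂, i₂) * FreeStar.of (j₃, i₃)))
      (E q j₁ j₂ j₃ • 1)

/-- The coordinate star-algebra of `SU_q(3)`. -/
def OSU3 (q : Set.Ioo (0 : ℝ) 1) : Type := StarPres (SU3Rel q)

/-- The relations of `SU3Rel` for a matrix over a star-algebra. -/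
structure IsSU3Matrix (q : Set.Ioo (0 : ℝ) 1) {B : Type*} [Ring B] [StarRing B] [Algebra ℂ B]
    (v : Fin 3 → Fin 3 → B) : Prop where
  coisometry : ∀ i j, ∑ k, v i k * star (v j k) = if i = j then 1 else 0
  isometry : ∀ i j, ∑ k, star (v k i) * v k j = if i = j then 1 else 0
  det : ∀ j₁ j₂ j₃, ∑ i₁, ∑ i₂, ∑ i₃, E q i₁ i₂ i₃ • (v j₁ i₁ * v j₂ i₂ * v j₃ i₃) =
    E q j₁ j₂ j₃ • 1

theorem star_E (q : Set.Ioo (0 : ℝ) 1) (i j k : Fin 3) : star (E q i j k) = E q i j k := by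
  unfold E
  split_ifs <;> simp

theorem q_ne (q : Set.Ioo (0 : ℝ) 1) : ((q : ℝ) : ℂ) ≠ 0 :=
  Complex.ofReal_ne_zero.2 q.2.1.ne'

theorem one_add_ne (q : Set.Ioo (0 : ℝ) 1) : 1 + ((q : ℝ) : ℂ) ^ 2 ≠ 0 := by
  have : (0 : ℝ) < 1 + (q : ℝ) ^ 2 := by positivity
  exact_mod_cast this.ne'

/-- The weights describing the square of the antipode. -/
def wt (q : Set.Ioo (0 : ℝ) 1) (i : Fin 3) : ℂ := ((q : ℝ) : ℂ) ^ (2 * (i : ℕ))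

theorem wt_ne (q : Set.Ioo (0 : ℝ) 1) (i : Fin 3) : wt q i ≠ 0 := pow_ne_zero _ (q_ne q)

theorem E_front (q : Set.Ioo (0 : ℝ) 1) (m m' : Fin 3) : ∑ a, ∑ b, E q m a b * E q m' a b =
    if m = m' then (1 + ((q : ℝ) : ℂ) ^ 2) * wt q m else 0 := by
  fin_cases m <;> fin_cases m' <;> simp [Fin.sum_univ_three, E, inversions, wt] <;> ring

theorem E_back (q : Set.Ioo (0 : ℝ) 1) (m m' : Fin 3) : ∑ a, ∑ b, E q a b m * E q a b m' =
    if m = m' then ((1 + ((q : ℝ) : ℂ) ^ 2) * ((q : ℝ) : ℂ) ^ 4) * (wt q m)⁻¹ else 0 := by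
  have := q_ne q
  fin_cases m <;> fin_cases m' <;> simp [Fin.sum_univ_three, E, inversions, wt] <;> field_simp

section Sums

variable {M : Type*} [AddCommMonoid M]

theorem sum_rev (f : Fin 3 → Fin 3 → Fin 3 → M) :
    ∑ a, ∑ b, ∑ c, f a b c = ∑ c, ∑ b, ∑ a, f a b c :=
  Finset.sum_comm.trans ((Finset.sum_congr rfl fun _ _ => Finset.sum_comm).trans Finset.sum_comm)

theorem sum_rot (f : Fin 3 → Fin 3 → Fin 3 → M) :
    ∑ a, ∑ b, ∑ c, f a b c = ∑ c, ∑ a, ∑ b, f a b c :=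
  (Finset.sum_congr rfl fun _ _ => Finset.sum_comm).trans Finset.sum_comm

theorem sum_out (f : Fin 3 → Fin 3 → Fin 3 → Fin 3 → M) :
    ∑ a, ∑ b, ∑ c, ∑ d, f a b c d = ∑ d, ∑ a, ∑ b, ∑ c, f a b c d :=
  (Finset.sum_congr rfl fun _ _ => sum_rot _).trans Finset.sum_comm

theorem sum_swap32 (f : Fin 3 → Fin 3 → Fin 3 → Fin 3 → Fin 3 → M) :
    ∑ a, ∑ b, ∑ c, ∑ d, ∑ e, f a b c d e = ∑ d, ∑ e, ∑ a, ∑ b, ∑ c, f a b c d e :=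
  (sum_out fun a b c d => ∑ e, f a b c d e).trans
    (Finset.sum_congr rfl fun d _ => sum_out fun a b c e => f a b c d e)

end Sums

namespace IsSU3Matrix

variable {q : Set.Ioo (0 : ℝ) 1} {B : Type*} [Ring B] [StarRing B] [Algebra ℂ B]
  {v : Fin 3 → Fin 3 → B}

theorem cancel_left (hv : IsSU3Matrix q v) {y z : Fin 3 → B} (h : ∀ j, ∑ k, v j k * y k = z j)
    (k : Fin 3) : y k = ∑ j, star (v j k) * z j := by
  calc y k = ∑ l, (∑ j, star (v j k) * v j l) * y l := by simp [hv.isometry]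
    _ = ∑ j, star (v j k) * ∑ l, v j l * y l := by
      simp only [Finset.sum_mul, Finset.mul_sum, mul_assoc]
      exact Finset.sum_comm
    _ = _ := by simp only [h]

theorem cancel_right (hv : IsSU3Matrix q v) {y z : Fin 3 → B} (h : ∀ k, ∑ j, y j * v j k = z k)
    (j : Fin 3) : y j = ∑ k, z k * star (v j k) := by
  calc y j = ∑ l, y l * (∑ k, v l k * star (v j k)) := by simp [hv.coisometry]
    _ = ∑ k, (∑ l, y l * v l k) * star (v j k) := by
      simp only [Finset.sum_mul, Finset.mul_sum, mul_assoc]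
      exact Finset.sum_comm
    _ = _ := by simp only [h]

theorem row (hv : IsSU3Matrix q v) (i j₂ j₃ : Fin 3) :
    ∑ i₂, ∑ i₃, E q i i₂ i₃ • (v j₂ i₂ * v j₃ i₃) = ∑ j₁, E q j₁ j₂ j₃ • star (v j₁ i) := by
  rw [hv.cancel_left (y := fun i => ∑ i₂, ∑ i₃, E q i i₂ i₃ • (v j₂ i₂ * v j₃ i₃))
    (z := fun j => E q j j₂ j₃ • 1) (fun j => ?_) i]
  · simp
  · rw [← hv.det]
    simp only [Finset.mul_sum, mul_smul_comm, mul_assoc]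

variable [StarModule ℂ B]

/-- The twisted determinant relations along columns. -/
theorem det' (hv : IsSU3Matrix q v) (i₁ i₂ i₃ : Fin 3) :
    ∑ j₁, ∑ j₂, ∑ j₃, E q j₁ j₂ j₃ • (v j₁ i₁ * v j₂ i₂ * v j₃ i₃) = E q i₁ i₂ i₃ • 1 := by
  have h1 : ∀ j₃, ∑ i₃, E q i₁ i₂ i₃ • v j₃ i₃ =
      ∑ j₂, star (v j₂ i₂) * ∑ j₁, E q j₁ j₂ j₃ • star (v j₁ i₁) := fun j₃ =>
    hv.cancel_left (y := fun i₂ => ∑ i₃, E q i₁ i₂ i₃ • v j₃ i₃)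
      (z := fun j₂ => ∑ j₁, E q j₁ j₂ j₃ • star (v j₁ i₁)) (fun j => by
        rw [← hv.row]
        simp only [Finset.mul_sum, mul_smul_comm]) i₂
  have h2 : E q i₁ i₂ i₃ • (1 : B) = ∑ j₃, star (v j₃ i₃) *
      ∑ j₂, star (v j₂ i₂) * ∑ j₁, E q j₁ j₂ j₃ • star (v j₁ i₁) :=
    hv.cancel_left (y := fun i₃ => E q i₁ i₂ i₃ • (1 : B)) (fun j => by
        rw [← h1]
        simp only [mul_smul_comm, mul_one]) i₃
  have h3 := congrArg star h2
  rw [star_smul, star_one, star_E] at h3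
  rw [h3, sum_rev]
  simp only [star_sum, star_mul, star_star, star_smul, star_E, Finset.mul_sum,
    smul_mul_assoc]

theorem col (hv : IsSU3Matrix q v) (i₁ i₂ k : Fin 3) :
    ∑ j₁, ∑ j₂, E q j₁ j₂ k • (v j₁ i₁ * v j₂ i₂) = ∑ i₃, E q i₁ i₂ i₃ • star (v k i₃) := by
  rw [hv.cancel_right (y := fun k => ∑ j₁, ∑ j₂, E q j₁ j₂ k • (v j₁ i₁ * v j₂ i₂))
    (z := fun i₃ => E q i₁ i₂ i₃ • 1) (fun i₃ => ?_) k]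
  · simp
  · rw [← hv.det', sum_rot]
    simp only [Finset.sum_mul, smul_mul_assoc]

/-- Orthogonality of the columns in the opposite algebra. -/
theorem ortho_col (hv : IsSU3Matrix q v) (i j : Fin 3) :
    ∑ m, wt q m • (v m i * star (v m j)) = if i = j then wt q i • 1 else 0 := by
  have h : ∑ m, ∑ a, ∑ b, E q m a b • (v m i * ∑ m', E q m' a b • star (v m' j)) =
      ∑ c, ∑ d, E q j c d • ∑ m, ∑ a, ∑ b, E q m a b • (v m i * v a c * v b d) := by
    simp only [← hv.row, Finset.mul_sum, Finset.smul_sum, mul_smul_comm]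
    rw [sum_swap32]
    simp only [mul_assoc, smul_comm (E q j _ _)]
  simp only [hv.det'] at h
  have h1 : ∀ m, ∑ a, ∑ b, E q m a b • (v m i * ∑ m', E q m' a b • star (v m' j)) =
      ((1 + ((q : ℝ) : ℂ) ^ 2) * wt q m) • (v m i * star (v m j)) := by
    intro m
    have : ∀ m', ∑ a, ∑ b, E q m a b * E q m' a b =
      if m = m' then (1 + ((q : ℝ) : ℂ) ^ 2) * wt q m else 0 := E_front q m
    calc _ = ∑ m', (∑ a, ∑ b, E q m a b * E q m' a b) • (v m i * star (v m' j)) := by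
          simp only [Finset.mul_sum, Finset.smul_sum, mul_smul_comm, Finset.sum_smul, smul_smul]
          exact sum_rot (M := B) _
      _ = _ := by simp [this]
  have h2 : ∑ c, ∑ d, E q j c d • E q i c d • (1 : B) =
      if i = j then ((1 + ((q : ℝ) : ℂ) ^ 2) * wt q i) • 1 else 0 := by
    simp only [smul_smul, ← Finset.sum_smul]
    rw [E_front]
    simp only [eq_comm (a := j), ite_smul, zero_smul]
    split_ifs with h'
    · rw [h']
    · rfl
  rw [h2] at h
  simp only [h1, mul_smul, ← Finset.smul_sum] at h
  have h0 := one_add_ne q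
  split_ifs at h ⊢ with hij
  · exact smul_right_injective B h0 h
  · exact (smul_eq_zero_iff_right h0).1 h

/-- Orthogonality of the rows in the opposite algebra. -/
theorem ortho_row (hv : IsSU3Matrix q v) (i j : Fin 3) :
    ∑ k, (wt q k)⁻¹ • (star (v j k) * v i k) = if i = j then (wt q i)⁻¹ • 1 else 0 := by
  have h : ∑ k, ∑ a, ∑ b, E q a b k • ((∑ i₃, E q a b i₃ • star (v j i₃)) * v i k) =
      ∑ c, ∑ d, E q c d j • ∑ a, ∑ b, ∑ k, E q a b k • (v c a * v d b * v i k) := by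
    simp only [← hv.col, Finset.sum_mul, Finset.smul_sum, smul_mul_assoc]
    rw [sum_swap32]
    simp only [smul_comm (E q _ _ j)]
    refine Finset.sum_congr rfl fun c _ => Finset.sum_congr rfl fun d _ => ?_
    exact (sum_rot (M := B) _).symm
  simp only [hv.det] at h
  have h1 : ∀ k, ∑ a, ∑ b, E q a b k • ((∑ i₃, E q a b i₃ • star (v j i₃)) * v i k) =
      (((1 + ((q : ℝ) : ℂ) ^ 2) * ((q : ℝ) : ℂ) ^ 4) * (wt q k)⁻¹) • (star (v j k) * v i k) := by
    intro k
    have : ∀ m', ∑ a, ∑ b, E q a b k * E q a b m' =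
      if k = m' then ((1 + ((q : ℝ) : ℂ) ^ 2) * ((q : ℝ) : ℂ) ^ 4) * (wt q k)⁻¹ else 0 :=
      E_back q k
    calc _ = ∑ m', (∑ a, ∑ b, E q a b k * E q a b m') • (star (v j m') * v i k) := by
          simp only [Finset.sum_mul, Finset.smul_sum, smul_mul_assoc, Finset.sum_smul, smul_smul]
          exact sum_rot (M := B) _
      _ = _ := by simp [this]
  have h2 : ∑ c, ∑ d, E q c d j • E q c d i • (1 : B) =
      if i = j then (((1 + ((q : ℝ) : ℂ) ^ 2) * ((q : ℝ) : ℂ) ^ 4) * (wt q i)⁻¹) • 1 else 0 := by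
    simp only [smul_smul, ← Finset.sum_smul]
    rw [E_back]
    simp only [eq_comm (a := j), ite_smul, zero_smul]
    split_ifs with h'
    · rw [h']
    · rfl
  rw [h2] at h
  simp only [h1, mul_smul _ (wt q _)⁻¹, ← Finset.smul_sum] at h
  have h0 := mul_ne_zero (one_add_ne q) (pow_ne_zero 4 (q_ne q))
  split_ifs at h ⊢ with hij
  · exact smul_right_injective B h0 h
  · exact (smul_eq_zero_iff_right h0).1 h

end IsSU3Matrix

namespace IsSU3Matrix

section

variable {B : Type*} [Ring B] [StarRing B]

open scoped Matrix in
theorem coisometry_iff (v : Fin 3 → Fin 3 → B) :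
    (∀ i j, ∑ k, v i k * star (v j k) = if i = j then 1 else 0) ↔
      Matrix.of v * (Matrix.of v)ᴴ = 1 := by
  rw [← Matrix.ext_iff]
  simp [Matrix.mul_apply, Matrix.one_apply]

open scoped Matrix in
theorem isometry_iff (v : Fin 3 → Fin 3 → B) :
    (∀ i j, ∑ k, star (v k i) * v k j = if i = j then 1 else 0) ↔
      (Matrix.of v)ᴴ * Matrix.of v = 1 := by
  rw [← Matrix.ext_iff]
  simp [Matrix.mul_apply, Matrix.one_apply]

end

variable {q : Set.Ioo (0 : ℝ) 1} {B : Type*} [Ring B] [StarRing B] [Algebra ℂ B]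

/-- Products of matrices with mutually commuting entries. -/
theorem mul {a b : Fin 3 → Fin 3 → B} (ha : IsSU3Matrix q a) (hb : IsSU3Matrix q b)
    (h : ∀ i j k l, Commute (a i j) (b k l)) : IsSU3Matrix q fun i j => ∑ k, a i k * b k j := by
  have hw : Matrix.of (fun i j => ∑ k, a i k * b k j) = Matrix.of a * Matrix.of b := by
    ext i j
    simp [Matrix.mul_apply]
  refine ⟨(coisometry_iff _).2 ?_, (isometry_iff _).2 ?_, fun j₁ j₂ j₃ => ?_⟩
  · rw [hw, Matrix.conjTranspose_mul, Matrix.mul_assoc, ← Matrix.mul_assoc (Matrix.of b),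
      (coisometry_iff b).1 hb.coisometry, Matrix.one_mul, (coisometry_iff a).1 ha.coisometry]
  · rw [hw, Matrix.conjTranspose_mul, Matrix.mul_assoc, ← Matrix.mul_assoc _ (Matrix.of a),
      (isometry_iff a).1 ha.isometry, Matrix.one_mul, (isometry_iff b).1 hb.isometry]
  · have key : ∀ i₁ i₂ i₃ k₁ k₂ k₃, a j₁ k₁ * b k₁ i₁ * (a j₂ k₂ * b k₂ i₂) *
        (a j₃ k₃ * b k₃ i₃) = a j₁ k₁ * a j₂ k₂ * a j₃ k₃ * (b k₁ i₁ * b k₂ i₂ * b k₃ i₃) := by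
      intro i₁ i₂ i₃ k₁ k₂ k₃
      calc _ = a j₁ k₁ * (b k₁ i₁ * a j₂ k₂) * (b k₂ i₂ * a j₃ k₃) * b k₃ i₃ := by
            simp only [mul_assoc]
        _ = a j₁ k₁ * a j₂ k₂ * (b k₁ i₁ * a j₃ k₃) * b k₂ i₂ * b k₃ i₃ := by
          rw [← (h j₂ k₂ k₁ i₁).eq, ← (h j₃ k₃ k₂ i₂).eq]
          simp only [mul_assoc]
        _ = _ := by
          rw [← (h j₃ k₃ k₁ i₁).eq]
          simp only [mul_assoc]
    calc _ = ∑ i₁, ∑ i₂, ∑ i₃, ∑ k₁, ∑ k₂, ∑ k₃, E q i₁ i₂ i₃ •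
          (a j₁ k₁ * a j₂ k₂ * a j₃ k₃ * (b k₁ i₁ * b k₂ i₂ * b k₃ i₃)) := by
          simp only [Finset.sum_mul, Finset.mul_sum, Finset.smul_sum, key]
          refine Finset.sum_congr rfl fun i₁ _ => Finset.sum_congr rfl fun i₂ _ =>
            Finset.sum_congr rfl fun i₃ _ => ?_
          exact sum_rev _
      _ = ∑ k₁, ∑ k₂, ∑ k₃, ∑ i₁, ∑ i₂, ∑ i₃, E q i₁ i₂ i₃ •
          (a j₁ k₁ * a j₂ k₂ * a j₃ k₃ * (b k₁ i₁ * b k₂ i₂ * b k₃ i₃)) := by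
          refine (sum_out _).trans (Finset.sum_congr rfl fun k₁ _ => ?_)
          refine (sum_out _).trans (Finset.sum_congr rfl fun k₂ _ => ?_)
          exact sum_out _
      _ = ∑ k₁, ∑ k₂, ∑ k₃, a j₁ k₁ * a j₂ k₂ * a j₃ k₃ *
          ∑ i₁, ∑ i₂, ∑ i₃, E q i₁ i₂ i₃ • (b k₁ i₁ * b k₂ i₂ * b k₃ i₃) := by
          simp only [Finset.mul_sum, mul_smul_comm]
      _ = _ := by
          simp only [hb.det, mul_smul_comm, mul_one, ha.det]

/-- The image of a matrix under a homomorphism. -/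
theorem map {C : Type*} [Ring C] [StarRing C] [Algebra ℂ C] {v : Fin 3 → Fin 3 → B}
    (hv : IsSU3Matrix q v) (f : B →⋆ₐ[ℂ] C) : IsSU3Matrix q fun i j => f (v i j) where
  coisometry i j := by
    simp only [← map_star, ← map_mul, ← map_sum, hv.coisometry]
    split_ifs <;> simp
  isometry i j := by
    simp only [← map_star, ← map_mul, ← map_sum, hv.isometry]
    split_ifs <;> simp
  det j₁ j₂ j₃ := by
    simp only [← map_mul, ← map_smul, ← map_sum, hv.det]
    simp

/-- Rescaling the columns by numbers of modulus one with product one. -/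
theorem rescale [StarModule ℂ B] {v : Fin 3 → Fin 3 → B} (hv : IsSU3Matrix q v)
    (d : Fin 3 → Circle) (hd : d 0 * d 1 * d 2 = 1) :
    IsSU3Matrix q fun i j => (d j : ℂ) • v i j where
  coisometry i j := by
    have (k : Fin 3) : (d k : ℂ) * star (d k : ℂ) = 1 := by
      rw [← starRingEnd_apply, Complex.mul_conj, Circle.normSq_coe]; simp
    simp only [star_smul, smul_mul_smul_comm, this, one_smul, hv.coisometry]
  isometry i j := by
    have (k : Fin 3) : star (d k : ℂ) * (d k : ℂ) = 1 := by
      rw [← starRingEnd_apply, mul_comm, Complex.mul_conj, Circle.normSq_coe]; simp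
    simp only [star_smul, smul_mul_smul_comm, ← Finset.smul_sum, hv.isometry]
    split_ifs with h
    · rw [h, this, one_smul]
    · rw [smul_zero]
  det j₁ j₂ j₃ := by
    have hd' : (d 0 : ℂ) * d 1 * d 2 = 1 := by exact_mod_cast congrArg Circle.coeHom hd
    have (i₁ i₂ i₃ : Fin 3) : E q i₁ i₂ i₃ * ((d i₁ : ℂ) * d i₂ * d i₃) = E q i₁ i₂ i₃ := by
      unfold E
      split_ifs with h
      · suffices (d i₁ : ℂ) * d i₂ * d i₃ = 1 by rw [this, mul_one]
        fin_cases i₁ <;> fin_cases i₂ <;> fin_cases i₃ <;> simp at h <;>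
          simp only [Fin.zero_eta, Fin.mk_one, Fin.reduceFinMk] <;> linear_combination hd'
      · rw [zero_mul]
    simp only [smul_mul_smul_comm, smul_smul, this, hv.det]

theorem one : IsSU3Matrix q fun i j : Fin 3 => if i = j then (1 : B) else 0 where
  coisometry i j := by fin_cases i <;> fin_cases j <;> simp
  isometry i j := by fin_cases i <;> fin_cases j <;> simp
  det j₁ j₂ j₃ := by simp

end IsSU3Matrix

namespace OSU3

variable (q : Set.Ioo (0 : ℝ) 1)

instance : Ring (OSU3 q) := inferInstanceAs (Ring (StarPres (SU3Rel q)))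
instance : Algebra ℂ (OSU3 q) := inferInstanceAs (Algebra ℂ (StarPres (SU3Rel q)))
instance : StarRing (OSU3 q) := inferInstanceAs (StarRing (StarPres (SU3Rel q)))
instance : StarModule ℂ (OSU3 q) := inferInstanceAs (StarModule ℂ (StarPres (SU3Rel q)))

/-- The matrix of generators. -/
def u (i j : Fin 3) : OSU3 q := StarPres.gen (SU3Rel q) (i, j)

theorem isSU3Matrix_eval {B : Type*} [Ring B] [StarRing B] [Algebra ℂ B]
    (v : Fin 3 → Fin 3 → B) : IsSU3Matrix q v ↔ ∀ a b, SU3Rel q a b →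
      StarPres.eval (fun x : Fin 3 × Fin 3 => v x.1 x.2) a = StarPres.eval (fun x => v x.1 x.2) b := by
  constructor
  · rintro hv _ _ (⟨i, j⟩ | ⟨i, j⟩ | ⟨i, j, k⟩)
    · simp only [map_sum, map_mul, StarPres.eval_of, StarPres.eval_star_of, hv.coisometry]
      split_ifs <;> simp
    · simp only [map_sum, map_mul, StarPres.eval_of, StarPres.eval_star_of, hv.isometry]
      split_ifs <;> simp
    · simp only [map_sum, map_mul, map_smul, StarPres.eval_of, hv.det, map_one]
  · intro h
    refine ⟨fun i j => ?_, fun i j => ?_, fun i j k => ?_⟩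
    · have := h _ _ (SU3Rel.coisometry i j)
      simp only [map_sum, map_mul, StarPres.eval_of, StarPres.eval_star_of] at this
      rw [this]
      split_ifs <;> simp
    · have := h _ _ (SU3Rel.isometry i j)
      simp only [map_sum, map_mul, StarPres.eval_of, StarPres.eval_star_of] at this
      rw [this]
      split_ifs <;> simp
    · have := h _ _ (SU3Rel.det i j k)
      simpa only [map_sum, map_mul, map_smul, StarPres.eval_of, map_one] using this

theorem isSU3Matrix_u : IsSU3Matrix q (u q) :=
  (isSU3Matrix_eval q (u q)).2 fun a b h => by
    have := StarPres.mk_rel h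
    rw [StarPres.mk_eq_eval, StarPres.mk_eq_eval] at this
    exact this

variable {q}

/-- The star-homomorphism given by a matrix satisfying the defining relations. -/
def ofMatrix {B : Type*} [Ring B] [StarRing B] [Algebra ℂ B] [StarModule ℂ B]
    (v : Fin 3 → Fin 3 → B) (hv : IsSU3Matrix q v) : OSU3 q →⋆ₐ[ℂ] B :=
  StarPres.lift (fun x => v x.1 x.2) ((isSU3Matrix_eval q v).1 hv)

@[simp]
theorem ofMatrix_u {B : Type*} [Ring B] [StarRing B] [Algebra ℂ B] [StarModule ℂ B]
    (v : Fin 3 → Fin 3 → B) (hv : IsSU3Matrix q v) (i j : Fin 3) :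
    ofMatrix v hv (u q i j) = v i j :=
  StarPres.lift_gen (fun x : Fin 3 × Fin 3 => v x.1 x.2) ((isSU3Matrix_eval q v).1 hv) (i, j)

@[simp]
theorem ofMatrix_star_u {B : Type*} [Ring B] [StarRing B] [Algebra ℂ B] [StarModule ℂ B]
    (v : Fin 3 → Fin 3 → B) (hv : IsSU3Matrix q v) (i j : Fin 3) :
    ofMatrix v hv (star (u q i j)) = star (v i j) := by
  rw [map_star, ofMatrix_u]

theorem algHom_ext {B : Type*} [Semiring B] [Algebra ℂ B] {f g : OSU3 q →ₐ[ℂ] B}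
    (h : ∀ i j, f (u q i j) = g (u q i j)) (h' : ∀ i j, f (star (u q i j)) = g (star (u q i j))) :
    f = g :=
  StarPres.algHom_ext (fun x => h x.1 x.2) fun x => h' x.1 x.2

variable (q)

theorem isSU3Matrix_comul :
    IsSU3Matrix q fun i j => ∑ k, u q i k ⊗ₜ[ℂ] u q k j := by
  have hl : IsSU3Matrix q fun i j => u q i j ⊗ₜ[ℂ] (1 : OSU3 q) := (isSU3Matrix_u q).map
    ({ Algebra.TensorProduct.includeLeft with map_star' := fun a => by simp } :
      OSU3 q →⋆ₐ[ℂ] OSU3 q ⊗[ℂ] OSU3 q)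
  have hr : IsSU3Matrix q fun i j => (1 : OSU3 q) ⊗ₜ[ℂ] u q i j := (isSU3Matrix_u q).map
    ({ Algebra.TensorProduct.includeRight with map_star' := fun a => by simp } :
      OSU3 q →⋆ₐ[ℂ] OSU3 q ⊗[ℂ] OSU3 q)
  have := hl.mul hr fun i j k l => by simp [Commute, SemiconjBy]
  simpa using this

/-- The comultiplication `u i j ↦ ∑ k, u i k ⊗ u k j`. -/
def comulHom : OSU3 q →⋆ₐ[ℂ] OSU3 q ⊗[ℂ] OSU3 q :=
  ofMatrix (fun i j => ∑ k, u q i k ⊗ₜ[ℂ] u q k j) (isSU3Matrix_comul q)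

/-- The counit `u i j ↦ δ i j`. -/
def counitHom : OSU3 q →⋆ₐ[ℂ] ℂ :=
  ofMatrix (fun i j => if i = j then 1 else 0) IsSU3Matrix.one

instance : Bialgebra ℂ (OSU3 q) :=
  Bialgebra.ofAlgHom (comulHom q).toAlgHom (counitHom q).toAlgHom
    (algHom_ext (fun i j => by
        simp [comulHom, TensorProduct.sum_tmul, TensorProduct.tmul_sum]
        exact Finset.sum_comm)
      fun i j => by
        simp [comulHom, TensorProduct.sum_tmul, TensorProduct.tmul_sum]
        exact Finset.sum_comm)
    (algHom_ext (fun i j => by simp [comulHom, counitHom, TensorProduct.ite_tmul])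
      fun i j => by simp [comulHom, counitHom, apply_ite, TensorProduct.ite_tmul])
    (algHom_ext (fun i j => by simp [comulHom, counitHom, TensorProduct.tmul_ite])
      fun i j => by simp [comulHom, counitHom, apply_ite])

end OSU3

theorem E_wt (q : Set.Ioo (0 : ℝ) 1) (i j k : Fin 3) :
    E q i j k * (wt q i * wt q j * wt q k) = ((q : ℝ) : ℂ) ^ 6 * E q i j k := by
  unfold E
  split_ifs with h
  · rw [mul_comm]
    congr 1
    fin_cases i <;> fin_cases j <;> fin_cases k <;> simp at h <;> simp [wt] <;> ring
  · simp

namespace OSU3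

variable (q : Set.Ioo (0 : ℝ) 1)

/-- The values of the antipode on the generators and on their adjoints. -/
def antipodeFun : (Fin 3 × Fin 3) ⊕ (Fin 3 × Fin 3) → (OSU3 q)ᵐᵒᵖ :=
  Sum.elim (fun x => MulOpposite.op (star (u q x.2 x.1)))
    fun x => MulOpposite.op ((wt q x.2 * (wt q x.1)⁻¹) • u q x.2 x.1)

theorem antipode_col (i j : Fin 3) :
    ∑ k, (wt q k * (wt q i)⁻¹) • (u q k i * star (u q k j)) = if i = j then 1 else 0 := by
  have h := congrArg (fun x => (wt q i)⁻¹ • x) ((isSU3Matrix_u q).ortho_col i j)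
  simp only [Finset.smul_sum, smul_smul, smul_ite, smul_zero, inv_mul_cancel₀ (wt_ne q i),
    one_smul] at h
  simpa only [mul_comm] using h

theorem antipode_row (i j : Fin 3) :
    ∑ k, (wt q i * (wt q k)⁻¹) • (star (u q j k) * u q i k) = if i = j then 1 else 0 := by
  have h := congrArg (fun x => wt q i • x) ((isSU3Matrix_u q).ortho_row i j)
  simpa only [Finset.smul_sum, smul_smul, smul_ite, smul_zero, mul_inv_cancel₀ (wt_ne q i),
    one_smul] using h

theorem antipode_rel (a b : FreeStar (Fin 3 × Fin 3)) (h : SU3Rel q a b) :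
    FreeStar.lift (antipodeFun q) a = FreeStar.lift (antipodeFun q) b := by
  apply MulOpposite.unop_injective
  cases h with
  | coisometry i j =>
    simp only [map_sum, map_mul, FreeStar.lift_of, FreeStar.lift_star_of, antipodeFun, Sum.elim_inl,
      Sum.elim_inr, Finset.unop_sum, MulOpposite.unop_mul, MulOpposite.unop_op, smul_mul_assoc,
      antipode_col, eq_comm (a := j)]
    split_ifs <;> simp
  | isometry i j =>
    simp only [map_sum, map_mul, FreeStar.lift_of, FreeStar.lift_star_of, antipodeFun, Sum.elim_inl,
      Sum.elim_inr, Finset.unop_sum, MulOpposite.unop_mul, MulOpposite.unop_op, mul_smul_comm,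
      antipode_row]
    split_ifs <;> simp
  | det j₁ j₂ j₃ =>
    have h := congrArg star ((isSU3Matrix_u q).det' j₁ j₂ j₃)
    simp only [star_sum, star_smul, star_E, star_mul, star_one] at h
    simpa only [map_sum, map_smul, map_mul, FreeStar.lift_of, antipodeFun, Sum.elim_inl,
      Finset.unop_sum, MulOpposite.unop_smul, MulOpposite.unop_mul, MulOpposite.unop_op,
      map_one, MulOpposite.unop_one, mul_assoc] using h

theorem antipode_star_rel (a b : FreeStar (Fin 3 × Fin 3)) (h : SU3Rel q a b) :
    FreeStar.lift (antipodeFun q) (star a) = FreeStar.lift (antipodeFun q) (star b) := by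
  cases h with
  | coisometry i j =>
    have h := antipode_rel q _ _ (SU3Rel.coisometry j i)
    simp only [star_sum, star_mul, star_star]
    rw [h]
    simp only [eq_comm (a := j)]
    split_ifs <;> simp
  | isometry i j =>
    have h := antipode_rel q _ _ (SU3Rel.isometry j i)
    simp only [star_sum, star_mul, star_star]
    rw [h]
    simp only [eq_comm (a := j)]
    split_ifs <;> simp
  | det j₁ j₂ j₃ =>
    apply MulOpposite.unop_injective
    have hq := pow_ne_zero 6 (q_ne q)
    have hE : ((q : ℝ) : ℂ) ^ 6 * (wt q j₁ * wt q j₂ * wt q j₃)⁻¹ * E q j₁ j₂ j₃ =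
        E q j₁ j₂ j₃ := by
      have h1 := wt_ne q j₁
      have h2 := wt_ne q j₂
      have h3 := wt_ne q j₃
      have := E_wt q j₁ j₂ j₃
      field_simp
      linear_combination -this
    have h := congrArg (fun x => (((q : ℝ) : ℂ) ^ 6 * (wt q j₁ * wt q j₂ * wt q j₃)⁻¹) • x)
      ((isSU3Matrix_u q).det' j₁ j₂ j₃)
    rw [smul_smul _ (E q j₁ j₂ j₃), hE] at h
    simp only [star_sum, star_smul, star_E, star_mul, star_one, map_sum, map_smul, map_mul,
      FreeStar.lift_star_of, antipodeFun, Sum.elim_inr,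
      Finset.unop_sum, MulOpposite.unop_smul, MulOpposite.unop_mul, MulOpposite.unop_op,
      map_one, MulOpposite.unop_one]
    rw [← h]
    simp only [Finset.smul_sum, smul_smul, mul_smul_comm, smul_mul_assoc, mul_assoc]
    refine Finset.sum_congr rfl fun i₁ _ => Finset.sum_congr rfl fun i₂ _ =>
      Finset.sum_congr rfl fun i₃ _ => ?_
    congr 1
    have := E_wt q i₁ i₂ i₃
    have h1 := wt_ne q j₁
    have h2 := wt_ne q j₂
    have h3 := wt_ne q j₃
    field_simp
    linear_combination this

/-- The antipode, as an antihomomorphism: `S (u i j) = star (u j i)`, and the values on the adjoints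
`star (u i j)` are the corresponding multiples of `u j i`. -/
def antipodeHom : OSU3 q →ₐ[ℂ] (OSU3 q)ᵐᵒᵖ :=
  StarPres.liftAlg (antipodeFun q) (antipode_rel q) (antipode_star_rel q)

theorem antipodeHom_u (i j : Fin 3) :
    antipodeHom q (u q i j) = MulOpposite.op (star (u q j i)) :=
  StarPres.liftAlg_gen _ _ (antipode_star_rel q) (i, j)

theorem antipodeHom_star_u (i j : Fin 3) : antipodeHom q (star (u q i j)) =
    MulOpposite.op ((wt q j * (wt q i)⁻¹) • u q j i) :=
  StarPres.liftAlg_star_gen _ _ (antipode_star_rel q) (i, j)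

theorem comul_u (i j : Fin 3) :
    Coalgebra.comul (R := ℂ) (u q i j) = ∑ k, u q i k ⊗ₜ[ℂ] u q k j :=
  ofMatrix_u _ (isSU3Matrix_comul q) i j

theorem comul_star_u (i j : Fin 3) :
    Coalgebra.comul (R := ℂ) (star (u q i j)) = ∑ k, star (u q i k) ⊗ₜ[ℂ] star (u q k j) :=
  (ofMatrix_star_u _ (isSU3Matrix_comul q) i j).trans (by simp)

theorem counit_u (i j : Fin 3) :
    Coalgebra.counit (R := ℂ) (u q i j) = if i = j then 1 else 0 :=
  ofMatrix_u _ IsSU3Matrix.one i j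

theorem counit_star_u (i j : Fin 3) :
    Coalgebra.counit (R := ℂ) (star (u q i j)) = if i = j then 1 else 0 :=
  (ofMatrix_star_u _ IsSU3Matrix.one i j).trans (by split_ifs <;> simp)

instance : HopfAlgebra ℂ (OSU3 q) :=
  hopfOfAntihom (antipodeHom q)
    (StarPres.subalgebra_eq_top _
      (fun x => by
        change LinearMap.mul' ℂ (OSU3 q) ((opLin (antipodeHom q)).rTensor (OSU3 q)
          (Coalgebra.comul (u q x.1 x.2))) = algebraMap ℂ (OSU3 q) (Coalgebra.counit (u q x.1 x.2))
        simp only [comul_u, counit_u, map_sum, LinearMap.rTensor_tmul, LinearMap.mul'_apply,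
          opLin_apply, antipodeHom_u, MulOpposite.unop_op, (isSU3Matrix_u q).isometry]
        split_ifs <;> simp)
      fun x => by
        change LinearMap.mul' ℂ (OSU3 q) ((opLin (antipodeHom q)).rTensor (OSU3 q)
          (Coalgebra.comul (star (u q x.1 x.2)))) =
            algebraMap ℂ (OSU3 q) (Coalgebra.counit (star (u q x.1 x.2)))
        simp only [comul_star_u, counit_star_u, map_sum, LinearMap.rTensor_tmul,
          LinearMap.mul'_apply, opLin_apply, antipodeHom_star_u, MulOpposite.unop_op,
          smul_mul_assoc, antipode_col]
        split_ifs <;> simp)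
    (StarPres.subalgebra_eq_top _
      (fun x => by
        change LinearMap.mul' ℂ (OSU3 q) ((opLin (antipodeHom q)).lTensor (OSU3 q)
          (Coalgebra.comul (u q x.1 x.2))) = algebraMap ℂ (OSU3 q) (Coalgebra.counit (u q x.1 x.2))
        simp only [comul_u, counit_u, map_sum, LinearMap.lTensor_tmul, LinearMap.mul'_apply,
          opLin_apply, antipodeHom_u, MulOpposite.unop_op, (isSU3Matrix_u q).coisometry]
        split_ifs <;> simp)
      fun x => by
        change LinearMap.mul' ℂ (OSU3 q) ((opLin (antipodeHom q)).lTensor (OSU3 q)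
          (Coalgebra.comul (star (u q x.1 x.2)))) =
            algebraMap ℂ (OSU3 q) (Coalgebra.counit (star (u q x.1 x.2)))
        simp only [comul_star_u, counit_star_u, map_sum, LinearMap.lTensor_tmul,
          LinearMap.mul'_apply, opLin_apply, antipodeHom_star_u, MulOpposite.unop_op,
          mul_smul_comm, antipode_row, eq_comm (a := x.2)]
        split_ifs <;> simp)

/-! ### The gauge action, the quantum sphere and the quantum projective plane -/

/-- The phases by which the columns are multiplied under the gauge action. -/
def phase (z : Circle × Circle) : Fin 3 → Circle := ![z.1, z.2, (z.1 * z.2)⁻¹]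

/-- The gauge action of the two-torus:
`u i 0 ↦ z₁ u i 0`, `u i 1 ↦ z₂ u i 1`, `u i 2 ↦ (z₁ z₂)⁻¹ u i 2`. -/
def gauge (z : Circle × Circle) : OSU3 q →⋆ₐ[ℂ] OSU3 q :=
  ofMatrix (fun i j => (phase z j : ℂ) • u q i j)
    ((isSU3Matrix_u q).rescale (phase z) (by simp [phase]))

/-- The coordinate algebra of the quantum flag manifold: the gauge-invariant elements. -/
def flag : StarSubalgebra ℂ (OSU3 q) :=
  ⨅ z : Circle × Circle, StarAlgHom.equalizer (gauge q z) (StarAlgHom.id ℂ (OSU3 q))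

/-- The coordinate algebra of the quantum five-sphere: the star-subalgebra generated by the first
column. -/
def sphere : StarSubalgebra ℂ (OSU3 q) :=
  StarAlgebra.adjoin ℂ (Set.range fun i => u q i 0)

/-- The coordinate algebra of the quantum complex projective plane: the gauge-invariant part of the
coordinate algebra of the quantum five-sphere. -/
def projectivePlane : StarSubalgebra ℂ (OSU3 q) := flag q ⊓ sphere q

end OSU3

/-! ## The coordinate algebra of the quantum group `U_q(2)` -/

/-- The generators of the coordinate algebra of `U_q(2)`. -/
inductive U2Gen
  | u | α | γ

/-- The relations of `U_q(2)`: `u` is central and unitary, and `α`, `γ` satisfy the relations of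
`SU_q(2)`. -/
inductive U2Rel (q : Set.Ioo (0 : ℝ) 1) : FreeStar U2Gen → FreeStar U2Gen → Prop
  | star_u_mul_u : U2Rel q (star (FreeStar.of U2Gen.u) * FreeStar.of U2Gen.u) 1
  | u_mul_star_u : U2Rel q (FreeStar.of U2Gen.u * star (FreeStar.of U2Gen.u)) 1
  | u_mul_α : U2Rel q (FreeStar.of U2Gen.u * FreeStar.of U2Gen.α)
      (FreeStar.of U2Gen.α * FreeStar.of U2Gen.u)
  | u_mul_γ : U2Rel q (FreeStar.of U2Gen.u * FreeStar.of U2Gen.γ)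
      (FreeStar.of U2Gen.γ * FreeStar.of U2Gen.u)
  | u_mul_star_α : U2Rel q (FreeStar.of U2Gen.u * star (FreeStar.of U2Gen.α))
      (star (FreeStar.of U2Gen.α) * FreeStar.of U2Gen.u)
  | u_mul_star_γ : U2Rel q (FreeStar.of U2Gen.u * star (FreeStar.of U2Gen.γ))
      (star (FreeStar.of U2Gen.γ) * FreeStar.of U2Gen.u)
  | α_mul_γ : U2Rel q (FreeStar.of U2Gen.α * FreeStar.of U2Gen.γ)
      (((q : ℝ) : ℂ) • (FreeStar.of U2Gen.γ * FreeStar.of U2Gen.α))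
  | γ_mul_star_γ : U2Rel q (FreeStar.of U2Gen.γ * star (FreeStar.of U2Gen.γ))
      (star (FreeStar.of U2Gen.γ) * FreeStar.of U2Gen.γ)
  | α_mul_star_γ : U2Rel q (FreeStar.of U2Gen.α * star (FreeStar.of U2Gen.γ))
      (((q : ℝ) : ℂ) • (star (FreeStar.of U2Gen.γ) * FreeStar.of U2Gen.α))
  | star_α_mul_α : U2Rel q (star (FreeStar.of U2Gen.α) * FreeStar.of U2Gen.α +
      FreeStar.of U2Gen.γ * star (FreeStar.of U2Gen.γ)) 1
  | α_mul_star_α : U2Rel q (FreeStar.of U2Gen.α * star (FreeStar.of U2Gen.α) +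
      ((q : ℝ) : ℂ) ^ 2 • (FreeStar.of U2Gen.γ * star (FreeStar.of U2Gen.γ))) 1

/-- The coordinate star-algebra of `U_q(2)`. -/
def OU2 (q : Set.Ioo (0 : ℝ) 1) : Type := StarPres (U2Rel q)

/-- The relations of `U2Rel` for three elements of a star-algebra. -/
structure IsU2Triple (q : Set.Ioo (0 : ℝ) 1) {B : Type*} [Ring B] [StarRing B] [Algebra ℂ B]
    (t a c : B) : Prop where
  tt : star t * t = 1
  tt' : t * star t = 1
  ta : t * a = a * t
  tc : t * c = c * t
  ta' : t * star a = star a * t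
  tc' : t * star c = star c * t
  ac : a * c = ((q : ℝ) : ℂ) • (c * a)
  cc : c * star c = star c * c
  ac' : a * star c = ((q : ℝ) : ℂ) • (star c * a)
  aa : star a * a + c * star c = 1
  aa' : a * star a + ((q : ℝ) : ℂ) ^ 2 • (c * star c) = 1

/-- The elements assigned to the generators. -/
def U2Gen.elim {B : Type*} (t a c : B) : U2Gen → B
  | .u => t
  | .α => a
  | .γ => c

namespace OU2

variable (q : Set.Ioo (0 : ℝ) 1)

instance : Ring (OU2 q) := inferInstanceAs (Ring (StarPres (U2Rel q)))
instance : Algebra ℂ (OU2 q) := inferInstanceAs (Algebra ℂ (StarPres (U2Rel q)))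
instance : StarRing (OU2 q) := inferInstanceAs (StarRing (StarPres (U2Rel q)))
instance : StarModule ℂ (OU2 q) := inferInstanceAs (StarModule ℂ (StarPres (U2Rel q)))

/-- The central unitary generator. -/
def u : OU2 q := StarPres.gen (U2Rel q) .u

/-- The generator `α`. -/
def α : OU2 q := StarPres.gen (U2Rel q) .α

/-- The generator `γ`. -/
def γ : OU2 q := StarPres.gen (U2Rel q) .γ

/-- The unitary matrix of generators. -/
def v : Fin 3 → Fin 3 → OU2 q :=
  ![![u q, 0, 0],
    ![0, α q, -((q : ℝ) : ℂ) • (star (γ q) * star (u q))],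
    ![0, γ q, star (α q) * star (u q)]]

theorem triple_eval {B : Type*} [Ring B] [StarRing B] [Algebra ℂ B] (f : U2Gen → B) :
    IsU2Triple q (f .u) (f .α) (f .γ) ↔
      ∀ x y, U2Rel q x y → StarPres.eval f x = StarPres.eval f y := by
  constructor
  · intro h x y hxy
    cases hxy <;>
      simp only [map_mul, map_add, map_smul, map_one, StarPres.eval_of, StarPres.eval_star_of]
    exacts [h.tt, h.tt', h.ta, h.tc, h.ta', h.tc', h.ac, h.cc, h.ac', h.aa, h.aa']
  · intro h
    have h1 := h _ _ U2Rel.star_u_mul_u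
    have h2 := h _ _ U2Rel.u_mul_star_u
    have h3 := h _ _ U2Rel.u_mul_α
    have h4 := h _ _ U2Rel.u_mul_γ
    have h5 := h _ _ U2Rel.u_mul_star_α
    have h6 := h _ _ U2Rel.u_mul_star_γ
    have h7 := h _ _ U2Rel.α_mul_γ
    have h8 := h _ _ U2Rel.γ_mul_star_γ
    have h9 := h _ _ U2Rel.α_mul_star_γ
    have h10 := h _ _ U2Rel.star_α_mul_α
    have h11 := h _ _ U2Rel.α_mul_star_α
    simp only [map_mul, map_add, map_smul, map_one, StarPres.eval_of, StarPres.eval_star_of]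
      at h1 h2 h3 h4 h5 h6 h7 h8 h9 h10 h11
    exact ⟨h1, h2, h3, h4, h5, h6, h7, h8, h9, h10, h11⟩

theorem triple : IsU2Triple q (u q) (α q) (γ q) :=
  (triple_eval q (StarPres.gen (U2Rel q))).2 fun a b h => by
    have := StarPres.mk_rel h
    rwa [StarPres.mk_eq_eval, StarPres.mk_eq_eval] at this

variable {q}

/-- The star-homomorphism given by three elements satisfying the defining relations. -/
def ofTriple {B : Type*} [Ring B] [StarRing B] [Algebra ℂ B] [StarModule ℂ B]
    (t a c : B) (h : IsU2Triple q t a c) : OU2 q →⋆ₐ[ℂ] B :=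
  StarPres.lift (U2Gen.elim t a c) ((triple_eval q (U2Gen.elim t a c)).1 h)

section

variable {B : Type*} [Ring B] [StarRing B] [Algebra ℂ B] [StarModule ℂ B]
    (t a c : B) (h : IsU2Triple q t a c)

@[simp]
theorem ofTriple_u : ofTriple t a c h (u q) = t := StarPres.lift_gen _ _ _

@[simp]
theorem ofTriple_α : ofTriple t a c h (α q) = a := StarPres.lift_gen _ _ _

@[simp]
theorem ofTriple_γ : ofTriple t a c h (γ q) = c := StarPres.lift_gen _ _ _

end

theorem algHom_ext {B : Type*} [Semiring B] [Algebra ℂ B] {f g : OU2 q →ₐ[ℂ] B}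
    (h1 : f (u q) = g (u q)) (h1' : f (star (u q)) = g (star (u q)))
    (h2 : f (α q) = g (α q)) (h2' : f (star (α q)) = g (star (α q)))
    (h3 : f (γ q) = g (γ q)) (h3' : f (star (γ q)) = g (star (γ q))) : f = g :=
  StarPres.algHom_ext (fun x => by cases x <;> assumption) fun x => by cases x <;> assumption

end OU2

/-! ### Normal ordering -/

namespace IsU2Triple

variable {q : Set.Ioo (0 : ℝ) 1} {B : Type*} [Ring B] [StarRing B] [Algebra ℂ B] {t a c : B}

variable [StarModule ℂ B]

/-- The defining relations as rewriting rules that move `t` and `star t` to the left, followed by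
`c`, `star c`, and finally `a`, `star a`. -/
theorem order (h : IsU2Triple q t a c) :
    star t * t = 1 ∧ t * star t = 1 ∧ a * t = t * a ∧ c * t = t * c ∧ star a * t = t * star a ∧
    star c * t = t * star c ∧ a * star t = star t * a ∧ c * star t = star t * c ∧
    star a * star t = star t * star a ∧ star c * star t = star t * star c ∧
    a * c = ((q : ℝ) : ℂ) • (c * a) ∧ star c * c = c * star c ∧
    a * star c = ((q : ℝ) : ℂ) • (star c * a) ∧ star a * a = 1 - c * star c ∧
    a * star a = 1 - ((q : ℝ) : ℂ) ^ 2 • (c * star c) ∧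
    star a * c = ((q : ℝ) : ℂ)⁻¹ • (c * star a) ∧
    star a * star c = ((q : ℝ) : ℂ)⁻¹ • (star c * star a) := by
  refine ⟨h.tt, h.tt', h.ta.symm, h.tc.symm, h.ta'.symm, h.tc'.symm, ?_, ?_, ?_, ?_, h.ac,
    h.cc.symm, h.ac', eq_sub_of_add_eq h.aa, eq_sub_of_add_eq h.aa', ?_, ?_⟩
  · simpa using congrArg star h.ta'
  · simpa using congrArg star h.tc'
  · simpa using congrArg star h.ta
  · simpa using congrArg star h.tc
  · have := congrArg star h.ac'
    simp only [star_mul, star_star, star_smul, Complex.star_def, Complex.conj_ofReal] at this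
    rw [this, smul_smul, inv_mul_cancel₀ (q_ne q), one_smul]
  · have := congrArg star h.ac
    simp only [star_mul, star_smul, Complex.star_def, Complex.conj_ofReal] at this
    rw [this, smul_smul, inv_mul_cancel₀ (q_ne q), one_smul]

/-- The rewriting rules inside longer products. -/
theorem order' (h : IsU2Triple q t a c) (z : B) :
    star t * (t * z) = z ∧ t * (star t * z) = z ∧ a * (t * z) = t * (a * z) ∧
    c * (t * z) = t * (c * z) ∧ star a * (t * z) = t * (star a * z) ∧
    star c * (t * z) = t * (star c * z) ∧ a * (star t * z) = star t * (a * z) ∧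
    c * (star t * z) = star t * (c * z) ∧ star a * (star t * z) = star t * (star a * z) ∧
    star c * (star t * z) = star t * (star c * z) ∧
    a * (c * z) = ((q : ℝ) : ℂ) • (c * (a * z)) ∧ star c * (c * z) = c * (star c * z) ∧
    a * (star c * z) = ((q : ℝ) : ℂ) • (star c * (a * z)) ∧
    star a * (a * z) = z - c * (star c * z) ∧
    a * (star a * z) = z - ((q : ℝ) : ℂ) ^ 2 • (c * (star c * z)) ∧
    star a * (c * z) = ((q : ℝ) : ℂ)⁻¹ • (c * (star a * z)) ∧
    star a * (star c * z) = ((q : ℝ) : ℂ)⁻¹ • (star c * (star a * z)) := by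
  obtain ⟨h1, h2, h3, h4, h5, h6, h7, h8, h9, h10, h11, h12, h13, h14, h15, h16, h17⟩ := h.order
  refine ⟨?_, ?_, ?_, ?_, ?_, ?_, ?_, ?_, ?_, ?_, ?_, ?_, ?_, ?_, ?_, ?_, ?_⟩ <;>
    simp only [← mul_assoc, h1, h2, h3, h4, h5, h6, h7, h8, h9, h10, h11, h12, h13, h14, h15, h16,
      h17, sub_mul, one_mul, smul_mul_assoc]

end IsU2Triple

namespace OU2

variable (q : Set.Ioo (0 : ℝ) 1)

theorem E_sum {B : Type*} [AddCommGroup B] [Module ℂ B] (f : Fin 3 → Fin 3 → Fin 3 → B) :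
    ∑ i, ∑ j, ∑ k, E q i j k • f i j k = f 0 1 2 - ((q : ℝ) : ℂ) • f 0 2 1 -
      ((q : ℝ) : ℂ) • f 1 0 2 + ((q : ℝ) : ℂ) ^ 2 • f 1 2 0 + ((q : ℝ) : ℂ) ^ 2 • f 2 0 1 -
      ((q : ℝ) : ℂ) ^ 3 • f 2 1 0 := by
  simp only [Fin.sum_univ_three]
  simp [E, inversions]
  module

theorem v_vals : v q 0 0 = u q ∧ v q 0 1 = 0 ∧ v q 0 2 = 0 ∧ v q 1 0 = 0 ∧ v q 1 1 = α q ∧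
    v q 1 2 = -((q : ℝ) : ℂ) • (star (γ q) * star (u q)) ∧ v q 2 0 = 0 ∧ v q 2 1 = γ q ∧
    v q 2 2 = star (α q) * star (u q) :=
  ⟨rfl, rfl, rfl, rfl, rfl, rfl, rfl, rfl, rfl⟩

theorem v_coisometry (i j : Fin 3) :
    ∑ k, v q i k * star (v q j k) = if i = j then 1 else 0 := by
  have h := triple q
  have hq := q_ne q
  fin_cases i <;> fin_cases j <;>
    simp only [Fin.zero_eta, Fin.mk_one, Fin.reduceFinMk, Fin.sum_univ_three, v_vals, star_mul,
      star_star, star_zero, star_smul, star_neg, Complex.star_def, Complex.conj_ofReal, neg_smul,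
      zero_mul, mul_zero, mul_one, add_zero, zero_add, smul_mul_assoc, mul_smul_comm, neg_mul, mul_neg, neg_neg, smul_neg, smul_zero,
      mul_sub, mul_assoc, h.order, h.order', Fin.reduceEq, reduceIte]
  all_goals match_scalars
  all_goals try field_simp
  all_goals try ring_nf

theorem v_isometry (i j : Fin 3) :
    ∑ k, star (v q k i) * v q k j = if i = j then 1 else 0 := by
  have h := triple q
  have hq := q_ne q
  fin_cases i <;> fin_cases j <;>
    simp only [Fin.zero_eta, Fin.mk_one, Fin.reduceFinMk, Fin.sum_univ_three, v_vals, star_mul,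
      star_star, star_zero, star_smul, star_neg, Complex.star_def, Complex.conj_ofReal, neg_smul,
      zero_mul, mul_zero, mul_one, add_zero, zero_add, smul_mul_assoc, mul_smul_comm, neg_mul, mul_neg, neg_neg, smul_neg, smul_zero,
      mul_sub, mul_assoc, h.order, h.order', Fin.reduceEq, reduceIte]
  all_goals match_scalars
  all_goals try field_simp
  all_goals try ring_nf

set_option maxHeartbeats 1000000 in
theorem isSU3Matrix_v : IsSU3Matrix q (v q) := by
  have h := triple q
  have hq := q_ne q
  refine ⟨v_coisometry q, v_isometry q, fun i j k => ?_⟩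
  rw [E_sum]
  fin_cases i <;> fin_cases j <;> fin_cases k <;>
    simp only [Fin.zero_eta, Fin.mk_one, Fin.reduceFinMk, v_vals, E, inversions, Fin.reduceEq,
      Fin.reduceLT, reduceIte, ne_eq, not_true_eq_false, not_false_eq_true, and_true, and_false,
      and_self, pow_zero, zero_smul,
      neg_smul, zero_mul, mul_zero, mul_one, add_zero, sub_zero, zero_sub, neg_zero,
      zero_add, smul_mul_assoc, mul_smul_comm, neg_mul, mul_neg, neg_neg, smul_neg, smul_zero,
      mul_sub, sub_mul, mul_assoc, h.order, h.order']
  all_goals match_scalars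
  all_goals try field_simp
  all_goals try ring_nf


/-- The matrix `∑ k, v i k ⊗ v k j`. -/
def w (i j : Fin 3) : OU2 q ⊗[ℂ] OU2 q := ∑ k, v q i k ⊗ₜ[ℂ] v q k j

theorem w00 : w q 0 0 = u q ⊗ₜ u q := by simp [w, Fin.sum_univ_three, v]

theorem w11 : w q 1 1 = α q ⊗ₜ α q -
    ((q : ℝ) : ℂ) • ((star (u q) * star (γ q)) ⊗ₜ γ q) := by
  simp [w, Fin.sum_univ_three, v, (triple q).order, -Complex.coe_smul, TensorProduct.neg_tmul,
    TensorProduct.smul_tmul', sub_eq_add_neg]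

theorem w21 : w q 2 1 = γ q ⊗ₜ α q + (star (u q) * star (α q)) ⊗ₜ γ q := by
  simp [w, Fin.sum_univ_three, v, (triple q).order]

set_option maxHeartbeats 2000000 in
theorem triple_w : IsU2Triple q (w q 0 0) (w q 1 1) (w q 2 1) := by
  have h := triple q
  have hq := q_ne q
  rw [w00, w11, w21]
  constructor <;>
  simp only [star_add, star_sub, TensorProduct.star_tmul, Algebra.TensorProduct.tmul_mul_tmul,
    TensorProduct.sub_tmul, TensorProduct.tmul_sub, ← TensorProduct.smul_tmul',
    TensorProduct.tmul_smul, Algebra.TensorProduct.one_def, h.order, h.order', mul_assoc, star_mul, star_star, star_smul, star_neg,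
      Complex.star_def, Complex.conj_ofReal, smul_mul_assoc, mul_smul_comm, smul_neg, neg_smul,
      neg_mul, mul_neg, neg_neg, mul_one, one_mul, add_mul, mul_add, sub_mul, mul_sub]
  all_goals match_scalars
  all_goals try field_simp
  all_goals try ring_nf

/-- The comultiplication `v i j ↦ ∑ k, v i k ⊗ v k j`, see `comulHom_v`. -/
def comulHom : OU2 q →⋆ₐ[ℂ] OU2 q ⊗[ℂ] OU2 q :=
  ofTriple (w q 0 0) (w q 1 1) (w q 2 1) (triple_w q)

theorem comulHom_v (i j : Fin 3) : comulHom q (v q i j) = ∑ k, v q i k ⊗ₜ[ℂ] v q k j := by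
  have h := triple q
  have hq := q_ne q
  change _ = w q i j
  have h12 : w q 1 2 = -((q : ℝ) : ℂ) • (star (w q 2 1) * star (w q 0 0)) := by
    rw [w00, w21]
    simp [w, Fin.sum_univ_three, v, h.order, h.order', mul_assoc, -Complex.coe_smul, add_mul,
      TensorProduct.neg_tmul, TensorProduct.tmul_neg, ← TensorProduct.smul_tmul']
    match_scalars <;> simp
  have h22 : w q 2 2 = star (w q 1 1) * star (w q 0 0) := by
    rw [w00, w11]
    simp [w, Fin.sum_univ_three, v, h.order, h.order', mul_assoc, -Complex.coe_smul, sub_mul,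
      TensorProduct.tmul_neg]
    match_scalars <;> simp
  have e00 : comulHom q (u q) = w q 0 0 := ofTriple_u _ _ _ _
  have e11 : comulHom q (α q) = w q 1 1 := ofTriple_α _ _ _ _
  have e21 : comulHom q (γ q) = w q 2 1 := ofTriple_γ _ _ _ _
  fin_cases i <;> fin_cases j
  · exact e00
  · simp [v, w, Fin.sum_univ_three]
  · simp [v, w, Fin.sum_univ_three]
  · simp [v, w, Fin.sum_univ_three]
  · exact e11
  · refine Eq.trans ?_ h12.symm
    rw [← e21, ← e00, ← map_star, ← map_star, ← map_mul, ← map_smul]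
    rfl
  · simp [v, w, Fin.sum_univ_three]
  · exact e21
  · refine Eq.trans ?_ h22.symm
    rw [← e11, ← e00, ← map_star, ← map_star, ← map_mul]
    rfl

theorem comulHom_star_v (i j : Fin 3) :
    comulHom q (star (v q i j)) = ∑ k, star (v q i k) ⊗ₜ[ℂ] star (v q k j) := by
  rw [map_star, comulHom_v]
  simp

theorem triple_one : IsU2Triple q (1 : ℂ) 1 0 := by
  constructor <;> simp

/-- The counit `v i j ↦ δ i j`, see `counitHom_v`. -/
def counitHom : OU2 q →⋆ₐ[ℂ] ℂ := ofTriple 1 1 0 (triple_one q)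

theorem counitHom_v (i j : Fin 3) : counitHom q (v q i j) = if i = j then 1 else 0 := by
  fin_cases i <;> fin_cases j <;>
    simp only [Fin.zero_eta, Fin.mk_one, Fin.reduceFinMk, v_vals, counitHom, map_mul, map_smul,
      map_zero, map_star, ofTriple_u, ofTriple_α, ofTriple_γ, star_one, star_zero, mul_one,
      zero_mul, smul_zero, Fin.reduceEq, reduceIte]

theorem counitHom_star_v (i j : Fin 3) :
    counitHom q (star (v q i j)) = if i = j then 1 else 0 := by
  rw [map_star, counitHom_v]
  split_ifs <;> simp

variable {q} in
theorem algHom_ext_v {B : Type*} [Semiring B] [Algebra ℂ B] {f g : OU2 q →ₐ[ℂ] B}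
    (h : ∀ i j, f (v q i j) = g (v q i j)) (h' : ∀ i j, f (star (v q i j)) = g (star (v q i j))) :
    f = g :=
  algHom_ext (h 0 0) (h' 0 0) (h 1 1) (h' 1 1) (h 2 1) (h' 2 1)

instance : Bialgebra ℂ (OU2 q) :=
  Bialgebra.ofAlgHom (comulHom q).toAlgHom (counitHom q).toAlgHom
    (algHom_ext_v (fun i j => by
        simp [comulHom_v, TensorProduct.sum_tmul, TensorProduct.tmul_sum]
        exact Finset.sum_comm)
      fun i j => by
        simp [comulHom_star_v, TensorProduct.sum_tmul, TensorProduct.tmul_sum]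
        exact Finset.sum_comm)
    (algHom_ext_v (fun i j => by simp [comulHom_v, counitHom_v, TensorProduct.ite_tmul])
      fun i j => by
        simp [comulHom_star_v, counitHom_star_v, TensorProduct.ite_tmul])
    (algHom_ext_v (fun i j => by simp [comulHom_v, counitHom_v, TensorProduct.tmul_ite])
      fun i j => by
        simp [comulHom_star_v, counitHom_star_v, TensorProduct.tmul_ite])

/-- The values of the antipode on the generators and on their adjoints. -/
def antipodeFun : U2Gen ⊕ U2Gen → (OU2 q)ᵐᵒᵖ :=
  Sum.elim
    (U2Gen.elim (MulOpposite.op (star (u q))) (MulOpposite.op (star (α q)))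
      (MulOpposite.op (-((q : ℝ) : ℂ) • (u q * γ q))))
    (U2Gen.elim (MulOpposite.op (u q)) (MulOpposite.op (α q))
      (MulOpposite.op (-((q : ℝ) : ℂ)⁻¹ • (star (u q) * star (γ q)))))

theorem antipode_rel (a b : FreeStar U2Gen) (hab : U2Rel q a b) :
    FreeStar.lift (antipodeFun q) a = FreeStar.lift (antipodeFun q) b := by
  have h := triple q
  have hq := q_ne q
  apply MulOpposite.unop_injective
  cases hab <;>
    simp only [map_mul, map_add, map_smul, map_one, star_add, star_one, FreeStar.lift_of,
      FreeStar.lift_star_of, antipodeFun, U2Gen.elim, Sum.elim_inl, Sum.elim_inr,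
      MulOpposite.unop_mul, MulOpposite.unop_add, MulOpposite.unop_smul, MulOpposite.unop_op,
      MulOpposite.unop_one, star_pow, h.order, h.order', mul_assoc, star_mul, star_star, star_smul, star_neg,
      Complex.star_def, Complex.conj_ofReal, smul_mul_assoc, mul_smul_comm, smul_neg, neg_smul,
      neg_mul, mul_neg, neg_neg, mul_one, one_mul, add_mul, mul_add, sub_mul, mul_sub]
  all_goals match_scalars
  all_goals try field_simp
  all_goals try ring_nf

theorem antipode_star_rel (a b : FreeStar U2Gen) (hab : U2Rel q a b) :
    FreeStar.lift (antipodeFun q) (star a) = FreeStar.lift (antipodeFun q) (star b) := by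
  have h := triple q
  have hq := q_ne q
  apply MulOpposite.unop_injective
  cases hab <;>
    simp only [map_mul, map_add, map_smul, map_one, star_add, star_one, FreeStar.lift_of,
      FreeStar.lift_star_of, antipodeFun, U2Gen.elim, Sum.elim_inl, Sum.elim_inr,
      MulOpposite.unop_mul, MulOpposite.unop_add, MulOpposite.unop_smul, MulOpposite.unop_op,
      MulOpposite.unop_one, star_pow, h.order, h.order', mul_assoc, star_mul, star_star, star_smul, star_neg,
      Complex.star_def, Complex.conj_ofReal, smul_mul_assoc, mul_smul_comm, smul_neg, neg_smul,
      neg_mul, mul_neg, neg_neg, mul_one, one_mul, add_mul, mul_add, sub_mul, mul_sub]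
  all_goals match_scalars
  all_goals try field_simp
  all_goals try ring_nf

/-- The antipode, as an antihomomorphism; it satisfies `S (v i j) = star (v j i)`, see
`antipodeHom_v`. -/
def antipodeHom : OU2 q →ₐ[ℂ] (OU2 q)ᵐᵒᵖ :=
  StarPres.liftAlg (antipodeFun q) (antipode_rel q) (antipode_star_rel q)

theorem antipodeHom_gens :
    antipodeHom q (u q) = MulOpposite.op (star (u q)) ∧
    antipodeHom q (α q) = MulOpposite.op (star (α q)) ∧
    antipodeHom q (γ q) = MulOpposite.op (-((q : ℝ) : ℂ) • (u q * γ q)) ∧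
    antipodeHom q (star (u q)) = MulOpposite.op (u q) ∧
    antipodeHom q (star (α q)) = MulOpposite.op (α q) ∧
    antipodeHom q (star (γ q)) =
      MulOpposite.op (-((q : ℝ) : ℂ)⁻¹ • (star (u q) * star (γ q))) :=
  ⟨StarPres.liftAlg_gen _ _ (antipode_star_rel q) _,
    StarPres.liftAlg_gen _ _ (antipode_star_rel q) _,
    StarPres.liftAlg_gen _ _ (antipode_star_rel q) _,
    StarPres.liftAlg_star_gen _ _ (antipode_star_rel q) _,
    StarPres.liftAlg_star_gen _ _ (antipode_star_rel q) _,
    StarPres.liftAlg_star_gen _ _ (antipode_star_rel q) _⟩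

theorem antipodeHom_v (i j : Fin 3) :
    antipodeHom q (v q i j) = MulOpposite.op (star (v q j i)) := by
  have h := triple q
  have hq := q_ne q
  apply MulOpposite.unop_injective
  fin_cases i <;> fin_cases j <;>
    simp [v, antipodeHom_gens, h.order, h.order', mul_assoc, -Complex.coe_smul]
  all_goals match_scalars
  all_goals field_simp

/-- The comultiplication on the generators and their adjoints. -/
theorem comul_gens :
    Coalgebra.comul (R := ℂ) (u q) = u q ⊗ₜ u q ∧
    Coalgebra.comul (R := ℂ) (α q) = α q ⊗ₜ α q -
      ((q : ℝ) : ℂ) • ((star (u q) * star (γ q)) ⊗ₜ γ q) ∧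
    Coalgebra.comul (R := ℂ) (γ q) = γ q ⊗ₜ α q + (star (u q) * star (α q)) ⊗ₜ γ q ∧
    Coalgebra.comul (R := ℂ) (star (u q)) = star (u q) ⊗ₜ star (u q) ∧
    Coalgebra.comul (R := ℂ) (star (α q)) = star (α q) ⊗ₜ star (α q) -
      ((q : ℝ) : ℂ) • ((γ q * u q) ⊗ₜ star (γ q)) ∧
    Coalgebra.comul (R := ℂ) (star (γ q)) = star (γ q) ⊗ₜ star (α q) +
      (α q * u q) ⊗ₜ star (γ q) := by
  have e00 : comulHom q (u q) = w q 0 0 := ofTriple_u _ _ _ _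
  have e11 : comulHom q (α q) = w q 1 1 := ofTriple_α _ _ _ _
  have e21 : comulHom q (γ q) = w q 2 1 := ofTriple_γ _ _ _ _
  rw [w00] at e00
  rw [w11] at e11
  rw [w21] at e21
  refine ⟨e00, e11, e21, ?_, ?_, ?_⟩
  · change comulHom q _ = _
    rw [map_star, e00, TensorProduct.star_tmul]
  · change comulHom q _ = _
    rw [map_star, e11]
    simp [-Complex.coe_smul]
  · change comulHom q _ = _
    rw [map_star, e21]
    simp

theorem counit_gens :
    Coalgebra.counit (R := ℂ) (u q) = 1 ∧ Coalgebra.counit (R := ℂ) (α q) = 1 ∧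
    Coalgebra.counit (R := ℂ) (γ q) = 0 ∧ Coalgebra.counit (R := ℂ) (star (u q)) = 1 ∧
    Coalgebra.counit (R := ℂ) (star (α q)) = 1 ∧ Coalgebra.counit (R := ℂ) (star (γ q)) = 0 := by
  refine ⟨?_, ?_, ?_, ?_, ?_, ?_⟩ <;> change counitHom q _ = _ <;>
    simp [counitHom, map_star]

theorem left_antipode (x : OU2 q) (hx : x = u q ∨ x = α q ∨ x = γ q ∨ x = star (u q) ∨
    x = star (α q) ∨ x = star (γ q)) : x ∈ leftAntipode (antipodeHom q) := by
  have h := triple q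
  have hq := q_ne q
  change LinearMap.mul' ℂ (OU2 q) ((opLin (antipodeHom q)).rTensor (OU2 q)
    (Coalgebra.comul x)) = algebraMap ℂ (OU2 q) (Coalgebra.counit x)
  rcases hx with rfl | rfl | rfl | rfl | rfl | rfl <;>
    simp only [comul_gens, counit_gens, antipodeHom_gens, map_sub, map_add, map_smul, map_mul,
      map_one, map_zero, LinearMap.rTensor_tmul, LinearMap.mul'_apply, opLin_apply,
      MulOpposite.unop_mul, MulOpposite.unop_smul, MulOpposite.unop_op,
      h.order, h.order', mul_assoc, star_mul, star_star, star_smul, star_neg,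
      Complex.star_def, Complex.conj_ofReal, smul_mul_assoc, mul_smul_comm, smul_neg, neg_smul,
      neg_mul, mul_neg, neg_neg, mul_one, one_mul, add_mul, mul_add, sub_mul, mul_sub]
  all_goals match_scalars
  all_goals try field_simp
  all_goals try ring_nf

theorem right_antipode (x : OU2 q) (hx : x = u q ∨ x = α q ∨ x = γ q ∨ x = star (u q) ∨
    x = star (α q) ∨ x = star (γ q)) : x ∈ rightAntipode (antipodeHom q) := by
  have h := triple q
  have hq := q_ne q
  change LinearMap.mul' ℂ (OU2 q) ((opLin (antipodeHom q)).lTensor (OU2 q)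
    (Coalgebra.comul x)) = algebraMap ℂ (OU2 q) (Coalgebra.counit x)
  rcases hx with rfl | rfl | rfl | rfl | rfl | rfl <;>
    simp only [comul_gens, counit_gens, antipodeHom_gens, map_sub, map_add, map_smul, map_mul,
      map_one, map_zero, LinearMap.lTensor_tmul, LinearMap.mul'_apply, opLin_apply,
      MulOpposite.unop_mul, MulOpposite.unop_smul, MulOpposite.unop_op,
      h.order, h.order', mul_assoc, star_mul, star_star, star_smul, star_neg,
      Complex.star_def, Complex.conj_ofReal, smul_mul_assoc, mul_smul_comm, smul_neg, neg_smul,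
      neg_mul, mul_neg, neg_neg, mul_one, one_mul, add_mul, mul_add, sub_mul, mul_sub]
  all_goals match_scalars
  all_goals try field_simp
  all_goals try ring_nf

theorem eq_top_of_gens (s : Subalgebra ℂ (OU2 q)) (h : ∀ x : OU2 q, x = u q ∨ x = α q ∨ x = γ q ∨
    x = star (u q) ∨ x = star (α q) ∨ x = star (γ q) → x ∈ s) : s = ⊤ :=
  StarPres.subalgebra_eq_top s
    (fun x => by
      cases x
      exacts [h (u q) (by simp), h (α q) (by simp), h (γ q) (by simp)])
    fun x => by
      cases x
      exacts [h (star (u q)) (by simp), h (star (α q)) (by simp), h (star (γ q)) (by simp)]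

instance : HopfAlgebra ℂ (OU2 q) :=
  hopfOfAntihom (antipodeHom q) (eq_top_of_gens q _ (left_antipode q))
    (eq_top_of_gens q _ (right_antipode q))

end OU2

/-! ## The quantum principal bundle -/

/-- The star-homomorphism `O(SU_q(3)) → O(U_q(2))`, `u i j ↦ v i j`. -/
def proj (q : Set.Ioo (0 : ℝ) 1) : OSU3 q →⋆ₐ[ℂ] OU2 q :=
  OSU3.ofMatrix (OU2.v q) (OU2.isSU3Matrix_v q)

/-- The coaction `(id ⊗ π) ∘ Δ` of `O(U_q(2))` on `O(SU_q(3))`. -/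
def coaction (q : Set.Ioo (0 : ℝ) 1) : OSU3 q →ₐ[ℂ] OSU3 q ⊗[ℂ] OU2 q :=
  (Algebra.TensorProduct.map (AlgHom.id ℂ (OSU3 q)) (proj q).toAlgHom).comp
    (Bialgebra.comulAlgHom ℂ (OSU3 q))

end QBundle

end

noncomputable section

open scoped TensorProduct

/-! Principality is reduced to one object, a strong connection: a unital linear map `ℓ : H → A ⊗ A`
lifting the translation map such that `a₀ ℓ(a₁)` lies in `B ⊗ A`, with `B` the coinvariants. Since
`a₀ ℓ(a₁)` multiplies back to `a`, it splits the multiplication `B ⊗ A → A`, so `A` is projective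
over `B`. Slicing the second leg by a functional `ψ` with `ψ 1 = 1` gives a `B`-linear map `A → B`
sending `1` to `1`, and projectivity becomes faithful flatness. Finally `a ⊗ h ↦ a ℓ(h)` inverts the
canonical map.

Let `π` be the projection to `O(U_q(2))`. If `i` is a unital section of `π` that is colinear for the
left coactions of `O(U_q(2))`, then `ℓ(h) = S(i(h)₁) ⊗ i(h)₂` is a strong connection. Such an `i`
exists because `O(SU_q(3))` is semisimple as a left comodule: it is spanned by the coefficients of
tensor powers of the fundamental corepresentation, these restrict to unitary corepresentations of
`O(U_q(2))`, and an invariant subspace of a unitary corepresentation has an invariant orthogonal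
complement. The main statements are `exists_colinear_section` and `exists_isStrongConnection`.

For the coinvariants, characters of `O(U_q(2))` yield gauge invariance at once. Conversely, the
sphere is spanned by elements with `ρ(x) = x ⊗ uⁿ`, and gauge invariance leaves only `n = 0`.

The hard inclusion is that coinvariants lie in the sphere. The algebra is filtered by the degree in
the last two columns over the sphere, which is degree `0`. Triangular representations of `O(U_q(2))`
give raising, lowering and torus operators of `U_q(su₂)`, trivial on the sphere. Quantum minors of
the last two columns are adjoints of entries of the first column, hence of degree `0`; so, modulo
lower degree, a product of `n` letters from these columns behaves like a vector of the
`(n+1)`-dimensional irreducible representation. The Casimir operator therefore acts on the degree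
`n` quotient by `qⁿ⁺¹ + q⁻ⁿ⁻¹` (`casimir_sub_mem`), whereas it is `q + q⁻¹` on coinvariants. These
numbers differ for `n ≥ 1`, so the degree of a coinvariant can be lowered to `0`. -/

namespace QBundle

/-! ### Balanced tensor products and a criterion for faithful flatness -/

namespace BalancedTensor

universe u v
variable {B : Type*} [Ring B] {N N' M : Type*} [AddCommGroup N]
  [Module Bᵐᵒᵖ N] [AddCommGroup N'] [Module Bᵐᵒᵖ N'] [AddCommGroup M] [Module B M]

theorem induction_on {C : BalancedTensor B N M → Prop} (x : BalancedTensor B N M)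
    (h0 : C 0) (ht : ∀ n m, C (tmul B n m)) (ha : ∀ x y, C x → C y → C (x + y)) : C x := by
  obtain ⟨x, rfl⟩ := QuotientAddGroup.mk_surjective x
  induction x using TensorProduct.induction_on with
  | zero => exact h0
  | tmul n m => exact ht n m
  | add x y hx hy => exact ha _ _ hx hy

/-- The map `n ↦ n ⊗ m`. -/
def tmulRight (B : Type*) [Ring B] (N : Type*) [AddCommGroup N] [Module Bᵐᵒᵖ N] [Module B M]
    (m : M) : N →+ BalancedTensor B N M :=
  AddMonoidHom.mk' (fun n => tmul B n m) fun n n' => add_tmul n n' m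

/-- The map `m ↦ n ⊗ m`. -/
def tmulLeft (B : Type*) [Ring B] [Module Bᵐᵒᵖ N] (M : Type*) [AddCommGroup M] [Module B M]
    (n : N) : M →+ BalancedTensor B N M :=
  AddMonoidHom.mk' (fun m => tmul B n m) (tmul_add n)

/-- Contraction of the second factor with a linear functional. -/
def contract (N : Type*) [AddCommGroup N] [Module Bᵐᵒᵖ N] (φ : M →ₗ[B] B) :
    BalancedTensor B N M →+ N :=
  lift (AddMonoidHom.mk' (fun n => AddMonoidHom.mk' (fun m => MulOpposite.op (φ m) • n)
      fun m m' => by simp [add_smul])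
    fun n n' => AddMonoidHom.ext fun m => by simp) fun n b m => by simp [mul_smul]

@[simp]
theorem contract_tmul (φ : M →ₗ[B] B) (n : N) (m : M) :
    contract N φ (tmul B n m) = MulOpposite.op (φ m) • n := rfl

theorem contract_map (φ : M →ₗ[B] B) (f : N →ₗ[Bᵐᵒᵖ] N') (x : BalancedTensor B N M) :
    contract N' φ (map M f x) = f (contract N φ x) := by
  induction x using induction_on with
  | h0 => simp
  | ht n m => simp
  | ha x y hx hy => simp [hx, hy]

/-- The coordinates of the elements of `N ⊗ M` determined by a linear map from `M` to a free
module. -/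
def coords (N : Type*) [AddCommGroup N] [Module Bᵐᵒᵖ N] {κ : Type*} (s : M →ₗ[B] κ →₀ B) :
    BalancedTensor B N M →+ κ →₀ N :=
  lift (AddMonoidHom.mk' (fun n => AddMonoidHom.mk'
      (fun m => (s m).mapRange (fun b => MulOpposite.op b • n) (by simp))
      fun m m' => by ext; simp [add_smul])
    fun n n' => AddMonoidHom.ext fun m => by ext; simp) fun n b m => by
      ext; simp [mul_smul]

@[simp]
theorem coords_tmul_apply {κ : Type*} (s : M →ₗ[B] κ →₀ B) (n : N) (m : M) (k : κ) :
    coords N s (tmul B n m) k = MulOpposite.op (s m k) • n := rfl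

theorem coords_map {κ : Type*} (s : M →ₗ[B] κ →₀ B) (f : N →ₗ[Bᵐᵒᵖ] N')
    (x : BalancedTensor B N M) (k : κ) : coords N' s (map M f x) k = f (coords N s x k) := by
  induction x using induction_on with
  | h0 => simp
  | ht n m => simp
  | ha x y hx hy => simp [hx, hy]

/-- The element of `N ⊗ M` with prescribed coordinates. -/
def ofCoords (B : Type*) [Ring B] (N : Type*) [AddCommGroup N] [Module Bᵐᵒᵖ N] [Module B M]
    {κ : Type*} (e : κ → M) : (κ →₀ N) →+ BalancedTensor B N M :=
  Finsupp.liftAddHom fun k => tmulRight B N (e k)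

/-- A splitting of a free module onto `M` survives tensoring with `N`: the coefficients of `s m` are
moved across the balanced tensor sign. Exactness after tensoring can then be tested on finitely
supported families in `N`. -/
theorem ofCoords_coords {κ : Type*} (s : M →ₗ[B] κ →₀ B) (e : κ → M)
    (h : ∀ m, Finsupp.linearCombination B e (s m) = m) (x : BalancedTensor B N M) :
    ofCoords B N e (coords N s x) = x := by
  induction x using induction_on with
  | h0 => simp
  | ha x y hx hy => simp [hx, hy]
  | ht n m =>
    conv_rhs => rw [← h m]
    have : coords N s (tmul B n m) = (s m).mapRange (fun b => MulOpposite.op b • n) (by simp) :=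
      rfl
    rw [this, ofCoords, Finsupp.liftAddHom_apply, Finsupp.sum_mapRange_index (by simp),
      Finsupp.linearCombination_apply, Finsupp.sum, Finsupp.sum]
    refine Eq.trans ?_ (map_sum (tmulLeft B M n) _ _).symm
    exact Finset.sum_congr rfl fun k _ => smul_tmul n (s m k) (e k)

end BalancedTensor

open BalancedTensor in
/-- A projective module admitting a functional that takes the value `1` is faithfully flat. -/
theorem isFaithfullyFlat_of_projective.{u, v} {B : Type u} {M : Type v} [Ring B] [AddCommGroup M]
    [Module B M] [hp : Module.Projective B M] (φ : M →ₗ[B] B) (m₀ : M) (hφ : φ m₀ = 1) :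
    IsFaithfullyFlat B M := by
  classical
  obtain ⟨s, hs⟩ := hp.out
  intro N₁ N₂ N₃ _ _ _ _ _ _ f g
  constructor
  · intro h x
    constructor
    · intro hx
      -- Taking coordinates commutes with `g`, so each coordinate of `x` lies in the kernel of `g`
      -- and lifts along `f`.
      have hc : ∀ k, ∃ n, f n = coords N₂ s x k := fun k =>
        (h _).1 (by rw [← coords_map, hx]; simp)
      choose n hn using hc
      -- The lift chosen for a zero coordinate need not vanish; replacing it by `0` keeps the family
      -- finitely supported.
      refine ⟨ofCoords B N₁ id (Finsupp.onFinset (coords N₂ s x).support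
        (fun k => if coords N₂ s x k = 0 then 0 else n k) fun k hk => by
          rw [Finsupp.mem_support_iff]; intro h0; simp [h0] at hk), ?_⟩
      conv_rhs => rw [← ofCoords_coords s id hs x]
      rw [ofCoords, ofCoords, Finsupp.liftAddHom_apply, Finsupp.liftAddHom_apply,
        Finsupp.onFinset_sum _ (by simp), Finsupp.sum, map_sum]
      refine Finset.sum_congr rfl fun k hk => ?_
      rw [if_neg (Finsupp.mem_support_iff.1 hk), ← hn]
      rfl
    · rintro ⟨y, rfl⟩
      induction y using induction_on with
      | h0 => simp
      | ht n m => simp [(h (f n)).2 ⟨n, rfl⟩]; exact map_zero (tmulRight B N₃ m)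
      | ha x y hx hy => simp [hx, hy]
  · intro h n
    constructor
    · intro hn
      -- Exactness is reflected by tensoring with `m₀` and contracting with `φ`: the composite `N →
      -- N ⊗ M → N` is the identity because `φ m₀ = 1`.
      obtain ⟨y, hy⟩ := (h (tmul B n m₀)).1
        (by rw [map_tmul, hn]; exact map_zero (tmulRight B N₃ m₀))
      refine ⟨contract N₁ φ y, ?_⟩
      rw [← contract_map, hy, contract_tmul, hφ, MulOpposite.op_one, one_smul]
    · rintro ⟨n, rfl⟩
      have := (h (map M f (tmul B n m₀))).2 ⟨_, rfl⟩
      have := congrArg (contract N₃ φ) this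
      simpa [hφ] using this

/-! ### Strong connections imply principality -/

section StrongConnection

variable {A H : Type*} [Ring A] [Algebra ℂ A] [Ring H] [HopfAlgebra ℂ H]

/-- The map `a ⊗ h ↦ a ℓ(h)`. -/
def mulConn (l : H →ₗ[ℂ] A ⊗[ℂ] A) : A ⊗[ℂ] H →ₗ[ℂ] A ⊗[ℂ] A :=
  (LinearMap.mul' ℂ A).rTensor A ∘ₗ (TensorProduct.assoc ℂ A A A).symm.toLinearMap ∘ₗ l.lTensor A

theorem mulConn_tmul (l : H →ₗ[ℂ] A ⊗[ℂ] A) (a : A) (h : H) :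
    mulConn l (a ⊗ₜ h) = a ⊗ₜ 1 * l h := by
  rw [mulConn, LinearMap.comp_apply, LinearMap.comp_apply, LinearMap.lTensor_tmul]
  induction l h with
  | zero => simp
  | tmul x y => simp
  | add x y hx hy => simp_all [TensorProduct.tmul_add, mul_add]

theorem mulConn_mul (l : H →ₗ[ℂ] A ⊗[ℂ] A) (a : A) (t : A ⊗[ℂ] H) :
    mulConn l (a ⊗ₜ 1 * t) = a ⊗ₜ 1 * mulConn l t := by
  induction t with
  | zero => simp
  | tmul b h => simp [mulConn_tmul, ← mul_assoc]
  | add x y hx hy => simp_all [mul_add]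

/-- The map `a ⊗ a' ↦ (a ⊗ 1) ρ(a')` on the tensor product over the base field. -/
def canLift (ρ : A →ₐ[ℂ] A ⊗[ℂ] H) : A ⊗[ℂ] A →ₗ[ℂ] A ⊗[ℂ] H :=
  TensorProduct.lift ((LinearMap.mul ℂ (A ⊗[ℂ] H)).compl₁₂
    (Algebra.TensorProduct.includeLeft : A →ₐ[ℂ] A ⊗[ℂ] H).toLinearMap ρ.toLinearMap)

@[simp]
theorem canLift_tmul (ρ : A →ₐ[ℂ] A ⊗[ℂ] H) (a b : A) : canLift ρ (a ⊗ₜ b) = a ⊗ₜ 1 * ρ b := by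
  simp [canLift]

/-- A strong connection: a unital linear map `ℓ : H → A ⊗ A` that lifts the translation map, such
that `a ↦ a₀ ℓ(a₁)` takes values in `B ⊗ A`, where `B` is the algebra of coinvariants. -/
structure IsStrongConnection (ρ : A →ₐ[ℂ] A ⊗[ℂ] H) (l : H →ₗ[ℂ] A ⊗[ℂ] A) : Prop where
  one : l 1 = 1 ⊗ₜ 1
  canLift_apply : ∀ h, canLift ρ (l h) = 1 ⊗ₜ h
  coinvariant : ∀ (a : A) (ψ : Module.Dual ℂ A),
    TensorProduct.rid ℂ A (ψ.lTensor A (mulConn l (ρ a))) ∈ coinvariants ρ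

namespace IsStrongConnection

variable {ρ : A →ₐ[ℂ] A ⊗[ℂ] H} {l : H →ₗ[ℂ] A ⊗[ℂ] A}

theorem canLift_mulConn (hl : IsStrongConnection ρ l) (t : A ⊗[ℂ] H) :
    canLift ρ (mulConn l t) = t := by
  induction t with
  | zero => simp
  | add x y hx hy => simp [hx, hy]
  | tmul a h =>
    have key : ∀ x : A ⊗[ℂ] A, canLift ρ (a ⊗ₜ 1 * x) = a ⊗ₜ 1 * canLift ρ x := by
      intro x
      induction x with
      | zero => simp
      | add x y hx hy => simp [hx, hy, mul_add]
      | tmul b c => simp [← mul_assoc]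
    rw [mulConn_tmul, key, hl.canLift_apply]
    simp

/-- Applying the counit to the second leg of `(a ⊗ 1) ρ(b)` gives `a b`, so multiplication factors
through the canonical map; on `a₀ ℓ(a₁)` the latter returns `ρ(a)`, whose counit is `a`. -/
theorem mul'_mulConn (hρ : IsComoduleAlgebra ρ) (hl : IsStrongConnection ρ l) (a : A) :
    LinearMap.mul' ℂ A (mulConn l (ρ a)) = a := by
  have h1 : ∀ a, TensorProduct.rid ℂ A (Coalgebra.counit.lTensor A (ρ a)) = a := fun a =>
    congrArg (fun f : A →ₗ[ℂ] A => f a) hρ.counit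
  have h2 : ∀ t : A ⊗[ℂ] A, TensorProduct.rid ℂ A (Coalgebra.counit.lTensor A (canLift ρ t)) =
      LinearMap.mul' ℂ A t := by
    intro t
    induction t with
    | zero => simp
    | add x y hx hy => simp [hx, hy]
    | tmul b c =>
      rw [canLift_tmul, LinearMap.mul'_apply]
      conv_rhs => rw [← h1 c]
      induction ρ c with
      | zero => simp
      | add x y hx hy => simp [hx, hy, mul_add]
      | tmul d e => simp
  rw [← h2, hl.canLift_mulConn, h1]

/-- The components of `a ↦ a₀ ℓ(a₁)`. -/
def component (hl : IsStrongConnection ρ l) (ψ : Module.Dual ℂ A) :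
    A →ₗ[coinvariants ρ] coinvariants ρ where
  toFun a := ⟨TensorProduct.rid ℂ A (ψ.lTensor A (mulConn l (ρ a))), hl.coinvariant a ψ⟩
  map_add' a b := Subtype.ext (by simp)
  map_smul' b a := Subtype.ext <| by
    have h : ρ (b • a) = (b : A) ⊗ₜ 1 * ρ a := by
      rw [← mem_coinvariants.1 b.2, ← map_mul]; rfl
    simp only [h, mulConn_mul]
    change _ = (b : A) * TensorProduct.rid ℂ A (ψ.lTensor A (mulConn l (ρ a)))
    induction mulConn l (ρ a) with
    | zero => simp
    | add x y hx hy => simp_all [mul_add]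
    | tmul d e => simp

theorem component_apply (hl : IsStrongConnection ρ l) (ψ : Module.Dual ℂ A) (a : A) :
    (hl.component ψ a : A) = TensorProduct.rid ℂ A (ψ.lTensor A (mulConn l (ρ a))) := rfl

theorem component_one (hl : IsStrongConnection ρ l) (ψ : Module.Dual ℂ A) (hψ : ψ 1 = 1) :
    hl.component ψ 1 = 1 := Subtype.ext <| by
  simp [component_apply, Algebra.TensorProduct.one_def, mulConn_tmul, hl.one, hψ]

/-- The coordinates of `a₀ ℓ(a₁)` with respect to a basis of `A`. -/
def coordinates (hl : IsStrongConnection ρ l) {κ : Type*} [DecidableEq κ]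
    (b : Module.Basis κ ℂ A) :
    A →ₗ[coinvariants ρ] κ →₀ coinvariants ρ where
  toFun a := Finsupp.onFinset
    (TensorProduct.equivFinsuppOfBasisRight b (mulConn l (ρ a))).support
    (fun k => hl.component (b.coord k) a) fun k hk => by
      rw [Finsupp.mem_support_iff, TensorProduct.equivFinsuppOfBasisRight_apply]
      intro h
      exact hk (Subtype.ext h)
  map_add' x y := by ext; simp
  map_smul' r x := by ext; simp

/-- Expanding the second leg in a basis of `A` displays `a₀ ℓ(a₁)` as an element of `B ⊗ A` with
explicit coefficients in `B`; this is what allows moving them across the balanced tensor sign. -/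
theorem sum_coordinates (hl : IsStrongConnection ρ l) {κ : Type*} [DecidableEq κ]
    (b : Module.Basis κ ℂ A)
    (a : A) : (hl.coordinates b a).sum (fun k c => (c : A) ⊗ₜ[ℂ] b k) = mulConn l (ρ a) := by
  conv_rhs => rw [← (TensorProduct.equivFinsuppOfBasisRight b).symm_apply_apply
    (mulConn l (ρ a)), TensorProduct.equivFinsuppOfBasisRight_symm_apply]
  rw [coordinates, LinearMap.coe_mk, AddHom.coe_mk, Finsupp.onFinset_sum _ (by simp), Finsupp.sum]
  refine Finset.sum_congr rfl fun k _ => ?_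
  rw [component_apply, TensorProduct.equivFinsuppOfBasisRight_apply]

/-- The coordinates of `a₀ ℓ(a₁)` split the surjection from the free `B`-module on a basis of `A`,
because `a₀ ℓ(a₁)` multiplies back to `a`. -/
theorem projective (hρ : IsComoduleAlgebra ρ) (hl : IsStrongConnection ρ l) :
    Module.Projective (coinvariants ρ) A := by
  classical
  let b := Module.Basis.ofVectorSpace ℂ A
  refine Module.Projective.of_split (hl.coordinates b)
    (Finsupp.linearCombination (coinvariants ρ) b) (LinearMap.ext fun a => ?_)
  conv_rhs => rw [LinearMap.id_apply, ← hl.mul'_mulConn hρ a, ← hl.sum_coordinates b]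
  rw [LinearMap.comp_apply, Finsupp.linearCombination_apply, Finsupp.sum, Finsupp.sum, map_sum]
  rfl

/-- The projection of the tensor product over the base field to the balanced tensor product. -/
def toBalanced (B : Subalgebra ℂ A) : A ⊗[ℂ] A →+ BalancedTensor B A A :=
  TensorProduct.liftAddHom
    (AddMonoidHom.mk' (fun a => BalancedTensor.tmulLeft B A a) fun a a' =>
      AddMonoidHom.ext fun x => BalancedTensor.add_tmul a a' x)
    fun c a a' => by
      have := BalancedTensor.smul_tmul (B := B) a (algebraMap ℂ B c) a'
      change BalancedTensor.tmul B (a * algebraMap ℂ A c) a' =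
        BalancedTensor.tmul B a (algebraMap ℂ A c * a') at this
      rw [← Algebra.commutes, ← Algebra.smul_def, ← Algebra.smul_def] at this
      exact this

@[simp]
theorem toBalanced_tmul (B : Subalgebra ℂ A) (a a' : A) :
    toBalanced B (a ⊗ₜ a') = BalancedTensor.tmul B a a' := rfl

theorem can_toBalanced (t : A ⊗[ℂ] A) : can ρ (toBalanced (coinvariants ρ) t) = canLift ρ t := by
  induction t with
  | zero => simp
  | add x y hx hy => simp [hx, hy]
  | tmul a b => simp [can_tmul]

/-- The inverse is the class of `a ⊗ h ↦ a ℓ(h)`. Starting from `a ⊗ a'`, one obtains `a a'₀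
ℓ(a'₁)`; the `B`-coefficients of `a'₀ ℓ(a'₁)` pass to the right factor, where they reassemble to
`a'`. -/
theorem can_bijective (hρ : IsComoduleAlgebra ρ) (hl : IsStrongConnection ρ l) :
    Function.Bijective (can ρ) := by
  constructor
  · refine Function.LeftInverse.injective
      (g := fun t => toBalanced (coinvariants ρ) (mulConn l t)) fun x => ?_
    induction x using BalancedTensor.induction_on with
    | h0 => simp
    | ha x y hx hy => simp [hx, hy]
    | ht a a' =>
      classical
      simp only [can_tmul, mulConn_mul]
      let b := Module.Basis.ofVectorSpace ℂ A
      conv_rhs => rw [← hl.mul'_mulConn hρ a']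
      rw [← hl.sum_coordinates b, Finsupp.sum, Finset.mul_sum, map_sum, map_sum]
      refine Eq.trans ?_ (map_sum (BalancedTensor.tmulLeft _ A a) _ _).symm
      refine Finset.sum_congr rfl fun k _ => ?_
      rw [Algebra.TensorProduct.tmul_mul_tmul, one_mul, toBalanced_tmul]
      exact BalancedTensor.smul_tmul a _ (b k)
  · intro t
    exact ⟨toBalanced (coinvariants ρ) (mulConn l t), by rw [can_toBalanced, hl.canLift_mulConn]⟩

theorem isPrincipalComoduleAlgebra (hρ : IsComoduleAlgebra ρ) (hl : IsStrongConnection ρ l)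
    (hS : Function.Bijective (HopfAlgebra.antipode ℂ (A := H))) (ψ : Module.Dual ℂ A)
    (hψ : ψ 1 = 1) : IsPrincipalComoduleAlgebra ρ where
  toIsComoduleAlgebra := hρ
  antipode_bijective := hS
  faithfullyFlat :=
    have := hl.projective hρ
    isFaithfullyFlat_of_projective (hl.component ψ) 1 (hl.component_one ψ hψ)
  can_bijective := hl.can_bijective hρ

end IsStrongConnection

end StrongConnection

/-! ### Semisimple families of operators -/

section Operators

variable {X M M' : Type*} [AddCommGroup M] [Module ℂ M] [AddCommGroup M'] [Module ℂ M']

/-- The module structure over the free algebra given by a family of operators. -/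
abbrev opModule (f : X → Module.End ℂ M) : Module (FreeAlgebra ℂ X) M :=
  Module.compHom M (FreeAlgebra.lift ℂ f).toRingHom

theorem opModule_ι (f : X → Module.End ℂ M) (x : X) (m : M) :
    letI := opModule f
    FreeAlgebra.ι ℂ x • m = f x m := by
  change FreeAlgebra.lift ℂ f (FreeAlgebra.ι ℂ x) m = f x m
  rw [FreeAlgebra.lift_ι_apply]

theorem opModule_isScalarTower (f : X → Module.End ℂ M) :
    letI := opModule f
    IsScalarTower ℂ (FreeAlgebra ℂ X) M :=
  letI := opModule f
  ⟨fun c r m => by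
    change FreeAlgebra.lift ℂ f (c • r) m = c • FreeAlgebra.lift ℂ f r m
    rw [map_smul, LinearMap.smul_apply]⟩

section Module

variable [Module (FreeAlgebra ℂ X) M] [IsScalarTower ℂ (FreeAlgebra ℂ X) M]
  [Module (FreeAlgebra ℂ X) M'] [IsScalarTower ℂ (FreeAlgebra ℂ X) M']

/-- A subspace that is invariant under the generators of the free algebra. -/
def invariantSubmodule (p : Submodule ℂ M) (h : ∀ x : X, ∀ m ∈ p, FreeAlgebra.ι ℂ x • m ∈ p) :
    Submodule (FreeAlgebra ℂ X) M where
  carrier := p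
  add_mem' := p.add_mem
  zero_mem' := p.zero_mem
  smul_mem' r m hm := by
    induction r using FreeAlgebra.induction generalizing m with
    | grade0 c => rw [algebraMap_smul]; exact p.smul_mem c hm
    | grade1 x => exact h x m hm
    | mul a b ha hb => rw [mul_smul]; exact ha _ (hb m hm)
    | add a b ha hb => rw [add_smul]; exact p.add_mem (ha m hm) (hb m hm)

theorem mem_invariantSubmodule {p : Submodule ℂ M}
    {h : ∀ x : X, ∀ m ∈ p, FreeAlgebra.ι ℂ x • m ∈ p} {m : M} :
    m ∈ invariantSubmodule p h ↔ m ∈ p := Iff.rfl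

/-- A linear map that commutes with the generators of the free algebra. -/
def intertwiner (g : M →ₗ[ℂ] M')
    (h : ∀ (x : X) m, g (FreeAlgebra.ι ℂ x • m) = FreeAlgebra.ι ℂ x • g m) :
    M →ₗ[FreeAlgebra ℂ X] M' where
  toFun := g
  map_add' := g.map_add
  map_smul' r m := by
    rw [RingHom.id_apply]
    induction r using FreeAlgebra.induction generalizing m with
    | grade0 c => rw [algebraMap_smul, algebraMap_smul, map_smul]
    | grade1 x => exact h x m
    | mul a b ha hb => rw [mul_smul, ha, hb, mul_smul]
    | add a b ha hb => rw [add_smul, map_add, ha, hb, add_smul]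

@[simp]
theorem intertwiner_apply (g : M →ₗ[ℂ] M')
    (h : ∀ (x : X) m, g (FreeAlgebra.ι ℂ x • m) = FreeAlgebra.ι ℂ x • g m) (m : M) :
    intertwiner g h m = g m := rfl

/-- A family of operators on a finite-dimensional Hilbert space that is closed under adjoints acts
semisimply. -/
theorem isSemisimpleModule_of_adjoint {V : Type*} [NormedAddCommGroup V] [InnerProductSpace ℂ V]
    [FiniteDimensional ℂ V] [Module (FreeAlgebra ℂ X) V] [IsScalarTower ℂ (FreeAlgebra ℂ X) V]
    (τ : X → X) (h : ∀ (x : X) (v w : V),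
      inner ℂ (FreeAlgebra.ι ℂ x • v) w = inner ℂ v (FreeAlgebra.ι ℂ (τ x) • w)) :
    IsSemisimpleModule (FreeAlgebra ℂ X) V where
  exists_isCompl p := by
    -- The orthogonal complement is invariant since the adjoint of each operator belongs to the
    -- family.
    refine ⟨invariantSubmodule (p.restrictScalars ℂ)ᗮ fun x m hm => ?_, ?_, ?_⟩
    · rw [Submodule.mem_orthogonal'] at hm ⊢
      intro v hv
      rw [h]
      exact hm _ (p.smul_mem _ hv)
    · rw [Submodule.disjoint_def]
      exact fun m hm hm' =>
        Submodule.disjoint_def.1 (p.restrictScalars ℂ).orthogonal_disjoint m hm hm'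
    · rw [codisjoint_iff, eq_top_iff]
      intro m _
      obtain ⟨y, hy, z, hz, hyz⟩ := Submodule.mem_sup.1
        ((Submodule.sup_orthogonal_of_hasOrthogonalProjection
          (K := p.restrictScalars ℂ)).symm ▸ Submodule.mem_top :
            m ∈ p.restrictScalars ℂ ⊔ (p.restrictScalars ℂ)ᗮ)
      exact Submodule.mem_sup.2 ⟨y, hy, z, hz, hyz⟩

open scoped Matrix in
/-- Vectors on which the operators act through matrices closed under conjugate transposes lie in
a semisimple submodule. -/
theorem exists_semisimple_of_conjTranspose {ι : Type*} [Fintype ι] (e : ι → M)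
    (m : X → Matrix ι ι ℂ) (τ : X → X)
    (h : ∀ (x : X) i, (FreeAlgebra.ι ℂ x : FreeAlgebra ℂ X) • e i = ∑ k, m x k i • e k)
    (hτ : ∀ x, m (τ x) = (m x)ᴴ) : ∃ p : Submodule (FreeAlgebra ℂ X) M,
      IsSemisimpleModule (FreeAlgebra ℂ X) p ∧ ∀ i, e i ∈ p := by
  classical
  -- The matrices act on the Hilbert space `ℂ^ι`, where adjoints are conjugate transposes. The map
  -- `θ` sending the standard basis to the vectors `e i` is an intertwiner, and its range, a
  -- quotient of a semisimple module, is the required submodule.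
  let f : X → Module.End ℂ (EuclideanSpace ℂ ι) := fun x => Matrix.toEuclideanLin (m x)
  let _ := opModule f
  have _ := opModule_isScalarTower f
  have hss : IsSemisimpleModule (FreeAlgebra ℂ X) (EuclideanSpace ℂ ι) :=
    isSemisimpleModule_of_adjoint τ fun x v w => by
      rw [opModule_ι, opModule_ι]
      simp only [f]
      rw [hτ, Matrix.toEuclideanLin_conjTranspose_eq_adjoint, LinearMap.adjoint_inner_right]
  let θ : EuclideanSpace ℂ ι →ₗ[ℂ] M :=
    { toFun := fun x => ∑ k, x k • e k
      map_add' := fun x y => by simp [add_smul, Finset.sum_add_distrib]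
      map_smul' := fun c x => by simp [mul_smul, Finset.smul_sum] }
  have hθ : ∀ (x : X) v, θ (FreeAlgebra.ι ℂ x • v) = FreeAlgebra.ι ℂ x • θ v := fun x v => by
    rw [opModule_ι]
    simp only [θ, f, LinearMap.coe_mk, AddHom.coe_mk, Finset.smul_sum]
    simp only [← algebraMap_smul (FreeAlgebra ℂ X) (v.ofLp _), ← mul_smul, ← Algebra.commutes]
    simp only [mul_smul, h, algebraMap_smul, Finset.smul_sum]
    rw [Finset.sum_comm]
    simp [Matrix.toLpLin_apply, Matrix.mulVec, dotProduct, Finset.sum_smul, smul_smul, mul_comm]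
  exact ⟨LinearMap.range (intertwiner θ hθ), IsSemisimpleModule.range _, fun i =>
    ⟨EuclideanSpace.single i 1, by simp [θ]⟩⟩

/-- A semisimple family of operators admits a splitting of every surjective intertwiner, with
a prescribed value on an invariant line. -/
theorem exists_intertwining_section [IsSemisimpleModule (FreeAlgebra ℂ X) M] (g : M →ₗ[ℂ] M')
    (hg : ∀ (x : X) m, g (FreeAlgebra.ι ℂ x • m) = FreeAlgebra.ι ℂ x • g m)
    (hs : Function.Surjective g) (m₀ : M)
    (h₀ : ∀ x : X, ∃ c : ℂ, FreeAlgebra.ι ℂ x • m₀ = c • m₀) (hm : g m₀ ≠ 0) :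
    ∃ i : M' →ₗ[ℂ] M, (∀ y, g (i y) = y) ∧
      (∀ (x : X) y, i (FreeAlgebra.ι ℂ x • y) = FreeAlgebra.ι ℂ x • i y) ∧ i (g m₀) = m₀ := by
  let G := intertwiner g hg
  let K := LinearMap.ker G
  let L : Submodule (FreeAlgebra ℂ X) M :=
    invariantSubmodule (Submodule.span ℂ {m₀}) fun x m hm => by
      obtain ⟨c, rfl⟩ := Submodule.mem_span_singleton.1 hm
      obtain ⟨d, hd⟩ := h₀ x
      rw [← algebraMap_smul (FreeAlgebra ℂ X) c m₀, ← mul_smul, ← Algebra.commutes, mul_smul, hd,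
        algebraMap_smul]
      exact Submodule.smul_mem _ _ (Submodule.smul_mem _ _ (Submodule.mem_span_singleton_self m₀))
  have hKL : Disjoint K L := by
    rw [Submodule.disjoint_def]
    intro m hm1 hm2
    obtain ⟨c, rfl⟩ := Submodule.mem_span_singleton.1 (mem_invariantSubmodule.1 hm2)
    have : g (c • m₀) = 0 := hm1
    rw [map_smul, smul_eq_zero_iff_left hm] at this
    rw [this, zero_smul]
  -- A complement of the kernel that contains the line through `m₀` is needed, so the complement is
  -- taken to `K ⊔ L` and `L` is added to it. The inverse of `g` on `L ⊔ C` is then the section, and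
  -- it sends `g m₀` to `m₀`.
  obtain ⟨C, hC⟩ := exists_isCompl (K ⊔ L)
  have hc : IsCompl K (L ⊔ C) :=
    ⟨hKL.disjoint_sup_right_of_disjoint_sup_left hC.disjoint, codisjoint_assoc.1 hC.codisjoint⟩
  have hinj : ∀ a ∈ L ⊔ C, ∀ b ∈ L ⊔ C, g a = g b → a = b := fun a ha b hb hab => by
    refine sub_eq_zero.1 (Submodule.disjoint_def.1 hc.disjoint _ ?_ ((L ⊔ C).sub_mem ha hb))
    rw [LinearMap.mem_ker, map_sub, sub_eq_zero]
    exact hab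
  have hex : ∀ y : M', ∃ a ∈ L ⊔ C, g a = y := fun y => by
    obtain ⟨m, rfl⟩ := hs y
    obtain ⟨k, hk, a, ha, rfl⟩ := Submodule.mem_sup.1
      (hc.codisjoint.eq_top.symm ▸ Submodule.mem_top : m ∈ K ⊔ (L ⊔ C))
    have hk' : g k = 0 := hk
    exact ⟨a, ha, by rw [map_add, hk', zero_add]⟩
  choose i hi hgi using hex
  refine ⟨⟨⟨i, fun x y => ?_⟩, fun c y => ?_⟩, hgi, fun x y => ?_, ?_⟩
  · refine hinj _ (hi _) _ ((L ⊔ C).add_mem (hi x) (hi y)) ?_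
    rw [hgi, map_add, hgi, hgi]
  · refine hinj _ (hi _) _ (((L ⊔ C).restrictScalars ℂ).smul_mem c (hi y)) ?_
    rw [hgi, RingHom.id_apply, map_smul, hgi]
  · refine hinj _ (hi _) _ ((L ⊔ C).smul_mem _ (hi y)) ?_
    rw [hg]
    simp only [LinearMap.coe_mk, AddHom.coe_mk, hgi]
  · refine hinj _ (hi _) _ (Submodule.mem_sup_left ?_) (hgi _)
    exact mem_invariantSubmodule.2 (Submodule.mem_span_singleton_self m₀)

end Module

end Operators

/-! ### Generation of `O(SU_q(3))` by the matrix entries alone -/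

namespace OSU3

variable (q : Set.Ioo (0 : ℝ) 1)

/-- Contracting the minor expansion `IsSU3Matrix.row` with `E` isolates one adjoint, by the
orthogonality `E_front`. Hence adjoints are quadratic in the entries, and homomorphisms need only be
compared on the entries. -/
theorem smul_star_u (m i : Fin 3) : ((1 + ((q : ℝ) : ℂ) ^ 2) * wt q m) • star (u q m i) =
    ∑ a, ∑ b, E q m a b • ∑ c, ∑ d, E q i c d • (u q a c * u q b d) := by
  calc _ = ∑ m', (∑ a, ∑ b, E q m a b * E q m' a b) • star (u q m' i) := by simp [E_front]
    _ = ∑ a, ∑ b, E q m a b • ∑ m', E q m' a b • star (u q m' i) := by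
      simp only [Finset.smul_sum, Finset.sum_smul, smul_smul]
      exact (sum_rot fun a b m' => (E q m a b * E q m' a b) • star (u q m' i)).symm
    _ = _ := by simp only [(isSU3Matrix_u q).row]

theorem star_u_mem (s : Subalgebra ℂ (OSU3 q)) (m i : Fin 3)
    (h : ∀ a c, E q i c c = 0 → c ≠ i → u q a c ∈ s) : star (u q m i) ∈ s := by
  have hne : (1 + ((q : ℝ) : ℂ) ^ 2) * wt q m ≠ 0 := mul_ne_zero (one_add_ne q) (wt_ne q m)
  rw [← inv_smul_smul₀ hne (star (u q m i)), smul_star_u]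
  refine s.smul_mem (s.sum_mem fun a _ => s.sum_mem fun b _ => s.smul_mem (s.sum_mem fun c _ =>
    s.sum_mem fun d _ => ?_) _) _
  by_cases hE : c ≠ i ∧ d ≠ i
  · exact s.smul_mem (s.mul_mem (h a c (by simp [E]) hE.1) (h b d (by simp [E]) hE.2)) _
  · have : E q i c d = 0 := by
      rw [E, if_neg]
      rintro ⟨h1, h2, -⟩
      exact hE ⟨h1.symm, h2.symm⟩
    rw [this, zero_smul]
    exact s.zero_mem

theorem subalgebra_eq_top (s : Subalgebra ℂ (OSU3 q)) (h : ∀ i j, u q i j ∈ s) : s = ⊤ :=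
  StarPres.subalgebra_eq_top s (fun x => h x.1 x.2) fun x =>
    star_u_mem q s x.1 x.2 fun a c _ _ => h a c

end OSU3

/-! ### The projection to `O(U_q(2))` and the coaction -/

section Projection

variable (q : Set.Ioo (0 : ℝ) 1)

@[simp]
theorem proj_u (i j : Fin 3) : proj q (OSU3.u q i j) = OU2.v q i j := OSU3.ofMatrix_u _ _ i j

theorem OU2.comul_v (i j : Fin 3) :
    Coalgebra.comul (R := ℂ) (OU2.v q i j) = ∑ k, OU2.v q i k ⊗ₜ[ℂ] OU2.v q k j :=
  OU2.comulHom_v q i j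

theorem OU2.comul_star_v (i j : Fin 3) : Coalgebra.comul (R := ℂ) (star (OU2.v q i j)) =
    ∑ k, star (OU2.v q i k) ⊗ₜ[ℂ] star (OU2.v q k j) :=
  OU2.comulHom_star_v q i j

theorem OU2.counit_v (i j : Fin 3) :
    Coalgebra.counit (R := ℂ) (OU2.v q i j) = if i = j then 1 else 0 :=
  OU2.counitHom_v q i j

theorem OU2.counit_star_v (i j : Fin 3) :
    Coalgebra.counit (R := ℂ) (star (OU2.v q i j)) = if i = j then 1 else 0 :=
  OU2.counitHom_star_v q i j

theorem OU2.antipode_apply (x : OU2 q) :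
    HopfAlgebra.antipode ℂ x = (OU2.antipodeHom q x).unop := rfl

theorem OU2.antipode_v (i j : Fin 3) :
    HopfAlgebra.antipode ℂ (OU2.v q i j) = star (OU2.v q j i) := by
  rw [OU2.antipode_apply, OU2.antipodeHom_v, MulOpposite.unop_op]

theorem OSU3.antipode_apply (x : OSU3 q) :
    HopfAlgebra.antipode ℂ x = (OSU3.antipodeHom q x).unop := rfl

/-- The projection as a linear map. -/
abbrev projLin : OSU3 q →ₗ[ℂ] OU2 q := (proj q).toAlgHom.toLinearMap

/-- Both sides are algebra homomorphisms, and on generators both comultiplications have the same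
matrix form. -/
theorem comul_proj (a : OSU3 q) : Coalgebra.comul (R := ℂ) (proj q a) =
    TensorProduct.map (projLin q) (projLin q) (Coalgebra.comul a) := by
  have : (Bialgebra.comulAlgHom ℂ (OU2 q)).comp (proj q).toAlgHom =
      (Algebra.TensorProduct.map (proj q).toAlgHom (proj q).toAlgHom).comp
        (Bialgebra.comulAlgHom ℂ (OSU3 q)) := by
    refine OSU3.algHom_ext (fun i j => ?_) fun i j => ?_
    · simp [OU2.comul_v, OSU3.comul_u]
    · simp [OU2.comul_star_v, OSU3.comul_star_u, map_star]
  exact congrArg (fun f : OSU3 q →ₐ[ℂ] OU2 q ⊗[ℂ] OU2 q => f a) this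

theorem proj_surjective : Function.Surjective (proj q) := by
  have : (proj q).toAlgHom.range = ⊤ := by
    refine OU2.eq_top_of_gens q _ fun x hx => ?_
    rcases hx with rfl | rfl | rfl | rfl | rfl | rfl
    · exact ⟨OSU3.u q 0 0, proj_u q 0 0⟩
    · exact ⟨OSU3.u q 1 1, proj_u q 1 1⟩
    · exact ⟨OSU3.u q 2 1, proj_u q 2 1⟩
    · exact ⟨star (OSU3.u q 0 0), (map_star (proj q) _).trans (congrArg star (proj_u q 0 0))⟩
    · exact ⟨star (OSU3.u q 1 1), (map_star (proj q) _).trans (congrArg star (proj_u q 1 1))⟩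
    · exact ⟨star (OSU3.u q 2 1), (map_star (proj q) _).trans (congrArg star (proj_u q 2 1))⟩
  intro x
  have hx : x ∈ (proj q).toAlgHom.range := this ▸ Algebra.mem_top
  exact hx

theorem coaction_apply (a : OSU3 q) :
    coaction q a = (projLin q).lTensor (OSU3 q) (Coalgebra.comul a) := rfl

theorem coaction_u (i j : Fin 3) :
    coaction q (OSU3.u q i j) = ∑ k, OSU3.u q i k ⊗ₜ[ℂ] OU2.v q k j := by
  simp [coaction_apply, OSU3.comul_u]

theorem coaction_star_u (i j : Fin 3) : coaction q (star (OSU3.u q i j)) =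
    ∑ k, star (OSU3.u q i k) ⊗ₜ[ℂ] star (OU2.v q k j) := by
  simp [coaction_apply, OSU3.comul_star_u, map_star]

theorem isComoduleAlgebra_coaction : IsComoduleAlgebra (coaction q) where
  coassoc := by
    have h := OSU3.algHom_ext (q := q)
      (f := (Algebra.TensorProduct.assoc ℂ ℂ ℂ (OSU3 q) (OU2 q) (OU2 q)).toAlgHom.comp
        ((Algebra.TensorProduct.map (coaction q) (AlgHom.id ℂ (OU2 q))).comp (coaction q)))
      (g := (Algebra.TensorProduct.map (AlgHom.id ℂ (OSU3 q))
        (Bialgebra.comulAlgHom ℂ (OU2 q))).comp (coaction q))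
      (fun i j => by
        simp [coaction_u, OU2.comul_v, TensorProduct.sum_tmul, TensorProduct.tmul_sum]
        exact Finset.sum_comm)
      (fun i j => by
        simp [coaction_star_u, OU2.comul_star_v, TensorProduct.sum_tmul, TensorProduct.tmul_sum]
        exact Finset.sum_comm)
    exact congrArg AlgHom.toLinearMap h
  counit := by
    have h := OSU3.algHom_ext (q := q)
      (f := (Algebra.TensorProduct.rid ℂ ℂ (OSU3 q)).toAlgHom.comp
        ((Algebra.TensorProduct.map (AlgHom.id ℂ (OSU3 q))
          (Bialgebra.counitAlgHom ℂ (OU2 q))).comp (coaction q)))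
      (g := AlgHom.id ℂ (OSU3 q))
      (fun i j => by simp [coaction_u, OU2.counit_v])
      (fun i j => by simp [coaction_star_u, OU2.counit_star_v])
    exact congrArg AlgHom.toLinearMap h

end Projection

/-! ### Semisimplicity of the left coaction and the colinear section -/

section UnitaryCorep

variable (q : Set.Ioo (0 : ℝ) 1)

/-- Matrix corepresentations of `O(SU_q(3))` whose restriction to `O(U_q(2))` is unitary. -/
structure IsUnitaryCorep {ι : Type} [Fintype ι] (U : ι → ι → OSU3 q) : Prop where
  comul : ∀ i j, Coalgebra.comul (R := ℂ) (U i j) = ∑ k, U i k ⊗ₜ[ℂ] U k j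
  antipode : ∀ i j, HopfAlgebra.antipode ℂ (proj q (U i j)) = star (proj q (U j i))

theorem isUnitaryCorep_u : IsUnitaryCorep q (OSU3.u q) :=
  ⟨OSU3.comul_u q, fun i j => by rw [proj_u, proj_u, OU2.antipode_v]⟩

-- Unitarity passes to tensor products because the antipode and the adjoint both reverse products.
variable {q} in
theorem IsUnitaryCorep.mul {ι κ : Type} [Fintype ι] [Fintype κ] {U : ι → ι → OSU3 q}
    {V : κ → κ → OSU3 q} (hU : IsUnitaryCorep q U) (hV : IsUnitaryCorep q V) :
    IsUnitaryCorep q fun x y : ι × κ => U x.1 y.1 * V x.2 y.2 where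
  comul x y := by
    rw [Bialgebra.comul_mul, hU.comul, hV.comul, Finset.sum_mul_sum, Fintype.sum_prod_type]
    simp
  antipode x y := by
    rw [map_mul (proj q), map_mul (proj q), star_mul, ← hU.antipode, ← hV.antipode]
    exact congrArg MulOpposite.unop (map_mul (OU2.antipodeHom q) _ _)

/-- The submonoid of the coefficients of unitary corepresentations. -/
def coefficients : Submonoid (OSU3 q) where
  carrier := {a | ∃ (ι : Type) (_ : Fintype ι) (U : ι → ι → OSU3 q) (i j : ι),
    IsUnitaryCorep q U ∧ U i j = a}
  one_mem' := ⟨Unit, inferInstance, fun _ _ => 1, (), (),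
    ⟨fun _ _ => by simp [Algebra.TensorProduct.one_def], fun _ _ => by simp⟩, rfl⟩
  mul_mem' := by
    rintro _ _ ⟨ι, _, U, i, j, hU, rfl⟩ ⟨κ, _, V, k, l, hV, rfl⟩
    exact ⟨ι × κ, inferInstance, _, (i, k), (j, l), hU.mul hV, rfl⟩

/-- Coefficients are closed under products, so their span is the subalgebra they generate, and it
contains every `u i j`. -/
theorem span_coefficients : Submodule.span ℂ (coefficients q : Set (OSU3 q)) = ⊤ := by
  have h : Algebra.adjoin ℂ (coefficients q : Set (OSU3 q)) = ⊤ :=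
    OSU3.subalgebra_eq_top q _ fun i j => Algebra.subset_adjoin
      ⟨Fin 3, inferInstance, _, i, j, isUnitaryCorep_u q, rfl⟩
  have := Algebra.adjoin_eq_span ℂ (coefficients q : Set (OSU3 q))
  rw [Submonoid.closure_eq, h] at this
  rw [← this, Algebra.top_toSubmodule]

/-- The action of functionals on `O(U_q(2))` on `O(SU_q(3))` given by the left coaction. -/
def leftOp (φ : Module.Dual ℂ (OU2 q)) : Module.End ℂ (OSU3 q) :=
  (TensorProduct.lid ℂ (OSU3 q)).toLinearMap ∘ₗ (φ ∘ₗ projLin q).rTensor (OSU3 q) ∘ₗ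
    Coalgebra.comul

/-- The action of functionals on `O(U_q(2))` by left convolution. -/
def OU2.leftOp (φ : Module.Dual ℂ (OU2 q)) : Module.End ℂ (OU2 q) :=
  (TensorProduct.lid ℂ (OU2 q)).toLinearMap ∘ₗ φ.rTensor (OU2 q) ∘ₗ Coalgebra.comul

theorem leftOp_apply (φ : Module.Dual ℂ (OU2 q)) (a : OSU3 q) : leftOp q φ a =
    TensorProduct.lid ℂ (OSU3 q) ((φ ∘ₗ projLin q).rTensor (OSU3 q) (Coalgebra.comul a)) := rfl

theorem OU2.leftOp_apply (φ : Module.Dual ℂ (OU2 q)) (a : OU2 q) : OU2.leftOp q φ a =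
    TensorProduct.lid ℂ (OU2 q) (φ.rTensor (OU2 q) (Coalgebra.comul a)) := rfl

theorem proj_leftOp (φ : Module.Dual ℂ (OU2 q)) (a : OSU3 q) :
    proj q (leftOp q φ a) = OU2.leftOp q φ (proj q a) := by
  rw [leftOp_apply, OU2.leftOp_apply, comul_proj]
  induction Coalgebra.comul (R := ℂ) a with
  | zero => simp
  | tmul x y => simp
  | add x y hx hy => simp [hx, hy]

/-- The functional `x ↦ conj (φ (S x)⋆)`. -/
def adjointFunctional (φ : Module.Dual ℂ (OU2 q)) : Module.Dual ℂ (OU2 q) where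
  toFun x := star (φ (star (HopfAlgebra.antipode ℂ x)))
  map_add' x y := by simp
  map_smul' c x := by simp

/-- A subspace stable under all functionals plays the role of a subcomodule. Every coefficient of a
unitary corepresentation lies in a semisimple submodule, and these coefficients span, so the whole
algebra is a sum of semisimple submodules. -/
theorem isSemisimpleModule_leftOp :
    letI := opModule (leftOp q)
    IsSemisimpleModule (FreeAlgebra ℂ (Module.Dual ℂ (OU2 q))) (OSU3 q) := by
  let _ := opModule (leftOp q)
  have _ := opModule_isScalarTower (leftOp q)
  refine isSemisimpleModule_of_isSemisimpleModule_submodule'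
    (ι := {p : Submodule (FreeAlgebra ℂ (Module.Dual ℂ (OU2 q))) (OSU3 q) //
      IsSemisimpleModule (FreeAlgebra ℂ (Module.Dual ℂ (OU2 q))) p}) (p := Subtype.val)
    (fun p => p.2) ?_
  suffices h : (coefficients q : Set (OSU3 q)) ⊆ (⨆ p : {p : Submodule (FreeAlgebra ℂ
      (Module.Dual ℂ (OU2 q))) (OSU3 q) // IsSemisimpleModule (FreeAlgebra ℂ
        (Module.Dual ℂ (OU2 q))) p}, p.1).restrictScalars ℂ by
    rw [← Submodule.span_le, span_coefficients, top_le_iff,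
      Submodule.restrictScalars_eq_top_iff] at h
    exact h
  rintro _ ⟨ι, _, U, i, j, hU, rfl⟩
  -- The entries of a fixed column `j` span an invariant subspace, on which `φ` acts by the
  -- transpose of `φ(π(U))`. The identity `S(π(U k l)) = π(U l k)⋆` turns the adjoint functional
  -- into the conjugate transpose.
  obtain ⟨p, hp, hm⟩ := exists_semisimple_of_conjTranspose (fun k => U k j)
    (fun φ => Matrix.of fun k l => φ (proj q (U l k))) (adjointFunctional q)
    (fun φ l => by
      rw [opModule_ι]
      simp [leftOp_apply, hU.comul])
    (fun φ => by
      ext k l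
      simp [adjointFunctional, hU.antipode])
  exact Submodule.mem_iSup_of_mem ⟨p, hp⟩ (hm i)

/-- Elements of a tensor product of vector spaces are separated by functionals on one factor. -/
theorem eq_of_rTensor_eq {M N : Type*} [AddCommGroup M] [Module ℂ M] [AddCommGroup N] [Module ℂ N]
    {x y : M ⊗[ℂ] N} (h : ∀ φ : Module.Dual ℂ M,
      TensorProduct.lid ℂ N (φ.rTensor N x) = TensorProduct.lid ℂ N (φ.rTensor N y)) : x = y := by
  classical
  apply (TensorProduct.equivFinsuppOfBasisLeft (Module.Basis.ofVectorSpace ℂ M)).injective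
  ext k
  rw [TensorProduct.equivFinsuppOfBasisLeft_apply, TensorProduct.equivFinsuppOfBasisLeft_apply]
  exact h _

/-- The projection has a unital section that is a homomorphism of left comodules. -/
theorem exists_colinear_section : ∃ i : OU2 q →ₗ[ℂ] OSU3 q, (∀ h, proj q (i h) = h) ∧ i 1 = 1 ∧
    ∀ h, (projLin q).rTensor (OSU3 q) (Coalgebra.comul (i h)) =
      i.lTensor (OU2 q) (Coalgebra.comul h) := by
  let _ := opModule (leftOp q)
  have _ := opModule_isScalarTower (leftOp q)
  let _ := opModule (OU2.leftOp q)
  have _ := opModule_isScalarTower (OU2.leftOp q)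
  have _ := isSemisimpleModule_leftOp q
  obtain ⟨i, hi, hi', h1⟩ := exists_intertwining_section (X := Module.Dual ℂ (OU2 q)) (projLin q)
    (fun φ a => by rw [opModule_ι, opModule_ι]; exact proj_leftOp q φ a) (proj_surjective q) 1
    -- The unit spans an invariant line, on which `φ` acts by `φ 1`; prescribing its lift makes the
    -- section unital.
    (fun φ => ⟨φ 1, by
      rw [opModule_ι]; simp [leftOp_apply, Algebra.TensorProduct.one_def]⟩)
    (fun h0 => by
      have h2 : Coalgebra.counit (R := ℂ) (proj q 1) = 1 := by simp
      have h3 : proj q 1 = 0 := h0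
      rw [h3, map_zero] at h2
      exact zero_ne_one h2)
  refine ⟨i, hi, ?_, fun h => eq_of_rTensor_eq fun φ => ?_⟩
  · rw [← h1]; exact congrArg i (map_one (proj q)).symm
  · have := hi' φ h
    rw [opModule_ι, opModule_ι, leftOp_apply, OU2.leftOp_apply] at this
    rw [← LinearMap.comp_apply, ← LinearMap.rTensor_comp, ← this]
    induction Coalgebra.comul (R := ℂ) h with
    | zero => simp
    | tmul x y => simp
    | add x y hx hy => simp [hx, hy]

end UnitaryCorep

section ProductMap

variable {T M N : Type*} [Ring T] [Algebra ℂ T] [AddCommGroup M] [Module ℂ M] [AddCommGroup N]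
  [Module ℂ N]

/-- The map `m ⊗ n ↦ f m * g n`. -/
def prodMap (f : M →ₗ[ℂ] T) (g : N →ₗ[ℂ] T) : M ⊗[ℂ] N →ₗ[ℂ] T :=
  LinearMap.mul' ℂ T ∘ₗ TensorProduct.map f g

@[simp]
theorem prodMap_tmul (f : M →ₗ[ℂ] T) (g : N →ₗ[ℂ] T) (m : M) (n : N) :
    prodMap f g (m ⊗ₜ n) = f m * g n := rfl

end ProductMap

/-! ### Construction of the strong connection -/

variable (q : Set.Ioo (0 : ℝ) 1)

/-- The antipode reverses the coaction. -/
theorem coaction_antipode (a : OSU3 q) : coaction q (HopfAlgebra.antipode ℂ a) =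
    TensorProduct.map (HopfAlgebra.antipode ℂ) (HopfAlgebra.antipode ℂ ∘ₗ projLin q)
      (TensorProduct.comm ℂ (OSU3 q) (OSU3 q) (Coalgebra.comul a)) := by
  -- Both sides are antihomomorphisms in `a`; written as homomorphisms to the opposite algebra they
  -- need only be compared on the entries `u i j`.
  let f : OSU3 q →ₐ[ℂ] (OSU3 q ⊗[ℂ] OU2 q)ᵐᵒᵖ :=
    (AlgHom.op (coaction q)).comp (OSU3.antipodeHom q)
  let g : OSU3 q →ₐ[ℂ] (OSU3 q ⊗[ℂ] OU2 q)ᵐᵒᵖ :=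
    (Algebra.TensorProduct.opAlgEquiv ℂ ℂ (OSU3 q) (OU2 q)).toAlgHom.comp
      ((Algebra.TensorProduct.map (OSU3.antipodeHom q)
        ((OU2.antipodeHom q).comp (proj q).toAlgHom)).comp
          ((Algebra.TensorProduct.comm ℂ (OSU3 q) (OSU3 q)).toAlgHom.comp
            (Bialgebra.comulAlgHom ℂ (OSU3 q))))
  have hfg : AlgHom.equalizer f g = ⊤ := OSU3.subalgebra_eq_top q _ fun i j => by
    simp [f, g, OSU3.antipodeHom_u, coaction_star_u, OSU3.comul_u, OU2.antipodeHom_v]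
  have hg : ∀ t : OSU3 q ⊗[ℂ] OSU3 q,
      ((Algebra.TensorProduct.opAlgEquiv ℂ ℂ (OSU3 q) (OU2 q))
        (Algebra.TensorProduct.map (OSU3.antipodeHom q)
          ((OU2.antipodeHom q).comp (proj q).toAlgHom) t)).unop =
      TensorProduct.map (HopfAlgebra.antipode ℂ) (HopfAlgebra.antipode ℂ ∘ₗ projLin q) t := by
    intro t
    induction t with
    | zero => simp
    | tmul x y => simp [OSU3.antipode_apply, OU2.antipode_apply]
    | add x y hx hy => simp [hx, hy]
  have ha : a ∈ AlgHom.equalizer f g := hfg ▸ Algebra.mem_top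
  exact (congrArg MulOpposite.unop ha).trans (hg _)

/-- The map `a ↦ S(a₁) ⊗ a₂`. -/
def translation : OSU3 q →ₗ[ℂ] OSU3 q ⊗[ℂ] OSU3 q :=
  (HopfAlgebra.antipode ℂ).rTensor (OSU3 q) ∘ₗ Coalgebra.comul

/-- In Sweedler notation this is `S(a₁) a₂ ⊗ π(a₃) = 1 ⊗ π(a)`. -/
theorem canLift_translation (a : OSU3 q) :
    canLift (coaction q) (translation q a) = 1 ⊗ₜ proj q a := by
  have key : ∀ t : OSU3 q ⊗[ℂ] OSU3 q,
      canLift (coaction q) ((HopfAlgebra.antipode ℂ).rTensor (OSU3 q) t) =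
      TensorProduct.map (LinearMap.mul' ℂ (OSU3 q) ∘ₗ
        (HopfAlgebra.antipode ℂ).rTensor (OSU3 q)) (projLin q)
        ((TensorProduct.assoc ℂ _ _ _).symm (Coalgebra.comul.lTensor (OSU3 q) t)) := by
    intro t
    induction t with
    | zero => simp
    | add x y hx hy => simp only [map_add, hx, hy]
    | tmul x y =>
      rw [LinearMap.rTensor_tmul, canLift_tmul, LinearMap.lTensor_tmul, coaction_apply]
      induction Coalgebra.comul (R := ℂ) y with
      | zero => simp
      | add z w hz hw => simp only [map_add, mul_add, TensorProduct.tmul_add, hz, hw]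
      | tmul z w => simp
  rw [translation, LinearMap.comp_apply, key, Coalgebra.coassoc_symm_apply,
    ← LinearMap.comp_apply, LinearMap.map_comp_rTensor, LinearMap.comp_assoc,
    HopfAlgebra.mul_antipode_rTensor_comul, ← LinearMap.map_comp_rTensor, LinearMap.comp_apply,
    Coalgebra.rTensor_counit_comul]
  simp

/-- The map `a ⊗ a' ↦ a ⊗ 1 ⊗ a'`. -/
abbrev insertOne : OSU3 q ⊗[ℂ] OSU3 q →ₐ[ℂ] (OSU3 q ⊗[ℂ] OU2 q) ⊗[ℂ] OSU3 q :=
  Algebra.TensorProduct.map Algebra.TensorProduct.includeLeft (AlgHom.id ℂ (OSU3 q))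

/-- The map `h ↦ 1 ⊗ h ⊗ 1`. -/
abbrev includeMiddle : OU2 q →ₐ[ℂ] (OSU3 q ⊗[ℂ] OU2 q) ⊗[ℂ] OSU3 q :=
  Algebra.TensorProduct.includeLeft.comp Algebra.TensorProduct.includeRight

/-- The map `a ⊗ a' ↦ ρ(a) ⊗ a'`. -/
abbrev coactFirst : OSU3 q ⊗[ℂ] OSU3 q →ₐ[ℂ] (OSU3 q ⊗[ℂ] OU2 q) ⊗[ℂ] OSU3 q :=
  Algebra.TensorProduct.map (coaction q) (AlgHom.id ℂ (OSU3 q))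

/-- The map `h ⊗ a ↦ S(a₁) ⊗ S(h) ⊗ a₂`. -/
def twistedTranslation : OU2 q ⊗[ℂ] OSU3 q →ₗ[ℂ] (OSU3 q ⊗[ℂ] OU2 q) ⊗[ℂ] OSU3 q :=
  prodMap ((includeMiddle q).toLinearMap ∘ₗ HopfAlgebra.antipode ℂ)
    ((insertOne q).toLinearMap ∘ₗ translation q)

/-- Since `ρ(S(a)) = S(a₂) ⊗ S(π(a₁))`, both sides equal `S(a₂) ⊗ S(π(a₁)) ⊗ a₃`. The auxiliary map
`L` sends `a ⊗ b ⊗ c` to `S(b) ⊗ S(π(a)) ⊗ c`, so the identity is coassociativity. -/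
theorem coactFirst_translation (a : OSU3 q) : coactFirst q (translation q a) =
    twistedTranslation q ((projLin q).rTensor (OSU3 q) (Coalgebra.comul a)) := by
  let L := prodMap ((includeMiddle q).toLinearMap ∘ₗ HopfAlgebra.antipode ℂ ∘ₗ projLin q)
    ((insertOne q).toLinearMap ∘ₗ (HopfAlgebra.antipode ℂ).rTensor (OSU3 q))
  have h1 : ∀ t, coactFirst q ((HopfAlgebra.antipode ℂ).rTensor (OSU3 q) t) =
      L (TensorProduct.assoc ℂ _ _ _ (Coalgebra.comul.rTensor (OSU3 q) t)) := by
    intro t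
    induction t with
    | zero => simp
    | add x y hx hy => simp only [map_add, hx, hy]
    | tmul x y =>
      simp only [LinearMap.rTensor_tmul, Algebra.TensorProduct.map_tmul, AlgHom.coe_id, id_eq,
        coaction_antipode]
      induction Coalgebra.comul (R := ℂ) x with
      | zero => simp
      | add z w hz hw => simp only [map_add, TensorProduct.add_tmul, hz, hw]
      | tmul z w => simp [L]
  have h2 : ∀ t, twistedTranslation q ((projLin q).rTensor (OSU3 q) t) =
      L (Coalgebra.comul.lTensor (OSU3 q) t) := by
    intro t
    induction t with
    | zero => simp
    | add x y hx hy => simp only [map_add, hx, hy]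
    | tmul x y => simp [L, twistedTranslation, translation]
  rw [h2, ← Coalgebra.coassoc_apply, ← h1]
  rfl

theorem exists_isStrongConnection : ∃ l, IsStrongConnection (coaction q) l := by
  obtain ⟨i, hi, hi1, hic⟩ := exists_colinear_section q
  refine ⟨translation q ∘ₗ i, ⟨?_, fun h => ?_, fun a ψ => ?_⟩⟩
  · simp [translation, hi1, Algebra.TensorProduct.one_def]
  · rw [LinearMap.comp_apply, canLift_translation, hi]
  · set l := translation q ∘ₗ i with hl
    let twist : OU2 q →ₗ[ℂ] (OSU3 q ⊗[ℂ] OU2 q) ⊗[ℂ] OSU3 q :=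
      twistedTranslation q ∘ₗ i.lTensor (OU2 q) ∘ₗ Coalgebra.comul
    -- Colinearity of `i` replaces `π(i(h)₁) ⊗ i(h)₂` by `h₁ ⊗ i(h₂)`, so coacting on the first leg
    -- of `ℓ(h)` inserts `S(h₁)` in the middle of `ℓ(h₂)`.
    have hR : ∀ h, coactFirst q (l h) = twist h := fun h => by
      rw [hl, LinearMap.comp_apply, coactFirst_translation, hic]
      rfl
    -- Multiplying the middle leg by `h₁` produces `h₁ S(h₂)`, which the antipode axiom cancels.
    have hmid : ∀ h, prodMap (includeMiddle q).toLinearMap twist (Coalgebra.comul h) =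
        insertOne q (l h) := by
      intro h
      let Θ := prodMap (includeMiddle q).toLinearMap (twistedTranslation q ∘ₗ i.lTensor (OU2 q))
      have h1 : ∀ t, prodMap (includeMiddle q).toLinearMap twist t =
          Θ (Coalgebra.comul.lTensor (OU2 q) t) := by
        intro t
        induction t with
        | zero => simp
        | add x y hx hy => simp only [map_add, hx, hy]
        | tmul x y => rfl
      have h2 : ∀ t, Θ (TensorProduct.assoc ℂ _ _ _ t) =
          prodMap (includeMiddle q).toLinearMap ((insertOne q).toLinearMap ∘ₗ l)
          ((LinearMap.mul' ℂ (OU2 q) ∘ₗ (HopfAlgebra.antipode ℂ).lTensor (OU2 q)).rTensor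
            (OU2 q) t) := by
        intro t
        induction t with
        | zero => simp
        | add x y hx hy => simp only [map_add, hx, hy]
        | tmul x y =>
          induction x with
          | zero => simp
          | add x z hx hz => simp only [map_add, TensorProduct.add_tmul, hx, hz]
          | tmul x z =>
            simp only [Θ, l, TensorProduct.assoc_tmul, prodMap_tmul, LinearMap.comp_apply,
              LinearMap.lTensor_tmul, LinearMap.rTensor_tmul, twistedTranslation,
              LinearMap.mul'_apply, AlgHom.toLinearMap_apply, map_mul, mul_assoc]
      rw [h1, ← Coalgebra.coassoc_apply, h2, ← LinearMap.comp_apply (LinearMap.rTensor _ _),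
        ← LinearMap.rTensor_comp, LinearMap.comp_assoc, HopfAlgebra.mul_antipode_lTensor_comul,
        LinearMap.rTensor_comp, LinearMap.comp_apply, Coalgebra.rTensor_counit_comul,
        LinearMap.rTensor_tmul, prodMap_tmul, Algebra.linearMap_apply, map_one,
        AlgHom.toLinearMap_apply, map_one, one_mul]
      rfl
    let Ψ := prodMap (Algebra.TensorProduct.includeLeft.comp
        Algebra.TensorProduct.includeLeft :
          OSU3 q →ₐ[ℂ] (OSU3 q ⊗[ℂ] OU2 q) ⊗[ℂ] OSU3 q).toLinearMap
      (prodMap (includeMiddle q).toLinearMap twist)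
    have hΨ1 : ∀ t, coactFirst q (mulConn l t) =
        Ψ (TensorProduct.assoc ℂ _ _ _ ((coaction q).toLinearMap.rTensor (OU2 q) t)) := by
      intro t
      induction t with
      | zero => simp
      | add x y hx hy => simp only [map_add, hx, hy]
      | tmul x y =>
        rw [mulConn_tmul, map_mul, hR, Algebra.TensorProduct.map_tmul, LinearMap.rTensor_tmul,
          AlgHom.toLinearMap_apply, map_one]
        induction coaction q x with
        | zero => simp
        | add x z hx hz => simp only [map_add, TensorProduct.add_tmul, add_mul, hx, hz]
        | tmul x z => simp [Ψ, ← mul_assoc]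
    have hΨ2 : ∀ t, Ψ (Coalgebra.comul.lTensor (OSU3 q) t) = insertOne q (mulConn l t) := by
      intro t
      induction t with
      | zero => simp
      | add x y hx hy => simp only [map_add, hx, hy]
      | tmul x y =>
        rw [LinearMap.lTensor_tmul, prodMap_tmul, hmid, mulConn_tmul, map_mul]
        simp
    -- Coacting on the first leg of `a₀ ℓ(a₁)` gives `a₀ ⊗ a₁ S(a₂)` combined with `ℓ(a₃)`;
    -- coassociativity of `ρ` brings `a₁` and `S(a₂)` together and `hmid` cancels them, leaving a
    -- trivial middle leg.
    have hfin : coactFirst q (mulConn l (coaction q a)) =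
        insertOne q (mulConn l (coaction q a)) := by
      rw [hΨ1, ← hΨ2]
      exact congrArg (fun f : OSU3 q →ₗ[ℂ] OSU3 q ⊗[ℂ] (OU2 q ⊗[ℂ] OU2 q) => Ψ (f a))
        (isComoduleAlgebra_coaction q).coassoc
    rw [mem_coinvariants]
    have e1 : ∀ t : OSU3 q ⊗[ℂ] OSU3 q, coaction q (TensorProduct.rid ℂ _ (ψ.lTensor _ t)) =
        TensorProduct.rid ℂ _ (ψ.lTensor _ (coactFirst q t)) := by
      intro t
      induction t with
      | zero => simp
      | add x y hx hy => simp only [map_add, hx, hy]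
      | tmul x y => simp
    have e2 : ∀ t : OSU3 q ⊗[ℂ] OSU3 q, TensorProduct.rid ℂ _ (ψ.lTensor _ t) ⊗ₜ[ℂ] (1 : OU2 q) =
        TensorProduct.rid ℂ _ (ψ.lTensor _ (insertOne q t)) := by
      intro t
      induction t with
      | zero => simp
      | add x y hx hy => simp only [map_add, TensorProduct.add_tmul, hx, hy]
      | tmul x y => simp [TensorProduct.smul_tmul']
    rw [e1, e2, hfin]

/-- The map `x ↦ S(x)⋆` is multiplicative and conjugate-linear, and its square fixes the generators
and their adjoints. It is therefore an involution, and `S` has the inverse `x ↦ S(x⋆)⋆`. -/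
theorem OU2.antipode_bijective :
    Function.Bijective (HopfAlgebra.antipode ℂ (A := OU2 q)) := by
  have hS := OU2.antipodeHom_gens q
  have hmul : ∀ x y : OU2 q, star (HopfAlgebra.antipode ℂ (x * y)) =
      star (HopfAlgebra.antipode ℂ x) * star (HopfAlgebra.antipode ℂ y) := fun x y => by
    rw [← star_mul]
    exact congrArg (fun z => star (MulOpposite.unop z)) (map_mul (OU2.antipodeHom q) x y)
  let s : Subalgebra ℂ (OU2 q) :=
    { carrier := {x | star (HopfAlgebra.antipode ℂ (star (HopfAlgebra.antipode ℂ x))) = x}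
      mul_mem' := fun {x y} hx hy => by
        rw [Set.mem_ofPred_eq] at hx hy ⊢
        rw [hmul, hmul, hx, hy]
      add_mem' := fun {x y} hx hy => by
        rw [Set.mem_ofPred_eq] at hx hy ⊢
        simp only [map_add, star_add, hx, hy]
      algebraMap_mem' := fun c => by
        simp [Algebra.algebraMap_eq_smul_one] }
  have hs : s = ⊤ := by
    refine OU2.eq_top_of_gens q s fun x hx => ?_
    have h := OU2.triple q
    have hq := q_ne q
    change star (HopfAlgebra.antipode ℂ (star (HopfAlgebra.antipode ℂ x))) = x
    simp only [OU2.antipode_apply]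
    rcases hx with rfl | rfl | rfl | rfl | rfl | rfl <;>
      simp only [hS, MulOpposite.unop_op, MulOpposite.unop_smul, MulOpposite.unop_mul, star_star,
        map_smul, map_mul, star_smul, star_mul, star_neg, Complex.star_def, Complex.conj_ofReal,
        h.order, h.order', smul_mul_assoc, mul_assoc, map_inv₀]
    all_goals match_scalars
    all_goals try field_simp
  have hT : ∀ x : OU2 q,
      star (HopfAlgebra.antipode ℂ (star (HopfAlgebra.antipode ℂ x))) = x := fun x => by
    have : x ∈ s := hs ▸ Algebra.mem_top
    exact this
  refine ⟨fun x y hxy => ?_, fun x => ⟨star (HopfAlgebra.antipode ℂ (star x)), ?_⟩⟩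
  · rw [← hT x, hxy, hT]
  · exact star_injective (hT (star x))

theorem isPrincipalComoduleAlgebra_coaction : IsPrincipalComoduleAlgebra (coaction q) := by
  obtain ⟨l, hl⟩ := exists_isStrongConnection q
  exact hl.isPrincipalComoduleAlgebra (isComoduleAlgebra_coaction q) (OU2.antipode_bijective q)
    (Coalgebra.counit (R := ℂ) (A := OSU3 q)) (by simp)

/-! ### Quadratic relations between the matrix entries -/

theorem E_swap_right (j : Fin 3) {a b : Fin 3} (h : a < b) :
    E q j b a = -((q : ℝ) : ℂ) * E q j a b := by
  fin_cases j <;> fin_cases a <;> fin_cases b <;> simp at h <;> simp [E, inversions] <;> ring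

theorem E_swap_left (j : Fin 3) {a b : Fin 3} (h : a < b) :
    E q b a j = -((q : ℝ) : ℂ) * E q a b j := by
  fin_cases j <;> fin_cases a <;> fin_cases b <;> simp at h <;> simp [E, inversions] <;> ring

theorem E_ne_zero {i j k : Fin 3} (hij : i ≠ j) (hik : i ≠ k) (hjk : j ≠ k) : E q i j k ≠ 0 := by
  rw [E, if_pos ⟨hij, hik, hjk⟩]
  exact pow_ne_zero _ (neg_ne_zero.2 (q_ne q))

theorem exists_third (a b : Fin 3) : ∃ i : Fin 3, i ≠ a ∧ i ≠ b := by
  fin_cases a <;> fin_cases b <;> decide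

namespace OSU3

/-! ### Commutation relations -/

/-- For a fixed `i`, only the two orderings of the complementary columns contribute to
`IsSU3Matrix.row`. The right side depends on the rows only through `E`, which is the source of all
the commutation relations. -/
theorem row_minor {i c d : Fin 3} (hcd : c < d) (hc : i ≠ c) (hd : i ≠ d) (a b : Fin 3) :
    E q i c d • (u q a c * u q b d - ((q : ℝ) : ℂ) • (u q a d * u q b c)) =
      ∑ j, E q j a b • star (u q j i) := by
  rw [← (isSU3Matrix_u q).row]
  fin_cases i <;> fin_cases c <;> fin_cases d <;> simp at hcd hc hd <;>
    simp [Fin.sum_univ_three, E, inversions, -Complex.coe_smul] <;> module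

theorem col_minor {i c d : Fin 3} (hcd : c < d) (hc : i ≠ c) (hd : i ≠ d) (a b : Fin 3) :
    E q c d i • (u q c a * u q d b - ((q : ℝ) : ℂ) • (u q d a * u q c b)) =
      ∑ j, E q a b j • star (u q i j) := by
  rw [← (isSU3Matrix_u q).col]
  fin_cases i <;> fin_cases c <;> fin_cases d <;> simp at hcd hc hd <;>
    simp [Fin.sum_univ_three, E, inversions, -Complex.coe_smul] <;> module

/-- A minor with equal rows vanishes because `E q j a a = 0`. -/
theorem row_relation (a : Fin 3) {c d : Fin 3} (hcd : c < d) :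
    u q a d * u q a c = ((q : ℝ) : ℂ)⁻¹ • (u q a c * u q a d) := by
  obtain ⟨i, hc, hd⟩ := exists_third c d
  have h := row_minor q hcd hc hd a a
  have h0 : ∀ j, E q j a a = 0 := fun j => by simp [E]
  simp only [h0, zero_smul, Finset.sum_const_zero] at h
  rw [smul_eq_zero_iff_right (E_ne_zero q hc hd hcd.ne), sub_eq_zero] at h
  rw [h, inv_smul_smul₀ (q_ne q)]

theorem col_relation {a b : Fin 3} (hab : a < b) (c : Fin 3) :
    u q b c * u q a c = ((q : ℝ) : ℂ)⁻¹ • (u q a c * u q b c) := by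
  obtain ⟨i, ha, hb⟩ := exists_third a b
  have h := col_minor q hab ha hb c c
  have h0 : ∀ j, E q c c j = 0 := fun j => by simp [E]
  simp only [h0, zero_smul, Finset.sum_const_zero] at h
  rw [smul_eq_zero_iff_right (E_ne_zero q hab.ne ha.symm hb.symm), sub_eq_zero] at h
  rw [h, inv_smul_smul₀ (q_ne q)]

/-- Exchanging the rows of a minor multiplies each `E q j a b` by `-q`. -/
theorem row_swap {a b c d : Fin 3} (hab : a < b) (hcd : c < d) :
    u q b c * u q a d - ((q : ℝ) : ℂ) • (u q b d * u q a c) =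
      -((q : ℝ) : ℂ) • (u q a c * u q b d - ((q : ℝ) : ℂ) • (u q a d * u q b c)) := by
  obtain ⟨i, hc, hd⟩ := exists_third c d
  refine smul_right_injective _ (E_ne_zero q hc hd hcd.ne) ?_
  simp only
  rw [row_minor q hcd hc hd, smul_comm, row_minor q hcd hc hd]
  simp only [E_swap_right q _ hab, Finset.smul_sum, smul_smul]

theorem col_swap {a b c d : Fin 3} (hab : a < b) (hcd : c < d) :
    u q a d * u q b c - ((q : ℝ) : ℂ) • (u q b d * u q a c) =
      -((q : ℝ) : ℂ) • (u q a c * u q b d - ((q : ℝ) : ℂ) • (u q b c * u q a d)) := by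
  obtain ⟨i, ha, hb⟩ := exists_third a b
  refine smul_right_injective _ (E_ne_zero q hab.ne ha.symm hb.symm) ?_
  simp only
  rw [col_minor q hab ha hb, smul_comm, col_minor q hab ha hb]
  simp only [E_swap_left q _ hcd, Finset.smul_sum, smul_smul]

/-- Subtracting `col_swap` from `row_swap` leaves `1 + q²` times the commutator. -/
theorem cross_relation {a b c d : Fin 3} (hab : a < b) (hcd : c < d) :
    u q b c * u q a d = u q a d * u q b c := by
  refine smul_right_injective _ (one_add_ne q) ?_
  have h1 := row_swap q hab hcd
  have h2 := col_swap q hab hcd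
  simp only
  linear_combination (norm := module) h1 - h2

theorem diagonal_relation {a b c d : Fin 3} (hab : a < b) (hcd : c < d) :
    u q b d * u q a c = u q a c * u q b d -
      (((q : ℝ) : ℂ) - ((q : ℝ) : ℂ)⁻¹) • (u q a d * u q b c) := by
  have hq := q_ne q
  have h1 := row_swap q hab hcd
  rw [cross_relation q hab hcd] at h1
  refine smul_right_injective _ hq ?_
  simp only [smul_sub, smul_smul, sub_smul, mul_inv_cancel₀ hq, one_smul] at h1 ⊢
  linear_combination (norm := module) -h1

/-- Normal ordering of the second and the third column. -/
theorem order :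
    (∀ a, u q a 2 * u q a 1 = ((q : ℝ) : ℂ)⁻¹ • (u q a 1 * u q a 2)) ∧
    (∀ c, u q 1 c * u q 0 c = ((q : ℝ) : ℂ)⁻¹ • (u q 0 c * u q 1 c)) ∧
    (∀ c, u q 2 c * u q 0 c = ((q : ℝ) : ℂ)⁻¹ • (u q 0 c * u q 2 c)) ∧
    (∀ c, u q 2 c * u q 1 c = ((q : ℝ) : ℂ)⁻¹ • (u q 1 c * u q 2 c)) ∧
    u q 1 1 * u q 0 2 = u q 0 2 * u q 1 1 ∧ u q 2 1 * u q 0 2 = u q 0 2 * u q 2 1 ∧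
    u q 2 1 * u q 1 2 = u q 1 2 * u q 2 1 ∧
    u q 1 2 * u q 0 1 = u q 0 1 * u q 1 2 -
      (((q : ℝ) : ℂ) - ((q : ℝ) : ℂ)⁻¹) • (u q 0 2 * u q 1 1) ∧
    u q 2 2 * u q 0 1 = u q 0 1 * u q 2 2 -
      (((q : ℝ) : ℂ) - ((q : ℝ) : ℂ)⁻¹) • (u q 0 2 * u q 2 1) ∧
    u q 2 2 * u q 1 1 = u q 1 1 * u q 2 2 -
      (((q : ℝ) : ℂ) - ((q : ℝ) : ℂ)⁻¹) • (u q 1 2 * u q 2 1) := by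
  refine ⟨fun a => row_relation q a (by decide), fun c => col_relation q (by decide) c,
    fun c => col_relation q (by decide) c, fun c => col_relation q (by decide) c,
    cross_relation q (by decide) (by decide), cross_relation q (by decide) (by decide),
    cross_relation q (by decide) (by decide), diagonal_relation q (by decide) (by decide),
    diagonal_relation q (by decide) (by decide), diagonal_relation q (by decide) (by decide)⟩

/-- Normal ordering inside longer products. -/
theorem order' (z : OSU3 q) :
    (∀ a, u q a 2 * (u q a 1 * z) = ((q : ℝ) : ℂ)⁻¹ • (u q a 1 * (u q a 2 * z))) ∧
    (∀ c, u q 1 c * (u q 0 c * z) = ((q : ℝ) : ℂ)⁻¹ • (u q 0 c * (u q 1 c * z))) ∧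
    (∀ c, u q 2 c * (u q 0 c * z) = ((q : ℝ) : ℂ)⁻¹ • (u q 0 c * (u q 2 c * z))) ∧
    (∀ c, u q 2 c * (u q 1 c * z) = ((q : ℝ) : ℂ)⁻¹ • (u q 1 c * (u q 2 c * z))) ∧
    u q 1 1 * (u q 0 2 * z) = u q 0 2 * (u q 1 1 * z) ∧
    u q 2 1 * (u q 0 2 * z) = u q 0 2 * (u q 2 1 * z) ∧
    u q 2 1 * (u q 1 2 * z) = u q 1 2 * (u q 2 1 * z) ∧
    u q 1 2 * (u q 0 1 * z) = u q 0 1 * (u q 1 2 * z) -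
      (((q : ℝ) : ℂ) - ((q : ℝ) : ℂ)⁻¹) • (u q 0 2 * (u q 1 1 * z)) ∧
    u q 2 2 * (u q 0 1 * z) = u q 0 1 * (u q 2 2 * z) -
      (((q : ℝ) : ℂ) - ((q : ℝ) : ℂ)⁻¹) • (u q 0 2 * (u q 2 1 * z)) ∧
    u q 2 2 * (u q 1 1 * z) = u q 1 1 * (u q 2 2 * z) -
      (((q : ℝ) : ℂ) - ((q : ℝ) : ℂ)⁻¹) • (u q 1 2 * (u q 2 1 * z)) := by
  obtain ⟨h1, h2, h3, h4, h5, h6, h7, h8, h9, h10⟩ := order q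
  refine ⟨?_, ?_, ?_, ?_, ?_, ?_, ?_, ?_, ?_, ?_⟩ <;>
    simp only [← mul_assoc, h1, h2, h3, h4, h5, h6, h7, h8, h9, h10, sub_mul, smul_mul_assoc,
      implies_true]

/-- With `E 0 1 2 = 1`, the case `i = 0` of `row_minor` writes the adjoints of the first column
through the last two columns alone, where normal ordering is available. -/
theorem star_u_zero :
    star (u q 0 0) = u q 1 1 * u q 2 2 - ((q : ℝ) : ℂ) • (u q 1 2 * u q 2 1) ∧
    star (u q 1 0) = -((q : ℝ) : ℂ)⁻¹ •
      (u q 0 1 * u q 2 2 - ((q : ℝ) : ℂ) • (u q 0 2 * u q 2 1)) ∧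
    star (u q 2 0) = (((q : ℝ) : ℂ) ^ 2)⁻¹ •
      (u q 0 1 * u q 1 2 - ((q : ℝ) : ℂ) • (u q 0 2 * u q 1 1)) := by
  have hq := q_ne q
  have h := row_minor q (i := 0) (c := 1) (d := 2) (by decide) (by decide) (by decide)
  have e : E q 0 1 2 = 1 := by simp [E, inversions]
  simp only [e, one_smul] at h
  refine ⟨?_, ?_, ?_⟩
  · rw [h]; simp [Fin.sum_univ_three, E, inversions]
  · rw [h]; simp [Fin.sum_univ_three, E, inversions, -Complex.coe_smul, smul_smul, hq]
  · rw [h]; simp [Fin.sum_univ_three, E, inversions, -Complex.coe_smul, smul_smul, hq]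

/-- A generator in the last two columns commutes with the adjoints of the entries of the first
column in the other rows. -/
theorem commute_star_u {i l j : Fin 3} (hil : i ≠ l) (hj : j ≠ 0) :
    u q i j * star (u q l 0) = star (u q l 0) * u q i j := by
  have h := order q
  have h' := order' q
  have hs := star_u_zero q
  have hq := q_ne q
  fin_cases j
  · exact absurd rfl hj
  all_goals
    fin_cases i <;> fin_cases l <;> simp at hil <;>
    simp only [Fin.zero_eta, Fin.mk_one, Fin.reduceFinMk, hs, smul_sub, mul_sub, sub_mul,
      smul_mul_assoc, mul_smul_comm, mul_assoc, h, h']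
    all_goals match_scalars
    all_goals try field_simp
    all_goals try ring_nf

theorem zero_star_u {j : Fin 3} (hj : j ≠ 0) :
    u q 0 j * star (u q 0 0) = ((q : ℝ) : ℂ) • (star (u q 0 0) * u q 0 j) := by
  have h := order q
  have h' := order' q
  have hs := star_u_zero q
  have hq := q_ne q
  fin_cases j
  · exact absurd rfl hj
  all_goals
    simp only [Fin.mk_one, Fin.reduceFinMk, hs, smul_sub, mul_sub, sub_mul,
      smul_mul_assoc, mul_smul_comm, mul_assoc, h, h']
    match_scalars
    all_goals try field_simp
    all_goals try ring_nf

theorem two_star_u {j : Fin 3} (hj : j ≠ 0) :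
    u q 2 j * star (u q 2 0) = ((q : ℝ) : ℂ)⁻¹ • (star (u q 2 0) * u q 2 j) := by
  have h := order q
  have h' := order' q
  have hs := star_u_zero q
  have hq := q_ne q
  fin_cases j
  · exact absurd rfl hj
  all_goals
    simp only [Fin.mk_one, Fin.reduceFinMk, hs, smul_sub, mul_sub, sub_mul,
      smul_mul_assoc, mul_smul_comm, mul_assoc, h, h']
    match_scalars
    all_goals try field_simp
    all_goals try ring_nf

/-- Normal ordering does not make this middle-row product a multiple of the reversed product. It is
instead eliminated by orthogonality of columns `j` and `0` in the opposite algebra. -/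
theorem one_star_u {j : Fin 3} (hj : j ≠ 0) : u q 1 j * star (u q 1 0) =
    -((wt q 1)⁻¹ • (wt q 0 • (u q 0 j * star (u q 0 0)) +
      wt q 2 • (u q 2 j * star (u q 2 0)))) := by
  have h := (isSU3Matrix_u q).ortho_col j 0
  rw [if_neg hj, Fin.sum_univ_three] at h
  rw [← smul_right_injective _ (wt_ne q 1) |>.eq_iff]
  simp only [smul_neg, smul_inv_smul₀ (wt_ne q 1)]
  rw [eq_neg_iff_add_eq_zero, ← h]
  abel

/-! ### The filtration by the degree in the last two columns -/

/-- The coordinate algebra of the quantum sphere, as a subspace. -/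
abbrev sphereSpace : Submodule ℂ (OSU3 q) := (sphere q).toSubalgebra.toSubmodule

/-- A subalgebra that contains the first column and its adjoints contains the quantum sphere. -/
theorem sphere_le (s : Subalgebra ℂ (OSU3 q)) (h : ∀ i, u q i 0 ∈ s)
    (h' : ∀ i, star (u q i 0) ∈ s) : (sphere q).toSubalgebra ≤ s := by
  rw [sphere, StarAlgebra.adjoin_toSubalgebra, Algebra.adjoin_le_iff]
  rintro x (⟨i, rfl⟩ | ⟨i, hi⟩)
  · exact h i
  · rw [← star_star x, ← hi]
    exact h' i

theorem u_mem_sphere (i : Fin 3) : u q i 0 ∈ sphere q :=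
  StarAlgebra.subset_adjoin ℂ _ ⟨i, rfl⟩

theorem star_u_mem_sphere (i : Fin 3) : star (u q i 0) ∈ sphere q :=
  star_mem (u_mem_sphere q i)

/-- The span of a column. -/
def colSpan (j : Fin 3) : Submodule ℂ (OSU3 q) := Submodule.span ℂ (Set.range fun i => u q i j)

theorem mul_u_mem {x : OSU3 q} (hx : x ∈ sphere q) (i j : Fin 3) :
    x * u q i j ∈ sphereSpace q * colSpan q j :=
  Submodule.mul_mem_mul hx (Submodule.subset_span ⟨i, rfl⟩)

theorem sphereSpace_mul_self : sphereSpace q * sphereSpace q = sphereSpace q :=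
  (sphere q).toSubalgebra.isIdempotentElem_toSubmodule

/-- Different rows commute; in equal rows, the rows `0` and `2` commute up to a power of `q`, and
the row `1` reduces to those two. -/
theorem u_mul_star_u_mem {j : Fin 3} (hj : j ≠ 0) (i l : Fin 3) :
    u q i j * star (u q l 0) ∈ sphereSpace q * colSpan q j := by
  have h0 := mul_u_mem q (star_u_mem_sphere q 0) 0 j
  have h2 := mul_u_mem q (star_u_mem_sphere q 2) 2 j
  by_cases hil : i = l
  · subst hil
    fin_cases i
    · change u q 0 j * star (u q 0 0) ∈ _
      rw [zero_star_u q hj]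
      exact Submodule.smul_mem _ _ h0
    · change u q 1 j * star (u q 1 0) ∈ _
      rw [one_star_u q hj, zero_star_u q hj, two_star_u q hj]
      exact neg_mem (Submodule.smul_mem _ _ (add_mem
        (Submodule.smul_mem _ _ (Submodule.smul_mem _ _ h0))
        (Submodule.smul_mem _ _ (Submodule.smul_mem _ _ h2))))
    · change u q 2 j * star (u q 2 0) ∈ _
      rw [two_star_u q hj]
      exact Submodule.smul_mem _ _ h2
  · rw [commute_star_u q hil hj]
    exact mul_u_mem q (star_u_mem_sphere q l) i j

theorem u_mul_u_mem {j : Fin 3} (hj : j ≠ 0) (i l : Fin 3) :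
    u q i j * u q l 0 ∈ sphereSpace q * colSpan q j := by
  have h0j : (0 : Fin 3) < j := Fin.pos_iff_ne_zero.2 hj
  rcases lt_trichotomy i l with hil | rfl | hil
  · rw [← cross_relation q hil h0j]
    exact mul_u_mem q (u_mem_sphere q l) i j
  · rw [row_relation q i h0j]
    exact Submodule.smul_mem _ _ (mul_u_mem q (u_mem_sphere q i) i j)
  · rw [diagonal_relation q hil h0j, ← cross_relation q hil h0j]
    exact sub_mem (mul_u_mem q (u_mem_sphere q l) i j)
      (Submodule.smul_mem _ _ (mul_u_mem q (u_mem_sphere q i) l j))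

theorem colSpan_mul_sphereSpace_le {j : Fin 3} (hj : j ≠ 0) :
    colSpan q j * sphereSpace q ≤ sphereSpace q * colSpan q j := by
  let T := sphereSpace q * colSpan q j
  -- The elements that can be moved from the right of the column span `C` to its left, with
  -- coefficients in the sphere `P`, form a subalgebra: `C x y ⊆ P C y ⊆ P P C = P C`. Hence
  -- generators of the sphere suffice.
  let s : Subalgebra ℂ (OSU3 q) :=
    { carrier := {x | ∀ c ∈ colSpan q j, c * x ∈ T}
      mul_mem' := fun {x y} hx hy c hc => by
        rw [← mul_assoc]
        refine Submodule.mul_induction_on (hx c hc) (fun s hs c hc => ?_) fun a b ha hb => ?_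
        · have := Submodule.mul_mem_mul hs (hy c hc)
          rwa [← mul_assoc (sphereSpace q), sphereSpace_mul_self, ← mul_assoc] at this
        · rw [add_mul]; exact T.add_mem ha hb
      add_mem' := fun {x y} hx hy c hc => by
        rw [mul_add]; exact T.add_mem (hx c hc) (hy c hc)
      algebraMap_mem' := fun r c hc => by
        rw [← Algebra.commutes]
        exact Submodule.mul_mem_mul ((sphere q).algebraMap_mem r) hc }
  have hgen : ∀ x, (∀ i, u q i j * x ∈ T) → x ∈ s := fun x hx c hc => by
    induction hc using Submodule.span_induction with
    | mem c hc => obtain ⟨i, rfl⟩ := hc; exact hx i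
    | zero => rw [zero_mul]; exact T.zero_mem
    | add a b _ _ ha hb => rw [add_mul]; exact T.add_mem ha hb
    | smul r a _ ha => rw [smul_mul_assoc]; exact T.smul_mem r ha
  have hs := sphere_le q s (fun l => hgen _ fun i => u_mul_u_mem q hj i l)
    fun l => hgen _ fun i => u_mul_star_u_mem q hj i l
  rw [Submodule.mul_le]
  exact fun c hc x hx => hs hx c hc

/-- The span of the last two columns. -/
def lastCols : Submodule ℂ (OSU3 q) := colSpan q 1 ⊔ colSpan q 2

theorem u_mem_lastCols (i : Fin 3) : u q i 1 ∈ lastCols q ∧ u q i 2 ∈ lastCols q :=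
  ⟨Submodule.mem_sup_left (Submodule.subset_span ⟨i, rfl⟩),
    Submodule.mem_sup_right (Submodule.subset_span ⟨i, rfl⟩)⟩

theorem lastCols_le {p : Submodule ℂ (OSU3 q)} (h1 : ∀ i, u q i 1 ∈ p) (h2 : ∀ i, u q i 2 ∈ p) :
    lastCols q ≤ p :=
  sup_le (Submodule.span_le.2 (Set.range_subset_iff.2 h1))
    (Submodule.span_le.2 (Set.range_subset_iff.2 h2))

theorem pow_mul_sphereSpace_le (n : ℕ) :
    (1 ⊔ lastCols q) ^ n * sphereSpace q ≤ sphereSpace q * (1 ⊔ lastCols q) ^ n := by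
  have h1 : (1 ⊔ lastCols q) * sphereSpace q ≤ sphereSpace q * (1 ⊔ lastCols q) := by
    rw [lastCols, Submodule.sup_mul, Submodule.mul_sup, Submodule.sup_mul, Submodule.mul_sup,
      one_mul, mul_one]
    exact sup_le_sup le_rfl (sup_le_sup (colSpan_mul_sphereSpace_le q (by decide))
      (colSpan_mul_sphereSpace_le q (by decide)))
  induction n with
  | zero => simp
  | succ n ih =>
    calc (1 ⊔ lastCols q) ^ (n + 1) * sphereSpace q
        = (1 ⊔ lastCols q) ^ n * ((1 ⊔ lastCols q) * sphereSpace q) := by rw [pow_succ, mul_assoc]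
      _ ≤ (1 ⊔ lastCols q) ^ n * (sphereSpace q * (1 ⊔ lastCols q)) := by gcongr
      _ ≤ sphereSpace q * (1 ⊔ lastCols q) ^ n * (1 ⊔ lastCols q) := by
        rw [← mul_assoc]; gcongr
      _ = _ := by rw [mul_assoc, pow_succ]

/-- The filtration of the coordinate algebra by the degree in the last two columns; its step `n + 1`
consists of the combinations of words of degree at most `n`. -/
def fil : ℕ → Submodule ℂ (OSU3 q)
  | 0 => ⊥
  | n + 1 => sphereSpace q * (1 ⊔ lastCols q) ^ n

theorem fil_one : fil q 1 = sphereSpace q := by rw [fil, pow_zero, mul_one]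

/-- Sphere factors can be moved to the left without raising the degree, so the filtration is
multiplicative. The index is the degree plus one, with step `0` equal to zero. -/
theorem fil_mul_le (m n : ℕ) : fil q (m + 1) * fil q (n + 1) ≤ fil q (m + n + 1) := by
  calc fil q (m + 1) * fil q (n + 1)
      = sphereSpace q * ((1 ⊔ lastCols q) ^ m * sphereSpace q) * (1 ⊔ lastCols q) ^ n := by
        simp only [fil, mul_assoc]
    _ ≤ sphereSpace q * (sphereSpace q * (1 ⊔ lastCols q) ^ m) * (1 ⊔ lastCols q) ^ n := by
        exact mul_le_mul' (mul_le_mul' le_rfl (pow_mul_sphereSpace_le q m)) le_rfl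
    _ = _ := by rw [← mul_assoc, sphereSpace_mul_self, mul_assoc, ← pow_add, fil]

theorem fil_le_succ (n : ℕ) : fil q n ≤ fil q (n + 1) := by
  cases n with
  | zero => exact bot_le
  | succ n =>
    rw [fil, fil, pow_succ]
    exact mul_le_mul' le_rfl (le_mul_of_one_le_right' le_sup_left)

theorem sphere_mul_fil_le (n : ℕ) : sphereSpace q * fil q n ≤ fil q n := by
  cases n with
  | zero => simp [fil]
  | succ n => rw [fil, ← mul_assoc, sphereSpace_mul_self]

theorem fil_mul_lastCols_le (n : ℕ) : fil q n * lastCols q ≤ fil q (n + 1) := by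
  cases n with
  | zero => simp [fil]
  | succ n =>
    rw [fil, fil, pow_succ, ← mul_assoc]
    exact mul_le_mul' le_rfl le_sup_right

theorem exists_mem_fil (x : OSU3 q) : ∃ n, x ∈ fil q (n + 1) := by
  have hmono : Monotone (fil q) := monotone_nat_of_le_succ (fil_le_succ q)
  let s : Subalgebra ℂ (OSU3 q) :=
    { carrier := {x | ∃ n, x ∈ fil q (n + 1)}
      mul_mem' := by
        rintro x y ⟨m, hm⟩ ⟨n, hn⟩
        exact ⟨m + n, fil_mul_le q m n (Submodule.mul_mem_mul hm hn)⟩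
      add_mem' := by
        rintro x y ⟨m, hm⟩ ⟨n, hn⟩
        exact ⟨m + n, add_mem (hmono (by omega) hm) (hmono (by omega) hn)⟩
      algebraMap_mem' := fun c => ⟨0, by rw [fil_one]; exact (sphere q).algebraMap_mem c⟩ }
  have hlast : lastCols q ≤ fil q 2 := by
    rw [fil, pow_one]
    calc lastCols q = 1 * lastCols q := (one_mul _).symm
      _ ≤ _ := mul_le_mul' (by
        rw [Submodule.one_le]; exact one_mem (sphere q)) le_sup_right
  have hs : s = ⊤ := by
    refine subalgebra_eq_top q s fun i j => ?_
    fin_cases j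
    · exact ⟨0, by rw [fil_one]; exact u_mem_sphere q i⟩
    · exact ⟨1, hlast (u_mem_lastCols q i).1⟩
    · exact ⟨1, hlast (u_mem_lastCols q i).2⟩
  have hx : x ∈ s := hs ▸ Algebra.mem_top
  exact hx

end OSU3

/-! ### Representations of `O(U_q(2))` and operators on `O(SU_q(3))` -/

namespace OU2

section Rep

variable {B : Type*} [Ring B] [Algebra ℂ B]

/-- The values of a representation on the generators and on their adjoints. -/
def repFun (t : ℂˣ) (a : Bˣ) (c c' : B) : U2Gen ⊕ U2Gen → B :=
  Sum.elim (U2Gen.elim (algebraMap ℂ B t) a c) (U2Gen.elim (algebraMap ℂ B ↑t⁻¹) ↑a⁻¹ c')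

theorem mul_inv_of_mul {a : Bˣ} {c : B} {s : ℂ} (h : (a : B) * c = s • (c * a)) :
    c * ↑a⁻¹ = s • (↑a⁻¹ * c) := by
  have := congrArg (fun x => (↑a⁻¹ : B) * x * ↑a⁻¹) h
  simpa [mul_assoc, -Complex.coe_smul] using this

/-- Representations in which `γ γ⋆` vanishes. -/
def rep (t : ℂˣ) (a : Bˣ) (c c' : B) (h1 : (a : B) * c = ((q : ℝ) : ℂ) • (c * a))
    (h2 : (a : B) * c' = ((q : ℝ) : ℂ) • (c' * a)) (h3 : c * c' = 0) (h4 : c' * c = 0) :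
    OU2 q →ₐ[ℂ] B :=
  -- These are algebra representations that need not respect adjoints: `c` and `c'` are independent,
  -- so each relation and its adjoint are checked separately.
  StarPres.liftAlg (repFun t a c c')
    (fun x y hxy => by
      have e1 : algebraMap ℂ B ↑t⁻¹ * algebraMap ℂ B t = 1 := by rw [← map_mul]; simp
      have e2 : algebraMap ℂ B t * algebraMap ℂ B ↑t⁻¹ = 1 := by rw [← map_mul]; simp
      cases hxy <;> simp only [map_mul, map_add, map_smul, map_one, FreeStar.lift_of,
        FreeStar.lift_star_of, repFun, U2Gen.elim, Sum.elim_inl, Sum.elim_inr, e1, e2, h1, h2, h3,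
        h4, smul_zero, add_zero, Units.mul_inv, Units.inv_mul, Algebra.commutes])
    (fun x y hxy => by
      have e1 : algebraMap ℂ B ↑t⁻¹ * algebraMap ℂ B t = 1 := by rw [← map_mul]; simp
      have e2 : algebraMap ℂ B t * algebraMap ℂ B ↑t⁻¹ = 1 := by rw [← map_mul]; simp
      cases hxy <;> simp only [map_mul, map_add, map_smul, map_one, star_mul, star_add, star_star,
        star_smul, star_one, star_pow, Complex.star_def, Complex.conj_ofReal, FreeStar.lift_of,
        FreeStar.lift_star_of, repFun, U2Gen.elim, Sum.elim_inl, Sum.elim_inr, e1, e2, h3,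
        h4, smul_zero, add_zero, Units.mul_inv, Units.inv_mul, Algebra.commutes,
        mul_inv_of_mul h1, mul_inv_of_mul h2])

theorem rep_gens {t : ℂˣ} {a : Bˣ} {c c' : B} (h1 : (a : B) * c = ((q : ℝ) : ℂ) • (c * a))
    (h2 : (a : B) * c' = ((q : ℝ) : ℂ) • (c' * a)) (h3 : c * c' = 0) (h4 : c' * c = 0) :
    rep q t a c c' h1 h2 h3 h4 (u q) = algebraMap ℂ B t ∧ rep q t a c c' h1 h2 h3 h4 (α q) = a ∧
    rep q t a c c' h1 h2 h3 h4 (γ q) = c ∧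
    rep q t a c c' h1 h2 h3 h4 (star (u q)) = algebraMap ℂ B ↑t⁻¹ ∧
    rep q t a c c' h1 h2 h3 h4 (star (α q)) = ↑a⁻¹ ∧
    rep q t a c c' h1 h2 h3 h4 (star (γ q)) = c' :=
  ⟨StarPres.liftAlg_gen _ _ _ _, StarPres.liftAlg_gen _ _ _ _, StarPres.liftAlg_gen _ _ _ _,
    StarPres.liftAlg_star_gen _ _ _ _, StarPres.liftAlg_star_gen _ _ _ _,
    StarPres.liftAlg_star_gen _ _ _ _⟩

end Rep

/-- The characters of `O(U_q(2))`. -/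
def character (t a : ℂˣ) : OU2 q →ₐ[ℂ] ℂ := rep q t a 0 0 (by simp) (by simp) (by simp) (by simp)

theorem character_v (t a : ℂˣ) (i j : Fin 3) : character q t a (v q i j) =
    if i = j then ![(t : ℂ), a, ↑a⁻¹ * ↑t⁻¹] i else 0 := by
  have h := rep_gens q (t := t) (a := a) (c := 0) (c' := 0) (by simp) (by simp) (by simp) (by simp)
  fin_cases i <;> fin_cases j <;> simp [v, character, h, -Complex.coe_smul]

theorem character_star_v (t a : ℂˣ) (i j : Fin 3) : character q t a (star (v q i j)) =
    if i = j then ![((t⁻¹ : ℂˣ) : ℂ), ((a⁻¹ : ℂˣ) : ℂ), a * t] i else 0 := by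
  have h := rep_gens q (t := t) (a := a) (c := 0) (c' := 0) (by simp) (by simp) (by simp) (by simp)
  fin_cases i <;> fin_cases j <;> simp [v, character, h, -Complex.coe_smul, mul_comm]

/-- The deformation parameter as an invertible number. -/
def unit : ℂˣ := Units.mk0 ((q : ℝ) : ℂ) (q_ne q)

@[simp]
theorem val_unit : (unit q : ℂ) = ((q : ℝ) : ℂ) := rfl

/-- The invertible diagonal matrix with given diagonal. -/
def diagUnit (a d : ℂˣ) : (Matrix (Fin 2) (Fin 2) ℂ)ˣ where
  val := !![↑a, 0; 0, ↑d]
  inv := !![↑a⁻¹, 0; 0, ↑d⁻¹]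
  val_inv := by ext i j; fin_cases i <;> fin_cases j <;> simp
  inv_val := by ext i j; fin_cases i <;> fin_cases j <;> simp

theorem val_diagUnit (a d : ℂˣ) :
    (diagUnit a d : Matrix (Fin 2) (Fin 2) ℂ) = !![↑a, 0; 0, ↑d] := rfl

theorem val_inv_diagUnit (a d : ℂˣ) :
    (↑(diagUnit a d)⁻¹ : Matrix (Fin 2) (Fin 2) ℂ) = !![↑a⁻¹, 0; 0, ↑d⁻¹] := rfl

/-- The two-dimensional representation that involves the matrix unit `γ⋆`. -/
def lowerRep : OU2 q →ₐ[ℂ] Matrix (Fin 2) (Fin 2) ℂ :=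
  -- The diagonal is dictated by `α γ⋆ = q γ⋆ α`, and the entry `-q⁻¹` normalises the image of `v 1
  -- 2 = -q γ⋆ u⋆` to a matrix unit.
  rep q 1 (diagUnit 1 (unit q)⁻¹) 0 !![0, -((q : ℝ) : ℂ)⁻¹; 0, 0] (by simp)
    (by ext i j; have := q_ne q; fin_cases i <;> fin_cases j <;>
        simp [val_diagUnit, this, -Complex.coe_smul]) (by simp) (by simp)

/-- The two-dimensional representation that involves the matrix unit `γ`. -/
def raiseRep : OU2 q →ₐ[ℂ] Matrix (Fin 2) (Fin 2) ℂ :=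
  rep q 1 (diagUnit (unit q) 1) !![0, 1; 0, 0] 0
    (by ext i j; fin_cases i <;> fin_cases j <;>
        simp [val_diagUnit, -Complex.coe_smul]) (by simp) (by simp) (by simp)

theorem lowerRep_v (i j : Fin 3) : lowerRep q (v q i j) =
    ![![1, 0, 0], ![0, !![1, 0; 0, ((q : ℝ) : ℂ)⁻¹], !![0, 1; 0, 0]],
      ![0, 0, !![1, 0; 0, ((q : ℝ) : ℂ)]]] i j := by
  have hq := q_ne q
  obtain ⟨h1, h2, h3, h4, h5, h6⟩ :
      lowerRep q (u q) = algebraMap ℂ _ ((1 : ℂˣ) : ℂ) ∧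
      lowerRep q (α q) = ↑(diagUnit 1 (unit q)⁻¹) ∧ lowerRep q (γ q) = 0 ∧
      lowerRep q (star (u q)) = algebraMap ℂ _ (((1 : ℂˣ)⁻¹ : ℂˣ) : ℂ) ∧
      lowerRep q (star (α q)) = ↑(diagUnit 1 (unit q)⁻¹)⁻¹ ∧
      lowerRep q (star (γ q)) = !![0, -((q : ℝ) : ℂ)⁻¹; 0, 0] := rep_gens q _ _ _ _
  rw [val_inv_diagUnit] at h5
  fin_cases i <;> fin_cases j <;>
    simp [v, h1, h2, h3, h4, h5, h6, val_diagUnit, hq, -Complex.coe_smul]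

theorem lowerRep_vals : lowerRep q (v q 0 0) = 1 ∧
    lowerRep q (v q 0 1) = 0 ∧
    lowerRep q (v q 0 2) = 0 ∧
    lowerRep q (v q 1 0) = 0 ∧
    lowerRep q (v q 1 1) = !![1, 0; 0, ((q : ℝ) : ℂ)⁻¹] ∧
    lowerRep q (v q 1 2) = !![0, 1; 0, 0] ∧
    lowerRep q (v q 2 0) = 0 ∧
    lowerRep q (v q 2 1) = 0 ∧
    lowerRep q (v q 2 2) = !![1, 0; 0, ((q : ℝ) : ℂ)] :=
  ⟨lowerRep_v q 0 0, lowerRep_v q 0 1, lowerRep_v q 0 2, lowerRep_v q 1 0, lowerRep_v q 1 1,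
    lowerRep_v q 1 2, lowerRep_v q 2 0, lowerRep_v q 2 1, lowerRep_v q 2 2⟩

theorem raiseRep_v (i j : Fin 3) : raiseRep q (v q i j) =
    ![![1, 0, 0], ![0, !![((q : ℝ) : ℂ), 0; 0, 1], 0],
      ![0, !![0, 1; 0, 0], !![((q : ℝ) : ℂ)⁻¹, 0; 0, 1]]] i j := by
  obtain ⟨h1, h2, h3, h4, h5, h6⟩ :
      raiseRep q (u q) = algebraMap ℂ _ ((1 : ℂˣ) : ℂ) ∧
      raiseRep q (α q) = ↑(diagUnit (unit q) 1) ∧ raiseRep q (γ q) = !![0, 1; 0, 0] ∧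
      raiseRep q (star (u q)) = algebraMap ℂ _ (((1 : ℂˣ)⁻¹ : ℂˣ) : ℂ) ∧
      raiseRep q (star (α q)) = ↑(diagUnit (unit q) 1)⁻¹ ∧
      raiseRep q (star (γ q)) = 0 := rep_gens q _ _ _ _
  rw [val_inv_diagUnit] at h5
  fin_cases i <;> fin_cases j <;>
    simp [v, h1, h2, h3, h4, h5, h6, val_diagUnit, -Complex.coe_smul]

theorem raiseRep_vals : raiseRep q (v q 0 0) = 1 ∧
    raiseRep q (v q 0 1) = 0 ∧
    raiseRep q (v q 0 2) = 0 ∧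
    raiseRep q (v q 1 0) = 0 ∧
    raiseRep q (v q 1 1) = !![((q : ℝ) : ℂ), 0; 0, 1] ∧
    raiseRep q (v q 1 2) = 0 ∧
    raiseRep q (v q 2 0) = 0 ∧
    raiseRep q (v q 2 1) = !![0, 1; 0, 0] ∧
    raiseRep q (v q 2 2) = !![((q : ℝ) : ℂ)⁻¹, 0; 0, 1] :=
  ⟨raiseRep_v q 0 0, raiseRep_v q 0 1, raiseRep_v q 0 2, raiseRep_v q 1 0, raiseRep_v q 1 1,
    raiseRep_v q 1 2, raiseRep_v q 2 0, raiseRep_v q 2 1, raiseRep_v q 2 2⟩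

end OU2

namespace OSU3

/-- The homomorphism to matrices over `O(SU_q(3))` induced by a matrix representation of
`O(U_q(2))`. -/
def matrixOp (f : OU2 q →ₐ[ℂ] Matrix (Fin 2) (Fin 2) ℂ) :
    OSU3 q →ₐ[ℂ] Matrix (Fin 2) (Fin 2) (OSU3 q) :=
  (matrixEquivTensor (Fin 2) ℂ (OSU3 q)).symm.toAlgHom.comp
    ((Algebra.TensorProduct.map (AlgHom.id ℂ (OSU3 q)) f).comp (coaction q))

theorem matrixOp_u (f : OU2 q →ₐ[ℂ] Matrix (Fin 2) (Fin 2) ℂ) (i j : Fin 3) (k l : Fin 2) :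
    matrixOp q f (u q i j) k l = ∑ m, f (OU2.v q m j) k l • u q i m := by
  simp [matrixOp, coaction_u, Matrix.sum_apply, matrixEquivTensor_apply_symm, Algebra.smul_def,
    Algebra.commutes]

/-- If the coaction becomes trivial after applying the representation, then the off-diagonal entry,
which is the raising or lowering operator, vanishes. -/
theorem matrixOp_of_map_coaction (f : OU2 q →ₐ[ℂ] Matrix (Fin 2) (Fin 2) ℂ) {x : OSU3 q}
    (hx : Algebra.TensorProduct.map (AlgHom.id ℂ (OSU3 q)) f (coaction q x) = x ⊗ₜ 1)
    (k l : Fin 2) : matrixOp q f x k l = if k = l then x else 0 := by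
  simp [matrixOp, hx, matrixEquivTensor_apply_symm, Matrix.one_apply]

/-- The automorphism that rescales the columns by a character of `O(U_q(2))`. -/
def torus (t a : ℂˣ) : OSU3 q →ₐ[ℂ] OSU3 q :=
  (Algebra.TensorProduct.rid ℂ ℂ (OSU3 q)).toAlgHom.comp
    ((Algebra.TensorProduct.map (AlgHom.id ℂ (OSU3 q)) (OU2.character q t a)).comp (coaction q))

theorem torus_u (t a : ℂˣ) (i j : Fin 3) :
    torus q t a (u q i j) = ![(t : ℂ), a, ↑a⁻¹ * ↑t⁻¹] j • u q i j := by
  simp [torus, coaction_u, OU2.character_v, ite_smul, -Complex.coe_smul]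

theorem torus_star_u (t a : ℂˣ) (i j : Fin 3) : torus q t a (star (u q i j)) =
    ![((t⁻¹ : ℂˣ) : ℂ), ((a⁻¹ : ℂˣ) : ℂ), a * t] j • star (u q i j) := by
  simp [torus, coaction_star_u, OU2.character_star_v, ite_smul, -Complex.coe_smul]

theorem torus_of_map_coaction (t a : ℂˣ) {x : OSU3 q} (hx : Algebra.TensorProduct.map
    (AlgHom.id ℂ (OSU3 q)) (OU2.character q t a) (coaction q x) = x ⊗ₜ 1) :
    torus q t a x = x := by
  simp [torus, hx]

/-- The action of the lowering operator. -/
def lower : Module.End ℂ (OSU3 q) :=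
  Matrix.entryLinearMap ℂ (OSU3 q) 0 1 ∘ₗ (matrixOp q (OU2.lowerRep q)).toLinearMap

/-- The action of the raising operator. -/
def raise : Module.End ℂ (OSU3 q) :=
  Matrix.entryLinearMap ℂ (OSU3 q) 0 1 ∘ₗ (matrixOp q (OU2.raiseRep q)).toLinearMap

theorem lower_eq (x : OSU3 q) : lower q x = matrixOp q (OU2.lowerRep q) x 0 1 := rfl

theorem raise_eq (x : OSU3 q) : raise q x = matrixOp q (OU2.raiseRep q) x 0 1 := rfl

/-- Elements on which two homomorphisms describe the diagonal of an upper triangular matrix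
representation. -/
def triangular (g : OSU3 q →ₐ[ℂ] Matrix (Fin 2) (Fin 2) (OSU3 q)) (f f' : OSU3 q →ₐ[ℂ] OSU3 q) :
    Subalgebra ℂ (OSU3 q) where
  carrier := {x | g x 1 0 = 0 ∧ g x 0 0 = f x ∧ g x 1 1 = f' x}
  mul_mem' := fun {x y} hx hy => by
    obtain ⟨h1, h2, h3⟩ := hx
    obtain ⟨h4, h5, h6⟩ := hy
    simp [Matrix.mul_apply, h1, h2, h3, h4, h5, h6]
  add_mem' := fun {x y} hx hy => by
    obtain ⟨h1, h2, h3⟩ := hx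
    obtain ⟨h4, h5, h6⟩ := hy
    simp [h1, h2, h3, h4, h5, h6]
  algebraMap_mem' := fun r => by simp [Matrix.algebraMap_matrix_apply]

/-- The matrix homomorphism is upper triangular with diagonal `id` and a torus automorphism; the
corner entry of a product gives a twisted Leibniz rule. -/
theorem lower_mul (x y : OSU3 q) : lower q (x * y) =
    x * lower q y + lower q x * torus q 1 (OU2.unit q)⁻¹ y := by
  have h := subalgebra_eq_top q (triangular q (matrixOp q (OU2.lowerRep q)) (AlgHom.id ℂ _)
    (torus q 1 (OU2.unit q)⁻¹)) fun i j => by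
      have hq := q_ne q
      refine ⟨?_, ?_, ?_⟩ <;> fin_cases j <;>
        simp [matrixOp_u, OU2.lowerRep_vals, Fin.sum_univ_three, torus_u, -Complex.coe_smul]
  have hx : x ∈ triangular q _ _ _ := h ▸ Algebra.mem_top
  have hy : y ∈ triangular q _ _ _ := h ▸ Algebra.mem_top
  rw [lower_eq, map_mul, Matrix.mul_apply, Fin.sum_univ_two, hx.2.1, hy.2.2, AlgHom.id_apply,
    lower_eq, lower_eq]

theorem raise_mul (x y : OSU3 q) : raise q (x * y) =
    torus q 1 (OU2.unit q) x * raise q y + raise q x * y := by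
  have h := subalgebra_eq_top q (triangular q (matrixOp q (OU2.raiseRep q))
    (torus q 1 (OU2.unit q)) (AlgHom.id ℂ _)) fun i j => by
      have hq := q_ne q
      refine ⟨?_, ?_, ?_⟩ <;> fin_cases j <;>
        simp [matrixOp_u, OU2.raiseRep_vals, Fin.sum_univ_three, torus_u, -Complex.coe_smul]
  have hx : x ∈ triangular q _ _ _ := h ▸ Algebra.mem_top
  have hy : y ∈ triangular q _ _ _ := h ▸ Algebra.mem_top
  rw [raise_eq, map_mul, Matrix.mul_apply, Fin.sum_univ_two, hx.2.1, hy.2.2, AlgHom.id_apply,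
    raise_eq, raise_eq]

theorem lower_one : lower q 1 = 0 := by simp [lower_eq]

theorem raise_one : raise q 1 = 0 := by simp [raise_eq]

theorem lower_u (i : Fin 3) : lower q (u q i 1) = 0 ∧ lower q (u q i 2) = u q i 1 := by
  constructor <;> simp [lower_eq, matrixOp_u, OU2.lowerRep_vals, Fin.sum_univ_three]

theorem raise_u (i : Fin 3) : raise q (u q i 1) = u q i 2 ∧ raise q (u q i 2) = 0 := by
  constructor <;> simp [raise_eq, matrixOp_u, OU2.raiseRep_vals, Fin.sum_univ_three]

theorem map_coaction_of_mem_coinvariants {B : Type*} [Ring B] [Algebra ℂ B] (f : OU2 q →ₐ[ℂ] B)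
    {x : OSU3 q} (hx : x ∈ coinvariants (coaction q)) :
    Algebra.TensorProduct.map (AlgHom.id ℂ (OSU3 q)) f (coaction q x) = x ⊗ₜ 1 := by
  rw [mem_coinvariants] at hx
  simp [hx]

/-- The coaction followed by a homomorphism that kills the central unitary is trivial on the quantum
sphere. -/
theorem map_coaction_of_mem_sphere {B : Type*} [Ring B] [Algebra ℂ B] (f : OU2 q →ₐ[ℂ] B)
    (hf : f (OU2.v q 0 0) = 1) {x : OSU3 q} (hx : x ∈ sphere q) :
    Algebra.TensorProduct.map (AlgHom.id ℂ (OSU3 q)) f (coaction q x) = x ⊗ₜ 1 := by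
  have hf' : f (star (OU2.v q 0 0)) = 1 := by
    have h := congrArg f ((OU2.triple q).tt)
    rw [map_mul, map_one] at h
    change f (star (OU2.v q 0 0)) * f (OU2.v q 0 0) = 1 at h
    rwa [hf, mul_one] at h
  refine sphere_le q (AlgHom.equalizer ((Algebra.TensorProduct.map (AlgHom.id ℂ (OSU3 q)) f).comp
    (coaction q)) Algebra.TensorProduct.includeLeft) (fun i => ?_) (fun i => ?_) hx
  · have h : OU2.v q 1 0 = 0 ∧ OU2.v q 2 0 = 0 := ⟨rfl, rfl⟩
    simp [coaction_u, Fin.sum_univ_three, h, hf]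
  · have h : OU2.v q 1 0 = 0 ∧ OU2.v q 2 0 = 0 := ⟨rfl, rfl⟩
    simp [coaction_star_u, Fin.sum_univ_three, h, hf']

theorem operators_of_mem_coinvariants {x : OSU3 q} (hx : x ∈ coinvariants (coaction q)) (a : ℂˣ) :
    lower q x = 0 ∧ raise q x = 0 ∧ torus q 1 a x = x :=
  ⟨matrixOp_of_map_coaction q _ (map_coaction_of_mem_coinvariants q _ hx) 0 1,
    matrixOp_of_map_coaction q _ (map_coaction_of_mem_coinvariants q _ hx) 0 1,
    torus_of_map_coaction q _ _ (map_coaction_of_mem_coinvariants q _ hx)⟩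

/-- The first column coacts only through `u`, which all three representations send to `1`. The
operators thus see only the `SU_q(2)` part and are trivial on the sphere, which makes them linear
over it from the left. -/
theorem operators_of_mem_sphere {x : OSU3 q} (hx : x ∈ sphere q) (a : ℂˣ) :
    lower q x = 0 ∧ raise q x = 0 ∧ torus q 1 a x = x :=
  ⟨matrixOp_of_map_coaction q _ (map_coaction_of_mem_sphere q _ (OU2.lowerRep_v q 0 0) hx) 0 1,
    matrixOp_of_map_coaction q _ (map_coaction_of_mem_sphere q _ (OU2.raiseRep_v q 0 0) hx) 0 1,
    torus_of_map_coaction q _ _ (map_coaction_of_mem_sphere q _ (OU2.character_v q 1 a 0 0) hx)⟩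

theorem lower_sphere_mul {s : OSU3 q} (hs : s ∈ sphere q) (x : OSU3 q) :
    lower q (s * x) = s * lower q x := by
  rw [lower_mul, (operators_of_mem_sphere q hs 1).1, zero_mul, add_zero]

theorem raise_sphere_mul {s : OSU3 q} (hs : s ∈ sphere q) (x : OSU3 q) :
    raise q (s * x) = s * raise q x := by
  obtain ⟨-, h, h'⟩ := operators_of_mem_sphere q hs (OU2.unit q)
  rw [raise_mul, h, h', zero_mul, add_zero]

/-! ### The Casimir operator -/

/-- Ordered words in the last two columns: the letters have the row indices listed in `l` (from
right to left), and the last `r` of them are taken from the last column. -/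
def word : List (Fin 3) → ℕ → OSU3 q
  | [], 0 => 1
  | [], _ + 1 => 0
  | i :: l, 0 => word l 0 * u q i 1
  | i :: l, r + 1 => word l r * u q i 2

theorem word_mem_fil (l : List (Fin 3)) (r : ℕ) : word q l r ∈ fil q (l.length + 1) := by
  induction l generalizing r with
  | nil =>
    rw [List.length_nil, zero_add, fil_one]
    cases r with
    | zero => exact (sphere q).one_mem
    | succ r => exact (sphere q).zero_mem
  | cons i l ih =>
    cases r with
    | zero => exact fil_mul_lastCols_le q _ (Submodule.mul_mem_mul (ih 0) (u_mem_lastCols q i).1)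
    | succ r => exact fil_mul_lastCols_le q _ (Submodule.mul_mem_mul (ih r) (u_mem_lastCols q i).2)

theorem word_eq_zero (l : List (Fin 3)) (r : ℕ) (h : l.length < r) : word q l r = 0 := by
  induction l generalizing r with
  | nil => obtain ⟨r, rfl⟩ := Nat.exists_eq_succ_of_ne_zero h.ne'; rfl
  | cons i l ih =>
    obtain ⟨r, rfl⟩ := Nat.exists_eq_succ_of_ne_zero (Nat.zero_lt_of_lt h).ne'
    rw [word, ih r (by simpa using h), zero_mul]

/-- By `row_minor` this is a multiple of a combination of adjoints of the first column. In the
graded algebra the letters of columns `2` and `1` may therefore exchange their columns, at the cost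
of `q⁻¹`, while the row indices stay in place. -/
theorem minor_mem_sphere (i k : Fin 3) :
    u q k 2 * u q i 1 - ((q : ℝ) : ℂ)⁻¹ • (u q k 1 * u q i 2) ∈ sphere q := by
  have h := row_minor q (i := 0) (c := 1) (d := 2) (by decide) (by decide) (by decide) k i
  have h1 : E q 0 1 2 = 1 := by simp [E, inversions]
  rw [h1, one_smul] at h
  have h2 : u q k 1 * u q i 2 - ((q : ℝ) : ℂ) • (u q k 2 * u q i 1) ∈ sphere q := by
    rw [h]
    exact sum_mem fun j _ => (sphere q).toSubalgebra.smul_mem (star_u_mem_sphere q j) _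
  have h3 := (sphere q).toSubalgebra.smul_mem h2 (-((q : ℝ) : ℂ)⁻¹)
  have h4 : ∀ x ∈ (sphere q).toSubalgebra, x ∈ sphere q := fun _ hx => hx
  convert h4 _ h3 using 1
  rw [smul_sub, smul_smul, neg_mul, inv_mul_cancel₀ (q_ne q)]
  module

theorem fil_mul_sphere_le (n : ℕ) : fil q n * sphereSpace q ≤ fil q n := by
  cases n with
  | zero => simp [fil]
  | succ n => rw [← fil_one]; exact fil_mul_le q n 0

/-- The label of column `1` travels left through `r + 1` letters of column `2`, the row indices
staying fixed. Each exchange costs `q⁻¹` and a minor in the sphere, hence a term of smaller degree.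
-/
theorem word_mul_sub_mem (l : List (Fin 3)) (i : Fin 3) {r : ℕ} (hr : r < l.length) :
    word q l (r + 1) * u q i 1 - (((q : ℝ) : ℂ)⁻¹ ^ (r + 1)) • (word q l r * u q i 2) ∈
      fil q (l.length + 1) := by
  induction l generalizing r i with
  | nil => simp at hr
  | cons k m ih =>
    rw [List.length_cons, Nat.lt_succ_iff] at hr
    rw [List.length_cons]
    have h1 : word q m r * (u q k 2 * u q i 1 - ((q : ℝ) : ℂ)⁻¹ • (u q k 1 * u q i 2)) ∈
        fil q (m.length + 1) :=
      fil_mul_sphere_le q _ (Submodule.mul_mem_mul (word_mem_fil q m r) (minor_mem_sphere q i k))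
    cases r with
    | zero =>
      convert fil_le_succ q _ h1 using 1
      simp only [word, mul_sub, mul_smul_comm, mul_assoc, zero_add, pow_one]
    | succ r =>
      have h2 := fil_mul_lastCols_le q _ (Submodule.mul_mem_mul (ih k hr) (u_mem_lastCols q i).2)
      convert add_mem (fil_le_succ q _ h1)
        (Submodule.smul_mem _ (((q : ℝ) : ℂ)⁻¹) h2) using 1
      simp only [word, mul_sub, sub_mul, smul_sub, smul_mul_assoc, mul_smul_comm, mul_assoc,
        smul_smul, pow_succ' _ (r + 1)]
      abel

/-- The `q`-number attached to an integer. -/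
def qnum (m : ℤ) : ℂ :=
  (((q : ℝ) : ℂ) ^ m - ((q : ℝ) : ℂ) ^ (-m)) / (((q : ℝ) : ℂ) - ((q : ℝ) : ℂ)⁻¹)

theorem sub_inv_ne : ((q : ℝ) : ℂ) - ((q : ℝ) : ℂ)⁻¹ ≠ 0 := by
  have h0 := q.2.1
  have h1 := q.2.2
  rw [← Complex.ofReal_inv, ← Complex.ofReal_sub, Complex.ofReal_ne_zero]
  have := (one_lt_inv₀ h0).2 h1
  linarith

theorem qnum_zero : qnum q 0 = 0 := by simp [qnum]

theorem qnum_one : qnum q 1 = 1 := by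
  rw [qnum, zpow_one, zpow_neg_one, div_self (sub_inv_ne q)]

/-- This recursion matches adding one letter in `raise_word`; its variant with `q` and `q⁻¹`
exchanged does the same in `lower_word_succ`. -/
theorem qnum_add_one (m : ℤ) :
    qnum q (m + 1) = ((q : ℝ) : ℂ) ^ m + ((q : ℝ) : ℂ)⁻¹ * qnum q m := by
  have := q_ne q
  have := sub_inv_ne q
  rw [qnum, qnum, div_eq_iff this, add_mul, mul_assoc, div_mul_cancel₀ _ this, neg_add,
    zpow_add₀ (q_ne q), zpow_add₀ (q_ne q), zpow_one, zpow_neg_one]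
  ring

theorem qnum_add_one' (m : ℤ) :
    qnum q (m + 1) = ((q : ℝ) : ℂ) ^ (-m) + ((q : ℝ) : ℂ) * qnum q m := by
  have := q_ne q
  have := sub_inv_ne q
  rw [qnum, qnum, div_eq_iff this, add_mul, mul_assoc, div_mul_cancel₀ _ this, neg_add,
    zpow_add₀ (q_ne q), zpow_add₀ (q_ne q), zpow_one, zpow_neg_one]
  ring

theorem lower_word_zero (l : List (Fin 3)) : lower q (word q l 0) = 0 := by
  induction l with
  | nil => exact lower_one q
  | cons i l ih => rw [word, lower_mul, ih, (lower_u q i).1, mul_zero, zero_mul, add_zero]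

/-- Lowering the last letter leaves a column `1` letter to be reordered, at the cost of `q⁻ʳ` modulo
lower degree when `r` letters of column `2` precede it. Lowering an earlier letter brings the factor
`q` by which the torus acts on the last letter. The sum is the `q`-number. -/
theorem lower_word_succ (l : List (Fin 3)) {r : ℕ} (hr : r < l.length) :
    lower q (word q l (r + 1)) - qnum q (r + 1) • word q l r ∈ fil q l.length := by
  induction l generalizing r with
  | nil => simp at hr
  | cons i m ih =>
    rw [List.length_cons, Nat.lt_succ_iff] at hr
    rw [List.length_cons, word, lower_mul, (lower_u q i).2, torus_u, mul_smul_comm]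
    cases r with
    | zero =>
      simp [lower_word_zero, word, qnum_one]
    | succ r =>
      have h1 := word_mul_sub_mem q m i hr
      have h2 := fil_mul_lastCols_le q _ (Submodule.mul_mem_mul (ih hr) (u_mem_lastCols q i).2)
      convert add_mem h1 (Submodule.smul_mem _ ((q : ℝ) : ℂ) h2) using 1
      have h3 : qnum q (↑(r + 1) + 1) = (((q : ℝ) : ℂ)⁻¹ ^ (r + 1)) +
          ((q : ℝ) : ℂ) * qnum q (r + 1) := by
        rw [qnum_add_one', zpow_neg, zpow_natCast, inv_pow]
        push_cast
        rfl
      simp only [h3, word, sub_mul, smul_sub, smul_mul_assoc, add_smul, smul_smul, inv_inv,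
        Units.val_one, inv_one, mul_one, OU2.val_unit, Matrix.cons_val]
      abel

theorem torus_word (l : List (Fin 3)) (r : ℕ) : torus q 1 (OU2.unit q) (word q l r) =
    (((q : ℝ) : ℂ) ^ ((l.length : ℤ) - 2 * r)) • word q l r := by
  have hq := q_ne q
  induction l generalizing r with
  | nil => cases r <;> simp [word]
  | cons i m ih =>
    cases r with
    | zero =>
      rw [word, map_mul, ih, torus_u, smul_mul_smul_comm, List.length_cons]
      congr 1
    | succ r =>
      rw [word, map_mul, ih, torus_u, smul_mul_smul_comm, List.length_cons]
      congr 1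
      push_cast
      rw [show ((m.length : ℤ) + 1 - 2 * (r + 1)) = (m.length - 2 * r) + (-1) by ring,
        zpow_add₀ hq]
      simp

theorem torus_inv_word (l : List (Fin 3)) (r : ℕ) : torus q 1 (OU2.unit q)⁻¹ (word q l r) =
    (((q : ℝ) : ℂ) ^ (2 * r - (l.length : ℤ))) • word q l r := by
  have hq := q_ne q
  induction l generalizing r with
  | nil => cases r <;> simp [word]
  | cons i m ih =>
    cases r with
    | zero =>
      rw [word, map_mul, ih, torus_u, smul_mul_smul_comm, List.length_cons]
      congr 1
      push_cast
      rw [show (0 - ((m.length : ℤ) + 1)) = (0 - m.length) + (-1) by ring,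
        zpow_add₀ hq]
      simp
    | succ r =>
      rw [word, map_mul, ih, torus_u, smul_mul_smul_comm, List.length_cons]
      congr 1
      push_cast
      rw [show (2 * ((r : ℤ) + 1) - ((m.length : ℤ) + 1)) = (2 * r - m.length) + 1 by ring,
        zpow_add₀ hq]
      simp

theorem raise_word (l : List (Fin 3)) (r : ℕ) :
    raise q (word q l r) - qnum q (l.length - r) • word q l (r + 1) ∈ fil q l.length := by
  induction l generalizing r with
  | nil =>
    cases r with
    | zero => simp [word, raise_one]
    | succ r => simp [word]
  | cons i m ih =>
    rw [List.length_cons]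
    cases r with
    | zero =>
      have h2 := fil_mul_lastCols_le q _ (Submodule.mul_mem_mul (ih 0) (u_mem_lastCols q i).1)
      have h1 : qnum q m.length • (word q m 1 * u q i 1 -
          (((q : ℝ) : ℂ)⁻¹) • (word q m 0 * u q i 2)) ∈ fil q (m.length + 1) := by
        -- Reordering needs a letter to exchange with; for the empty word the coefficient `qnum q 0`
        -- vanishes instead.
        rcases Nat.eq_zero_or_pos m.length with h0 | h0
        · simp [h0, qnum_zero]
        · simpa only [zero_add, pow_one] using Submodule.smul_mem _ _ (word_mul_sub_mem q m i h0)
      rw [word, raise_mul, (raise_u q i).1, torus_word]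
      convert add_mem h1 h2 using 1
      simp only [Nat.cast_zero, mul_zero, sub_zero, word, Nat.cast_add, Nat.cast_one,
        qnum_add_one, zero_add, sub_mul, smul_sub, add_smul, smul_smul,
        smul_mul_assoc, zpow_natCast, mul_comm (qnum q _)]
      abel
    | succ r =>
      have h2 := fil_mul_lastCols_le q _ (Submodule.mul_mem_mul (ih r) (u_mem_lastCols q i).2)
      rw [word, raise_mul, (raise_u q i).2]
      convert h2 using 1
      simp only [mul_zero, zero_add, word, sub_mul, smul_mul_assoc, Nat.cast_add,
        Nat.cast_one, add_sub_add_right_eq_sub]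

theorem fil_succ (n : ℕ) : fil q (n + 2) = fil q (n + 1) * (1 ⊔ lastCols q) := by
  rw [fil, fil, pow_succ, mul_assoc]

theorem mul_mem_fil_succ {n : ℕ} {x y : OSU3 q} (hx : x ∈ fil q (n + 1))
    (hy : y ∈ 1 ⊔ lastCols q) : x * y ∈ fil q (n + 2) := by
  rw [fil_succ]
  exact Submodule.mul_mem_mul hx hy

/-- A linear map on `O(SU_q(3))` that is compatible with the columns preserves the filtration. -/
theorem map_mem_fil (f : Module.End ℂ (OSU3 q)) (h0 : ∀ x ∈ sphere q, f x ∈ sphere q)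
    (h : ∀ n, ∀ x ∈ fil q (n + 1), f x ∈ fil q (n + 1) → ∀ y ∈ 1 ⊔ lastCols q,
      f (x * y) ∈ fil q (n + 2)) {n : ℕ} {x : OSU3 q} (hx : x ∈ fil q n) : f x ∈ fil q n := by
  rw [← Submodule.mem_comap]
  revert x
  change fil q n ≤ _
  cases n with
  | zero => exact bot_le
  | succ n =>
    induction n with
    | zero => rw [zero_add, fil_one]; exact h0
    | succ n ih =>
      rw [fil_succ, Submodule.mul_le, ← fil_succ]
      exact fun x hx y hy => h n x hx (ih hx) y hy

theorem map_mem_one_sup_lastCols (f : Module.End ℂ (OSU3 q)) (h1 : f 1 ∈ 1 ⊔ lastCols q)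
    (h : ∀ i, f (u q i 1) ∈ lastCols q ∧ f (u q i 2) ∈ lastCols q) {y : OSU3 q}
    (hy : y ∈ 1 ⊔ lastCols q) : f y ∈ 1 ⊔ lastCols q := by
  have h2 : 1 ⊔ lastCols q ≤ (1 ⊔ lastCols q).comap f := by
    refine sup_le ?_ (lastCols_le q (fun i => Submodule.mem_sup_right (h i).1)
      fun i => Submodule.mem_sup_right (h i).2)
    rw [Submodule.one_le]
    exact h1
  exact h2 hy

theorem torus_mem_one_sup_lastCols (a : ℂˣ) {y : OSU3 q} (hy : y ∈ 1 ⊔ lastCols q) :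
    torus q 1 a y ∈ 1 ⊔ lastCols q := by
  refine map_mem_one_sup_lastCols q (torus q 1 a).toLinearMap ?_ (fun i => ?_) hy
  · rw [AlgHom.toLinearMap_apply, map_one]
    exact Submodule.mem_sup_left (Submodule.one_le.1 le_rfl)
  · rw [AlgHom.toLinearMap_apply, AlgHom.toLinearMap_apply, torus_u, torus_u]
    exact ⟨Submodule.smul_mem _ _ (u_mem_lastCols q i).1,
      Submodule.smul_mem _ _ (u_mem_lastCols q i).2⟩

theorem torus_mem_fil (a : ℂˣ) {n : ℕ} {x : OSU3 q} (hx : x ∈ fil q n) :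
    torus q 1 a x ∈ fil q n := by
  refine map_mem_fil q (torus q 1 a).toLinearMap (fun x hx => ?_) (fun n x hx hfx y hy => ?_) hx
  · rw [AlgHom.toLinearMap_apply, (operators_of_mem_sphere q hx a).2.2]
    exact hx
  · rw [AlgHom.toLinearMap_apply, map_mul]
    exact mul_mem_fil_succ q hfx (torus_mem_one_sup_lastCols q a hy)

theorem lower_mem_fil {n : ℕ} {x : OSU3 q} (hx : x ∈ fil q n) : lower q x ∈ fil q n := by
  refine map_mem_fil q (lower q) (fun x hx => ?_) (fun n x hx hfx y hy => ?_) hx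
  · rw [(operators_of_mem_sphere q hx 1).1]
    exact (sphere q).zero_mem
  · rw [lower_mul]
    refine add_mem (mul_mem_fil_succ q hx (map_mem_one_sup_lastCols q _ ?_ (fun i => ?_) hy))
      (mul_mem_fil_succ q hfx (torus_mem_one_sup_lastCols q _ hy))
    · rw [lower_one]
      exact zero_mem _
    · rw [(lower_u q i).1, (lower_u q i).2]
      exact ⟨zero_mem _, (u_mem_lastCols q i).1⟩

theorem raise_mem_fil {n : ℕ} {x : OSU3 q} (hx : x ∈ fil q n) : raise q x ∈ fil q n := by
  refine map_mem_fil q (raise q) (fun x hx => ?_) (fun n x hx hfx y hy => ?_) hx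
  · rw [(operators_of_mem_sphere q hx 1).2.1]
    exact (sphere q).zero_mem
  · rw [raise_mul]
    refine add_mem (mul_mem_fil_succ q (torus_mem_fil q _ hx)
      (map_mem_one_sup_lastCols q _ ?_ (fun i => ?_) hy)) (mul_mem_fil_succ q hfx hy)
    · rw [raise_one]
      exact zero_mem _
    · rw [(raise_u q i).1, (raise_u q i).2]
      exact ⟨(u_mem_lastCols q i).2, zero_mem _⟩

/-- The Casimir operator. -/
def casimir : Module.End ℂ (OSU3 q) :=
  ((((q : ℝ) : ℂ) - ((q : ℝ) : ℂ)⁻¹) ^ 2) • (raise q ∘ₗ lower q) +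
    ((q : ℝ) : ℂ) • (torus q 1 (OU2.unit q)).toLinearMap +
    ((q : ℝ) : ℂ)⁻¹ • (torus q 1 (OU2.unit q)⁻¹).toLinearMap

theorem casimir_apply (x : OSU3 q) : casimir q x =
    ((((q : ℝ) : ℂ) - ((q : ℝ) : ℂ)⁻¹) ^ 2) • raise q (lower q x) +
    ((q : ℝ) : ℂ) • torus q 1 (OU2.unit q) x + ((q : ℝ) : ℂ)⁻¹ • torus q 1 (OU2.unit q)⁻¹ x := rfl

theorem casimir_mem_fil {n : ℕ} {x : OSU3 q} (hx : x ∈ fil q n) : casimir q x ∈ fil q n := by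
  rw [casimir_apply]
  exact add_mem (add_mem (Submodule.smul_mem _ _ (raise_mem_fil q (lower_mem_fil q hx)))
    (Submodule.smul_mem _ _ (torus_mem_fil q _ hx))) (Submodule.smul_mem _ _ (torus_mem_fil q _ hx))

theorem casimir_sphere_mul {s : OSU3 q} (hs : s ∈ sphere q) (x : OSU3 q) :
    casimir q (s * x) = s * casimir q x := by
  rw [casimir_apply, casimir_apply, lower_sphere_mul q hs, raise_sphere_mul q hs, map_mul, map_mul,
    (operators_of_mem_sphere q hs _).2.2, (operators_of_mem_sphere q hs _).2.2]
  simp only [mul_add, mul_smul_comm]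

theorem casimir_of_mem_coinvariants {x : OSU3 q} (hx : x ∈ coinvariants (coaction q)) :
    casimir q x = (((q : ℝ) : ℂ) + ((q : ℝ) : ℂ)⁻¹) • x := by
  rw [casimir_apply, (operators_of_mem_coinvariants q hx 1).1,
    (operators_of_mem_coinvariants q hx _).2.2, (operators_of_mem_coinvariants q hx _).2.2,
    map_zero, smul_zero, zero_add, add_smul]

/-- The eigenvalues of the Casimir operator. -/
def casimirValue (n : ℕ) : ℂ := ((q : ℝ) : ℂ) ^ (n + 1) + ((q : ℝ) : ℂ)⁻¹ ^ (n + 1)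

theorem qnum_mul_qnum (m n : ℤ) : (((q : ℝ) : ℂ) - ((q : ℝ) : ℂ)⁻¹) ^ 2 * (qnum q m * qnum q n) =
    (((q : ℝ) : ℂ) ^ m - ((q : ℝ) : ℂ) ^ (-m)) * (((q : ℝ) : ℂ) ^ n - ((q : ℝ) : ℂ) ^ (-n)) := by
  have h := sub_inv_ne q
  rw [qnum, qnum]
  generalize ((q : ℝ) : ℂ) - ((q : ℝ) : ℂ)⁻¹ = d at h ⊢
  field_simp

/-- Raising after lowering multiplies the word by `[r+1][n-r]` modulo lower degree, where `n` is its
length. Together with the torus terms this depends on `n` only. -/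
theorem casimir_word (l : List (Fin 3)) (r : ℕ) :
    casimir q (word q l r) - casimirValue q l.length • word q l r ∈ fil q l.length := by
  have hq := q_ne q
  rcases lt_or_ge l.length r with hr | hr
  · rw [word_eq_zero q l r hr, map_zero, smul_zero, sub_zero]
    exact zero_mem _
  cases r with
  | zero =>
    convert zero_mem (fil q l.length) using 1
    rw [casimir_apply, lower_word_zero, map_zero, smul_zero, zero_add, torus_word, torus_inv_word,
      smul_smul, smul_smul, ← add_smul, ← sub_smul, casimirValue]
    simp [zpow_neg, pow_succ', -Complex.coe_smul]
  | succ r =>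
    have h1 := raise_mem_fil q (lower_word_succ q l hr)
    have h2 := Submodule.smul_mem _ (qnum q (r + 1)) (raise_word q l r)
    have h3 := Submodule.smul_mem _ ((((q : ℝ) : ℂ) - ((q : ℝ) : ℂ)⁻¹) ^ 2) (add_mem h1 h2)
    convert h3 using 1
    -- Expanding `(q^a - q^(-a)) (q^b - q^(-b))` with `a = r + 1` and `b = n - r`, the mixed terms
    -- cancel the torus contributions and leave `q^(n+1) + q^(-(n+1))`.
    have e : casimirValue q l.length = ((((q : ℝ) : ℂ) - ((q : ℝ) : ℂ)⁻¹) ^ 2) *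
        (qnum q (r + 1) * qnum q (l.length - r)) +
        ((q : ℝ) : ℂ) * ((q : ℝ) : ℂ) ^ ((l.length : ℤ) - 2 * ↑(r + 1)) +
        ((q : ℝ) : ℂ)⁻¹ * ((q : ℝ) : ℂ) ^ (2 * ↑(r + 1) - (l.length : ℤ)) := by
      rw [qnum_mul_qnum, ← zpow_one_add₀ hq, ← zpow_neg_one ((q : ℝ) : ℂ), ← zpow_add₀ hq, sub_mul,
        mul_sub, mul_sub, ← zpow_add₀ hq, ← zpow_add₀ hq, ← zpow_add₀ hq, ← zpow_add₀ hq,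
        casimirValue, inv_pow, ← zpow_natCast, ← zpow_neg]
      push_cast
      ring_nf
    rw [casimir_apply, torus_word, torus_inv_word, e, map_sub, map_smul]
    simp only [add_smul, smul_sub, smul_add, smul_smul]
    abel

/-- Every element of the filtration is a combination of ordered words up to lower terms. -/
theorem fil_le_words (n : ℕ) : fil q (n + 1) ≤ fil q n ⊔ sphereSpace q *
    Submodule.span ℂ {x | ∃ l r, l.length = n ∧ x = word q l r} := by
  induction n with
  | zero =>
    rw [zero_add, fil_one]
    refine le_sup_of_le_right ?_
    refine le_mul_of_one_le_right' ?_
    rw [Submodule.one_le]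
    exact Submodule.subset_span ⟨[], 0, rfl, rfl⟩
  | succ n ih =>
    set W := Submodule.span ℂ {x | ∃ l r, l.length = n ∧ x = word q l r}
    set W' := Submodule.span ℂ {x | ∃ l r, l.length = n + 1 ∧ x = word q l r}
    -- Appending a letter of column `2` to a word gives a word; a letter of column `1` is first
    -- reordered by `word_mul_sub_mem`, up to terms of lower degree.
    have h1 : W * lastCols q ≤ fil q (n + 1) ⊔ W' := by
      have key : ∀ x ∈ W, (∀ i, x * u q i 1 ∈ fil q (n + 1) ⊔ W') ∧
          ∀ i, x * u q i 2 ∈ fil q (n + 1) ⊔ W' := fun x hx => by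
        induction hx using Submodule.span_induction with
        | mem x hx =>
          obtain ⟨l, r, rfl, rfl⟩ := hx
          have h2 : ∀ r i, word q l r * u q i 2 ∈ fil q (l.length + 1) ⊔ W' := fun r i =>
            Submodule.mem_sup_right (Submodule.subset_span ⟨i :: l, r + 1, rfl, rfl⟩)
          refine ⟨fun i => ?_, h2 r⟩
          cases r with
          | zero => exact Submodule.mem_sup_right (Submodule.subset_span ⟨i :: l, 0, rfl, rfl⟩)
          | succ r =>
            rcases lt_or_ge r l.length with hr | hr
            · have h3 := add_mem (Submodule.mem_sup_left (word_mul_sub_mem q l i hr) :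
                _ ∈ fil q (l.length + 1) ⊔ W')
                (Submodule.smul_mem _ (((q : ℝ) : ℂ)⁻¹ ^ (r + 1)) (h2 r i))
              rwa [sub_add_cancel] at h3
            -- Here the word asks for more column `2` letters than its length, so it is zero by
            -- convention.
            · rw [word_eq_zero q l _ (Nat.lt_succ_of_le hr), zero_mul]
              exact zero_mem _
        | zero => simp
        | add x y _ _ hx hy =>
          simp only [add_mul]
          exact ⟨fun i => add_mem (hx.1 i) (hy.1 i), fun i => add_mem (hx.2 i) (hy.2 i)⟩
        | smul c x _ hx =>
          simp only [smul_mul_assoc]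
          exact ⟨fun i => Submodule.smul_mem _ _ (hx.1 i),
            fun i => Submodule.smul_mem _ _ (hx.2 i)⟩
      rw [Submodule.mul_le]
      intro x hx y hy
      exact lastCols_le q (p := (fil q (n + 1) ⊔ W').comap (LinearMap.mulLeft ℂ x)) (key x hx).1
        (key x hx).2 hy
    calc fil q (n + 1 + 1) = fil q (n + 1) ⊔ fil q (n + 1) * lastCols q := by
          rw [fil_succ, Submodule.mul_sup, mul_one]
      _ ≤ fil q (n + 1) ⊔ (fil q n ⊔ sphereSpace q * W) * lastCols q := by gcongr
      _ = fil q (n + 1) ⊔ (fil q n * lastCols q ⊔ sphereSpace q * (W * lastCols q)) := by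
          rw [Submodule.sup_mul, mul_assoc]
      _ ≤ fil q (n + 1) ⊔ (fil q (n + 1) ⊔ sphereSpace q * (fil q (n + 1) ⊔ W')) := by
          gcongr; exact fil_mul_lastCols_le q n
      _ ≤ fil q (n + 1) ⊔ sphereSpace q * W' := by
          rw [Submodule.mul_sup]
          refine sup_le le_sup_left (sup_le le_sup_left (sup_le_sup (sphere_mul_fil_le q _) le_rfl))

/-- The Casimir operator acts on the quotients of the filtration by scalars. -/
theorem casimir_sub_mem {n : ℕ} {x : OSU3 q} (hx : x ∈ fil q (n + 1)) :
    casimir q x - casimirValue q n • x ∈ fil q n := by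
  have h : fil q (n + 1) ≤ (fil q n).comap
      (casimir q - casimirValue q n • (LinearMap.id : Module.End ℂ (OSU3 q))) := by
    refine (fil_le_words q n).trans (sup_le (fun x hx => ?_) ?_)
    · exact sub_mem (casimir_mem_fil q hx) (Submodule.smul_mem _ _ hx)
    · rw [Submodule.mul_le]
      intro s hs y hy
      have h1 : casimir q y - casimirValue q n • y ∈ fil q n := by
        induction hy using Submodule.span_induction with
        | mem x hx =>
          obtain ⟨l, r, rfl, rfl⟩ := hx
          exact casimir_word q l r
        | zero => simp
        | add x y _ _ hx hy =>
          convert add_mem hx hy using 1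
          rw [map_add, smul_add]
          abel
        | smul c x _ hx =>
          convert Submodule.smul_mem _ c hx using 1
          rw [map_smul, smul_sub, smul_comm]
      have h2 := sphere_mul_fil_le q n (Submodule.mul_mem_mul hs h1)
      have e : (casimir q - casimirValue q n • (LinearMap.id : Module.End ℂ (OSU3 q))) (s * y) =
          s * (casimir q y - casimirValue q n • y) := by
        rw [LinearMap.sub_apply, casimir_sphere_mul q hs, LinearMap.smul_apply, LinearMap.id_apply,
          mul_sub, mul_smul_comm]
      rw [Submodule.mem_comap, e]
      exact h2
  exact h hx

/-- The difference equals `-(1 - q^(n+1)) (1 - q^(n+3)) / q^(n+2)`, which is nonzero because `0 < q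
< 1`. -/
theorem casimirValue_ne (n : ℕ) :
    ((q : ℝ) : ℂ) + ((q : ℝ) : ℂ)⁻¹ - casimirValue q (n + 1) ≠ 0 := by
  have h0 := q.2.1
  have h1 := q.2.2
  have hq := q_ne q
  have e : (((q : ℝ) : ℂ) + ((q : ℝ) : ℂ)⁻¹ - casimirValue q (n + 1)) =
      ((-((1 - (q : ℝ) ^ (n + 1)) * (1 - (q : ℝ) ^ (n + 3)) / (q : ℝ) ^ (n + 2)) : ℝ) : ℂ) := by
    rw [casimirValue]
    push_cast
    rw [inv_pow]
    field_simp
    ring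
  rw [e, Complex.ofReal_ne_zero]
  have h2 : 0 < 1 - (q : ℝ) ^ (n + 1) := sub_pos.2 (pow_lt_one₀ h0.le h1 (by simp))
  have h3 : 0 < 1 - (q : ℝ) ^ (n + 3) := sub_pos.2 (pow_lt_one₀ h0.le h1 (by simp))
  have h4 : 0 < (q : ℝ) ^ (n + 2) := pow_pos h0 _
  exact neg_ne_zero.2 (by positivity)

theorem coinvariants_le_sphere :
    coinvariants (coaction q) ≤ (sphere q).toSubalgebra := by
  intro x hx
  -- For a coinvariant of degree at most `n + 1`, the Casimir operator shows that a nonzero multiple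
  -- of it has degree at most `n`; descent ends in the sphere.
  have key : ∀ n, x ∈ fil q (n + 1) → x ∈ fil q 1 := fun n => by
    induction n with
    | zero => exact id
    | succ n ih =>
      intro h
      have h1 := casimir_sub_mem q h
      rw [casimir_of_mem_coinvariants q hx, ← sub_smul] at h1
      exact ih ((Submodule.smul_mem_iff _ (casimirValue_ne q n)).1 h1)
  obtain ⟨n, hn⟩ := exists_mem_fil q x
  have := key n hn
  rw [fil_one] at this
  exact this

end OSU3

/-! ### The coinvariants -/

namespace OU2

/-- The central unitary generator as an invertible element. -/
def uUnit : (OU2 q)ˣ := ⟨u q, star (u q), (triple q).tt', (triple q).tt⟩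

theorem character_uUnit_zpow (t a : ℂˣ) (n : ℤ) :
    character q t a ↑(uUnit q ^ n) = ((t ^ n : ℂˣ) : ℂ) := by
  have h : Units.map (character q t a : OU2 q →* ℂ) (uUnit q) = t :=
    Units.ext (character_v q t a 0 0)
  have h1 := congrArg (fun x : ℂˣ => ((x ^ n : ℂˣ) : ℂ)) h
  simp only [← map_zpow] at h1
  exact h1

end OU2

namespace OSU3

/-- Gauge transformations are the coaction followed by characters of `O(U_q(2))`, which is why
coinvariants are gauge invariant. -/
theorem gauge_eq_torus (z : Circle × Circle) (x : OSU3 q) :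
    gauge q z x = torus q (Circle.toUnits z.1) (Circle.toUnits z.2) x := by
  have h : (gauge q z).toAlgHom = torus q (Circle.toUnits z.1) (Circle.toUnits z.2) := by
    refine algHom_ext (fun i j => ?_) fun i j => ?_
    · rw [torus_u]
      refine (ofMatrix_u _ _ i j).trans ?_
      congr 1
      fin_cases j <;> simp [phase]
    · rw [torus_star_u]
      refine (map_star (gauge q z) _).trans ((congrArg star (ofMatrix_u _ _ i j)).trans ?_)
      rw [star_smul]
      congr 1
      fin_cases j <;> simp [phase, ← Circle.coe_inv_eq_conj, mul_comm]
  exact congrArg (fun f : OSU3 q →ₐ[ℂ] OSU3 q => f x) h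

theorem coinvariants_le_flag : coinvariants (coaction q) ≤ (flag q).toSubalgebra := by
  intro x hx
  have h : ∀ z, gauge q z x = x := fun z => by
    rw [gauge_eq_torus]
    exact torus_of_map_coaction q _ _ (map_coaction_of_mem_coinvariants q _ hx)
  rw [StarSubalgebra.mem_toSubalgebra, flag, StarSubalgebra.mem_iInf]
  exact h

/-- The elements on which the coaction is given by a power of the central unitary. -/
def homogeneous (n : ℤ) : Submodule ℂ (OSU3 q) :=
  LinearMap.eqLocus (coaction q).toLinearMap
    ((TensorProduct.mk ℂ (OSU3 q) (OU2 q)).flip ↑(OU2.uUnit q ^ n))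

theorem mem_homogeneous {n : ℤ} {x : OSU3 q} :
    x ∈ homogeneous q n ↔ coaction q x = x ⊗ₜ ↑(OU2.uUnit q ^ n) := Iff.rfl

theorem homogeneous_mul_le (m n : ℤ) :
    homogeneous q m * homogeneous q n ≤ homogeneous q (m + n) := by
  rw [Submodule.mul_le]
  intro x hx y hy
  rw [mem_homogeneous] at *
  rw [map_mul, hx, hy, Algebra.TensorProduct.tmul_mul_tmul, zpow_add, Units.val_mul]

theorem torus_of_mem_homogeneous (t a : ℂˣ) {n : ℤ} {x : OSU3 q} (hx : x ∈ homogeneous q n) :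
    torus q t a x = ((t ^ n : ℂˣ) : ℂ) • x := by
  rw [mem_homogeneous] at hx
  rw [← OU2.character_uUnit_zpow q t a n]
  simp [torus, hx, -Complex.coe_smul]

/-- The first column coacts by `u` and its adjoints by `u⁻¹`; degrees add under products, so sums of
homogeneous elements form a subalgebra containing the sphere. -/
theorem sphere_le_iSup_homogeneous : sphereSpace q ≤ ⨆ n, homogeneous q n := by
  let s : Subalgebra ℂ (OSU3 q) := (⨆ n, homogeneous q n).toSubalgebra
    (Submodule.mem_iSup_of_mem 0 (by
      rw [mem_homogeneous, zpow_zero, map_one]; rfl))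
    (fun x y hx hy => by
      have h := Submodule.mul_mem_mul hx hy
      simp only [Submodule.iSup_mul, Submodule.mul_iSup] at h
      exact (iSup_le fun m => iSup_le fun n =>
        (homogeneous_mul_le q _ _).trans (le_iSup (homogeneous q) _)) h)
  have h : OU2.v q 1 0 = 0 ∧ OU2.v q 2 0 = 0 := ⟨rfl, rfl⟩
  refine sphere_le q s (fun i => Submodule.mem_iSup_of_mem 1 ?_)
    fun i => Submodule.mem_iSup_of_mem (-1) ?_
  · rw [mem_homogeneous, zpow_one, coaction_u]
    simp [Fin.sum_univ_three, h]
    rfl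
  · rw [mem_homogeneous, zpow_neg_one, coaction_star_u]
    simp only [Fin.sum_univ_three, h, star_zero, TensorProduct.tmul_zero, add_zero]
    rfl

/-- A coincidence of powers of `e^i` would make a nonzero integer multiple of `π` an integer. One
gauge transformation therefore separates all degrees. -/
theorem exp_one_zpow_injective :
    Function.Injective fun n : ℤ => ((Circle.toUnits (Circle.exp 1) ^ n : ℂˣ) : ℂ) := by
  intro m n h
  have h1 : Circle.toUnits (Circle.exp 1) ^ (m - n) = 1 := by
    rw [zpow_sub, Units.ext h, mul_inv_cancel]
  have h2 : Complex.exp (((m - n : ℤ) : ℂ) * Complex.I) = 1 := by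
    have := congrArg Units.val h1
    rw [Complex.exp_int_mul]
    simpa using this
  obtain ⟨k, hk⟩ := Complex.exp_eq_one_iff.1 h2
  have h3 : ((m - n : ℤ) : ℝ) = (2 * k : ℤ) * Real.pi := by
    have h4 : ((m - n : ℤ) : ℂ) = ((2 * k : ℤ) : ℂ) * (Real.pi : ℂ) := by
      have := mul_right_cancel₀ (b := Complex.I) Complex.I_ne_zero (hk.trans (by ring :
        (k : ℂ) * (2 * Real.pi * Complex.I) = (2 * k * Real.pi) * Complex.I))
      rw [this]
      push_cast
      ring
    exact_mod_cast h4
  by_contra hne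
  have hk0 : (2 * k : ℤ) ≠ 0 := by
    intro h0
    rw [h0, Int.cast_zero, zero_mul, Int.cast_eq_zero] at h3
    exact hne (sub_eq_zero.1 h3)
  refine (irrational_pi.intCast_mul hk0).ne_int (m - n) h3.symm

theorem projectivePlane_le_coinvariants :
    (projectivePlane q).toSubalgebra ≤ coinvariants (coaction q) := by
  intro x hx
  obtain ⟨hf, hs⟩ : x ∈ flag q ∧ x ∈ sphere q := hx
  set t := Circle.toUnits (Circle.exp 1)
  set f : Module.End ℂ (OSU3 q) := (torus q t 1).toLinearMap
  have hfx : f x = x := by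
    rw [flag, StarSubalgebra.mem_iInf] at hf
    have h := hf (Circle.exp 1, 1)
    have h1 : gauge q (Circle.exp 1, 1) x = x := h
    rw [gauge_eq_torus] at h1
    exact (congrArg (fun a => torus q t a x) (map_one Circle.toUnits).symm).trans h1
  have hle : ∀ n, homogeneous q n ≤ f.eigenspace ((t ^ n : ℂˣ) : ℂ) := fun n y hy =>
    Module.End.mem_eigenspace_iff.2 (torus_of_mem_homogeneous q t 1 hy)
  have hind := (Module.End.eigenspaces_iSupIndep f).comp exp_one_zpow_injective
  have hx' := sphere_le_iSup_homogeneous q hs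
  -- The component `y` has degree `0` and `z` collects all other degrees. Since `y + z` and `y` are
  -- fixed by the torus element, so is `z`; independence of eigenspaces with distinct eigenvalues
  -- then gives `z = 0`.
  rw [iSup_split_single (homogeneous q) 0] at hx'
  obtain ⟨y, hy, z, hz, rfl⟩ := Submodule.mem_sup.1 hx'
  have hz' : z = 0 := by
    have h1 : z ∈ f.eigenspace ((t ^ (0 : ℤ) : ℂˣ) : ℂ) := by
      have h2 := Submodule.sub_mem _ (Module.End.mem_eigenspace_iff.2
        (by rw [hfx, zpow_zero, Units.val_one, one_smul] :
          f (y + z) = ((t ^ (0 : ℤ) : ℂˣ) : ℂ) • (y + z))) (hle 0 hy)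
      rwa [add_sub_cancel_left] at h2
    exact Submodule.disjoint_def.1 (hind 0) z h1 (iSup₂_mono (fun n _ => hle n) hz)
  rw [hz', add_zero, mem_coinvariants, (mem_homogeneous q).1 hy, zpow_zero, Units.val_one]

end OSU3

end QBundle

end

theorem mainTheorem2 (q : Set.Ioo (0 : ℝ) 1) :
    QBundle.IsPrincipalComoduleAlgebra (QBundle.coaction q) ∧
      QBundle.coinvariants (QBundle.coaction q) =
        (QBundle.OSU3.projectivePlane q).toSubalgebra :=
  ⟨QBundle.isPrincipalComoduleAlgebra_coaction q,
    le_antisymm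
      (fun _ hx => ⟨QBundle.OSU3.coinvariants_le_flag q hx,
        QBundle.OSU3.coinvariants_le_sphere q hx⟩)
      (QBundle.OSU3.projectivePlane_le_coinvariants q)⟩
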